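/- Let $R$ be a commutative Noetherian local ring with maximal ideal $\mathfrak m$; write $M^*=\operatorname{Hom}_R(M,R)$. Definitions. Complexes are graded homologically over $\mathbb Z$, and $C_n(T)=\operatorname{Coker}(T_{n+1}\to T_n)$. An acyclic complex $T$ of projective $R$-modules is totally acyclic if $\operatorname{Hom}_R(T,Q)$ is acyclic for every projective $R$-module $Q$. A finitely generated module $G$ is totally reflexive if the biduality map $G\to G^{**}$ is an isomorphism and $\operatorname{Ext}^i_R(G,R)=0=\operatorname{Ext}^i_R(G^*,R)$ for all $i\ge 1$. A complete (projective) resolution of $G$ is a totally acyclic complex $T$ of finitely generated free modules with $C_0(T)\cong G$; then $\widehat{\operatorname{Tor}}_i(G,N)=H_i(T\otimes_R N)$ and $\widehat{\operatorname{Ext}}^i(G,N)=H_{-i}(\operatorname{Hom}_R(T,N))$ for every module $N$ and every $i\in\mathbb Z$. A complex $F$ of finitely generated free modules is minimal if $\partial(F)\subseteq\mathfrak mF$. The pinched tensor product $T\boxtimes T'$ of two complexes is the complex with $$(T\boxtimes T')_n=\begin{cases}\bigoplus_{p+q=n,\ p,q\ge 0}T_p\otimes_R T'_q & n\ge 0,\\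 \bigoplus_{p+q=n-1,\ p,q\le -1}T_p\otimes_R T'_q & n\le -1,\end{cases}$$ whose differential maps $x\otimes y$, with $x\in T_p$ and $y\in T'_q$, to $\partial x\otimes y+(-1)^p x\otimes\partial y$ in degrees $n\ge 1$ (terms outside the nonnegative quadrant being zero), to $\partial x\otimes y-(-1)^p x\otimes\partial y$ in degrees $n\le -1$, and to $\partial x\otimes\partial y$ in degree $n=0$. The stable Betti number $\widehat\beta_n(G)$ of $G$ is the rank of $T_n$ for a minimal complete resolution $T\xrightarrow{\tau}P\to G$, that is, $P\to G$ is a projective resolution, $T$ is totally acyclic, $\tau_i$ is an isomorphism for $i\gg 0$, and $T$ and $P$ are minimal complexes of finitely generated free modules. Theorem. Let $M$ and $N$ be totally reflexive $R$-modules with complete resolutions $T$ and $T'$ (so $C_0(T)\cong M$ and $C_0(T')\cong N$), and assume that $\widehat{\operatorname{Tor}}_i(M,N)=0$ for all $i\in\mathbb Z$. Then the complex $T\boxtimes T'$ of finitely generated free $R$-modules is acyclic with $C_0(T\boxtimes T')\cong M\otimes_R N$, and the following conditions are equivalent: (i) the complex $T\boxtimes T'$ is totally acyclic; (ii) $\widehat{\operatorname{Ext}}^i(M,N^*)=0$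 for all $i\in\mathbb Z$; (iii) the module $M\otimes_R N$ is totally reflexive. When these conditions hold, $T\boxtimes T'$ is a complete resolution of $M\otimes_R N$, and moreover: (a) If $T$ and $T'$ are minimal, then $T\boxtimes T'$ is minimal. Conversely, if $T\boxtimes T'$ is minimal, then $T$ and $T'$ are minimal, provided that $M$ and $N$ are nonzero and that $R$ is a direct summand of both or of neither of them. (b) Assume that neither $M$ nor $N$ has $R$ as a direct summand or, more generally, that $N$ is free if $R$ is a direct summand of $M$, and $M$ is free if $R$ is a direct summand of $N$. Then $M$, $N$ and $M\otimes_R N$ have minimal complete resolutions in the above sense, and $$\widehat\beta_i(M\otimes_R N)=\begin{cases}\sum_{0\le j\le i}\widehat\beta_j(M)\,\widehat\beta_{i-j}(N) & \text{for } i\ge 0,\\ \sum_{i\le j<0}\widehat\beta_j(M)\,\widehat\beta_{i-j-1}(N) & \text{for } i<0.\end{cases}$$ -/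

import Mathlib

open CategoryTheory
open scoped TensorProduct

universe u

noncomputable section

namespace Pinched

variable {R : Type u} [CommRing R]

/-- The complex `T ⊗_R N`, for an `R`-complex `T` and an `R`-module `N`. -/
def tensorComplex (T : ChainComplex (ModuleCat.{u} R) ℤ)
    (N : Type u) [AddCommGroup N] [Module R N] : ChainComplex (ModuleCat.{u} R) ℤ where
  X n := ModuleCat.of R (T.X n ⊗[R] N)
  d n m := ModuleCat.ofHom (LinearMap.rTensor N (T.d n m).hom)
  shape n m h := by
    rw [T.shape n m h]
    ext1
    exact LinearMap.rTensor_zero N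
  d_comp_d' n m k _ _ := by
    rw [← ModuleCat.ofHom_comp, ← LinearMap.rTensor_comp, ← ModuleCat.hom_comp, T.d_comp_d]
    ext1
    exact LinearMap.rTensor_zero N

/-- The complex `Hom_R(T, N)`, for an `R`-complex `T` and an `R`-module `N`: in degree `n` it is
`Hom_R(T_{-n}, N)`, and the differential maps `φ` of degree `n` to `-(-1)^n φ ∘ d`. -/
def homComplex (T : ChainComplex (ModuleCat.{u} R) ℤ)
    (N : Type u) [AddCommGroup N] [Module R N] : ChainComplex (ModuleCat.{u} R) ℤ where
  X n := ModuleCat.of R (T.X (-n) →ₗ[R] N)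
  d n m := ModuleCat.ofHom (-(n.negOnePow • LinearMap.lcomp R N (T.d (-m) (-n)).hom))
  shape n m h := by
    have h' : ¬ (ComplexShape.down ℤ).Rel (-m) (-n) := by
      simp only [ComplexShape.down_Rel] at h ⊢
      omega
    rw [T.shape _ _ h']
    ext φ x
    simp
  d_comp_d' n m k _ _ := by
    have h : ∀ x : T.X (-k), (T.d (-m) (-n)).hom ((T.d (-k) (-m)).hom x) = 0 := fun x => by
      rw [← LinearMap.comp_apply, ← ModuleCat.hom_comp, T.d_comp_d]
      rfl
    ext φ x
    simp [h, Units.smul_def]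

/-- An acyclic complex `T` of projective `R`-modules is totally acyclic if `Hom_R(T, Q)` is
acyclic for every projective `R`-module `Q`. -/
structure IsTotallyAcyclic (T : ChainComplex (ModuleCat.{u} R) ℤ) : Prop where
  projective : ∀ n, Module.Projective R (T.X n)
  acyclic : T.Acyclic
  acyclic_hom : ∀ (Q : Type u) [AddCommGroup Q] [Module R Q], Module.Projective R Q →
    (homComplex T Q).Acyclic

/-- The module `C_n(T)`, the cokernel of the differential `T_{n+1} → T_n`. -/
abbrev Coker (T : ChainComplex (ModuleCat.{u} R) ℤ) (n : ℤ) : Type u :=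
  T.X n ⧸ LinearMap.range (T.d (n + 1) n).hom

/-- `T` is a complete projective resolution of the module `G`: it is a totally acyclic complex of
projective modules with `C_0(T) ≅ G`. The actual diagram is `T ⟶ T_{≥ 0} ⟶ G`. -/
structure IsCompleteResolutionOf (T : ChainComplex (ModuleCat.{u} R) ℤ)
    (G : Type u) [AddCommGroup G] [Module R G] : Prop where
  totallyAcyclic : IsTotallyAcyclic T
  coker_equiv : Nonempty (Coker T 0 ≃ₗ[R] G)

/-- Tate homology `H_i(T ⊗_R N)` with coefficients in `N` of the module with complete projective
resolution `T`. -/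
abbrev tateTor (T : ChainComplex (ModuleCat.{u} R) ℤ)
    (N : Type u) [AddCommGroup N] [Module R N] (i : ℤ) : ModuleCat.{u} R :=
  (tensorComplex T N).homology i

/-- Tate cohomology `H_{-i}(Hom_R(T, N))` with coefficients in `N` of the module with complete
projective resolution `T`. -/
abbrev tateExt (T : ChainComplex (ModuleCat.{u} R) ℤ)
    (N : Type u) [AddCommGroup N] [Module R N] (i : ℤ) : ModuleCat.{u} R :=
  (homComplex T N).homology (-i)

variable (R) in
/-- Totally reflexive modules: finitely generated, reflexive (the biduality map is bijective), with
`Ext^i(G, R) = 0 = Ext^i(G^*, R)` for all `i ≥ 1`. -/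
structure IsTotallyReflexive (G : Type u) [AddCommGroup G] [Module R G] : Prop where
  finite : Module.Finite R G
  reflexive : Module.IsReflexive R G
  ext_eq_zero : ∀ i : ℕ, 1 ≤ i →
    Subsingleton (Abelian.Ext (ModuleCat.of R G) (ModuleCat.of R R) i)
  ext_dual_eq_zero : ∀ i : ℕ, 1 ≤ i →
    Subsingleton (Abelian.Ext (ModuleCat.of R (Module.Dual R G)) (ModuleCat.of R R) i)

/-! ### The pinched tensor product -/

/-- The pairs `(p, q)` for which `T_p ⊗ A_q` is a summand of the pinched tensor product in
degree `n`. The first alternative describes `(T_{≥ 0} ⊗ A_{≥ 0})_n` and forces `0 ≤ n`. The second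
one describes `(T_{≤ -1} ⊗ Σ(A_{≤ -1}))_n` and forces `n ≤ -1`; here `A_q` sits in
degree `q + 1` of `Σ A`. -/
def IsIndex (n p q : ℤ) : Prop :=
  (0 ≤ p ∧ 0 ≤ q ∧ p + q = n) ∨ (p < 0 ∧ q < 0 ∧ p + (q + 1) = n)

instance (n p q : ℤ) : Decidable (IsIndex n p q) := by
  unfold IsIndex
  infer_instance

/-- The set of all pairs as in `IsIndex`. -/
abbrev Index (n : ℤ) : Type := {x : ℤ × ℤ // IsIndex n x.1 x.2}

/-- The module in degree `n` of the pinched tensor product. -/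
abbrev pinchedX (T A : ChainComplex (ModuleCat.{u} R) ℤ) (n : ℤ) : Type u :=
  DirectSum (Index n) fun x => T.X x.1.1 ⊗[R] A.X x.1.2

/-- The map `T_p ⊗ A_q ⟶ (T ⊠ A)_n` that is the inclusion of a summand if `(p, q)` is an index
in degree `n`, and zero otherwise. -/
def pinchedι (T A : ChainComplex (ModuleCat.{u} R) ℤ) (n p q : ℤ) :
    T.X p ⊗[R] A.X q →ₗ[R] pinchedX T A n :=
  if h : IsIndex n p q then
    DirectSum.lof R (Index n) (fun x => T.X x.1.1 ⊗[R] A.X x.1.2) ⟨(p, q), h⟩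
  else 0

/-- The restriction to `T_p ⊗ A_q` of the differential `(T ⊠ A)_n ⟶ (T ⊠ A)_m`, where `m + 1 = n`.
The first two summands are the differential of `T_{≥ 0} ⊗ A_{≥ 0}`, or of
`T_{≤ -1} ⊗ Σ(A_{≤ -1})`, where the second one has an additional sign, because the differential
of `Σ A` is that of `A` with the opposite sign. The third one is the map `d ⊗ σ d`
from `T_0 ⊗ A_0` to `T_{-1} ⊗ (Σ A)_0 = T_{-1} ⊗ A_{-1}`, that is, the differential from degree `0`
to degree `-1`. -/
def pinchedDAux (T A : ChainComplex (ModuleCat.{u} R) ℤ) (m p q : ℤ) :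
    T.X p ⊗[R] A.X q →ₗ[R] pinchedX T A m :=
  pinchedι T A m (p - 1) q ∘ₗ TensorProduct.map (T.d p (p - 1)).hom LinearMap.id
  + (if 0 ≤ q then p.negOnePow else -p.negOnePow) •
      (pinchedι T A m p (q - 1) ∘ₗ TensorProduct.map LinearMap.id (A.d q (q - 1)).hom)
  + (if p = 0 ∧ q = 0 then
      pinchedι T A m (p - 1) (q - 1) ∘ₗ TensorProduct.map (T.d p (p - 1)).hom (A.d q (q - 1)).hom
    else 0)

/-- The map `(T ⊠ A)_n ⟶ (T ⊠ A)_m` that is the differential of the pinched tensor product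
if `m + 1 = n`, and zero otherwise. -/
def pinchedD (T A : ChainComplex (ModuleCat.{u} R) ℤ) (n m : ℤ) :
    pinchedX T A n →ₗ[R] pinchedX T A m :=
  DirectSum.toModule R (Index n) (pinchedX T A m) fun x => pinchedDAux T A m x.1.1 x.1.2

lemma pinchedι_of_not (T A : ChainComplex (ModuleCat.{u} R) ℤ) {n p q : ℤ}
    (h : ¬ IsIndex n p q) : pinchedι T A n p q = 0 := dif_neg h

lemma pinchedD_ι (T A : ChainComplex (ModuleCat.{u} R) ℤ) (n m p q : ℤ) :
    pinchedD T A n m ∘ₗ pinchedι T A n p q =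
      if IsIndex n p q then pinchedDAux T A m p q else 0 := by
  by_cases h : IsIndex n p q
  · rw [if_pos h, pinchedι, dif_pos h]
    refine LinearMap.ext fun t => ?_
    exact DirectSum.toModule_lof R (φ := fun x : Index n => pinchedDAux T A m x.1.1 x.1.2)
      (⟨(p, q), h⟩ : Index n) t
  · rw [if_neg h, pinchedι_of_not T A h, LinearMap.comp_zero]

lemma pinchedX_hom_ext (T A : ChainComplex (ModuleCat.{u} R) ℤ) {n : ℤ}
    {V : Type u} [AddCommGroup V] [Module R V] {f g : pinchedX T A n →ₗ[R] V}
    (h : ∀ p q, IsIndex n p q → f ∘ₗ pinchedι T A n p q = g ∘ₗ pinchedι T A n p q) : f = g := by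
  refine DirectSum.linearMap_ext R fun x => ?_
  have := h x.1.1 x.1.2 x.2
  rwa [pinchedι, dif_pos x.2] at this

lemma pinchedDAux_tmul (T A : ChainComplex (ModuleCat.{u} R) ℤ) (m p q : ℤ)
    (t : T.X p) (a : A.X q) :
    pinchedDAux T A m p q (t ⊗ₜ a) =
      pinchedι T A m (p - 1) q ((T.d p (p - 1)).hom t ⊗ₜ a)
      + (if 0 ≤ q then p.negOnePow else -p.negOnePow) •
        pinchedι T A m p (q - 1) (t ⊗ₜ (A.d q (q - 1)).hom a)
      + (if p = 0 ∧ q = 0 then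
        pinchedι T A m (p - 1) (q - 1) ((T.d p (p - 1)).hom t ⊗ₜ (A.d q (q - 1)).hom a)
      else 0) := by
  rw [pinchedDAux]
  by_cases h : p = 0 ∧ q = 0
  · rw [if_pos h, if_pos h]
    rfl
  · rw [if_neg h, if_neg h]
    rfl

lemma pinchedD_shape (T A : ChainComplex (ModuleCat.{u} R) ℤ) {n m : ℤ} (h : m + 1 ≠ n) :
    pinchedD T A n m = 0 := by
  refine pinchedX_hom_ext T A fun p q hpq => ?_
  rw [pinchedD_ι, if_pos hpq, LinearMap.zero_comp, pinchedDAux]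
  have h1 : ¬ IsIndex m (p - 1) q := by unfold IsIndex at *; omega
  have h2 : ¬ IsIndex m p (q - 1) := by unfold IsIndex at *; omega
  rw [pinchedι_of_not T A h1, pinchedι_of_not T A h2]
  have h3 : p = 0 ∧ q = 0 → ¬ IsIndex m (p - 1) (q - 1) := by unfold IsIndex at *; omega
  by_cases h4 : p = 0 ∧ q = 0
  · rw [pinchedι_of_not T A (h3 h4)]
    simp
  · simp [h4]

lemma pinchedD_comp (T A : ChainComplex (ModuleCat.{u} R) ℤ) {n m k : ℤ}
    (hm : m + 1 = n) (hk : k + 1 = m) :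
    pinchedD T A m k ∘ₗ pinchedD T A n m = 0 := by
  have hT : ∀ (p : ℤ) (t : T.X p), (T.d (p - 1) (p - 1 - 1)).hom ((T.d p (p - 1)).hom t) = 0 :=
    fun p t => by
      rw [← LinearMap.comp_apply, ← ModuleCat.hom_comp, T.d_comp_d]
      rfl
  have hA : ∀ (p : ℤ) (t : A.X p), (A.d (p - 1) (p - 1 - 1)).hom ((A.d p (p - 1)).hom t) = 0 :=
    fun p t => by
      rw [← LinearMap.comp_apply, ← ModuleCat.hom_comp, A.d_comp_d]
      rfl
  have key : ∀ (p q : ℤ) (t : T.X p ⊗[R] A.X q), pinchedD T A m k (pinchedι T A m p q t) =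
      if IsIndex m p q then pinchedDAux T A k p q t else 0 := fun p q t => by
    rw [← LinearMap.comp_apply, pinchedD_ι]
    split_ifs <;> rfl
  refine pinchedX_hom_ext T A fun p q hpq => ?_
  rw [LinearMap.comp_assoc, pinchedD_ι, if_pos hpq, LinearMap.zero_comp]
  refine TensorProduct.ext' fun t a => ?_
  have hs : (if 0 ≤ q then (p - 1).negOnePow else -(p - 1).negOnePow) =
      -(if 0 ≤ q then p.negOnePow else -p.negOnePow) := by
    rw [Int.negOnePow_sub, Int.negOnePow_one]
    split_ifs <;> simp
  have e1 : pinchedD T A m k (pinchedι T A m (p - 1) q ((T.d p (p - 1)).hom t ⊗ₜ a)) =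
      -((if 0 ≤ q then p.negOnePow else -p.negOnePow) •
        pinchedι T A k (p - 1) (q - 1) ((T.d p (p - 1)).hom t ⊗ₜ (A.d q (q - 1)).hom a)) := by
    rw [key]
    by_cases h1 : IsIndex m (p - 1) q
    · rw [if_pos h1, pinchedDAux_tmul, hT, hs]
      simp only [TensorProduct.zero_tmul, map_zero, ite_self, zero_add, add_zero, neg_smul,
        Units.smul_def, Units.val_neg]
    · have hι : ¬ IsIndex k (p - 1) (q - 1) := by unfold IsIndex at *; omega
      rw [if_neg h1, pinchedι_of_not T A hι]
      simp
  have e2 : pinchedD T A m k (pinchedι T A m p (q - 1) (t ⊗ₜ (A.d q (q - 1)).hom a)) =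
      pinchedι T A k (p - 1) (q - 1) ((T.d p (p - 1)).hom t ⊗ₜ (A.d q (q - 1)).hom a) := by
    rw [key]
    by_cases h1 : IsIndex m p (q - 1)
    · rw [if_pos h1, pinchedDAux_tmul, hA]
      simp only [TensorProduct.tmul_zero, map_zero, ite_self, smul_zero, add_zero]
    · have hι : ¬ IsIndex k (p - 1) (q - 1) := by unfold IsIndex at *; omega
      rw [if_neg h1, pinchedι_of_not T A hι]
      simp
  have e3 : pinchedD T A m k (pinchedι T A m (p - 1) (q - 1)
      ((T.d p (p - 1)).hom t ⊗ₜ (A.d q (q - 1)).hom a)) = 0 := by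
    rw [key]
    split_ifs
    · rw [pinchedDAux_tmul, hT, hA]
      simp
    · rfl
  rw [LinearMap.comp_apply, pinchedDAux_tmul, map_add, map_add, e1, Units.smul_def,
    Units.smul_def, map_zsmul, e2, apply_ite (pinchedD T A m k), e3, map_zero, ite_self, add_zero,
    neg_add_cancel]
  rfl

/-- The pinched tensor product `T ⊠ A`. -/
def pinchedTensor (T A : ChainComplex (ModuleCat.{u} R) ℤ) : ChainComplex (ModuleCat.{u} R) ℤ where
  X n := ModuleCat.of R (pinchedX T A n)
  d n m := ModuleCat.ofHom (pinchedD T A n m)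
  shape n m h := by
    rw [pinchedD_shape T A (by simpa using h)]
    rfl
  d_comp_d' n m k h h' := by
    rw [← ModuleCat.ofHom_comp, pinchedD_comp T A (by simpa using h) (by simpa using h')]
    rfl

/-! ### Minimality and stable Betti numbers -/

/-- A complex `F` (of finitely generated free modules) over a local ring with maximal ideal `𝔪` is
minimal if `d(F) ⊆ 𝔪 F`. -/
def IsMinimal [IsLocalRing R] (F : ChainComplex (ModuleCat.{u} R) ℤ) : Prop :=
  ∀ n : ℤ, LinearMap.range (F.d (n + 1) n).hom ≤
    IsLocalRing.maximalIdeal R • (⊤ : Submodule R (F.X n))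

variable (R) in
/-- A complete projective resolution `T ⟶ P ⟶ M` of the module `M`: here `P ⟶ M` is a
projective resolution, `T` is totally acyclic, and `τ_i` is an isomorphism for `i ≫ 0`. -/
structure CompleteResolution (M : Type u) [AddCommGroup M] [Module R M] where
  T : ChainComplex (ModuleCat.{u} R) ℤ
  P : ChainComplex (ModuleCat.{u} R) ℤ
  τ : T ⟶ P
  π : P.X 0 →ₗ[R] M
  totallyAcyclic : IsTotallyAcyclic T
  projective : ∀ n, Module.Projective R (P.X n)
  subsingleton_of_neg : ∀ n < 0, Subsingleton (P.X n)
  exactAt_of_pos : ∀ n > 0, P.ExactAt n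
  exact_zero : Function.Exact (P.d 1 0).hom π
  surjective : Function.Surjective π
  isIso : ∃ g : ℤ, ∀ i ≥ g, IsIso (τ.f i)

/-- A complete projective resolution `T ⟶ P ⟶ M` is minimal if `T` and `P` are minimal complexes
of finitely generated free modules. -/
structure CompleteResolution.IsMinimal [IsLocalRing R] {M : Type u} [AddCommGroup M] [Module R M]
    (X : CompleteResolution R M) : Prop where
  free_T : ∀ n, Module.Free R (X.T.X n)
  finite_T : ∀ n, Module.Finite R (X.T.X n)
  minimal_T : Pinched.IsMinimal X.T
  free_P : ∀ n, Module.Free R (X.P.X n)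
  finite_P : ∀ n, Module.Finite R (X.P.X n)
  minimal_P : Pinched.IsMinimal X.P

variable (R) in
/-- `M` has a minimal complete projective resolution. -/
def HasMinimalCompleteResolution [IsLocalRing R]
    (M : Type u) [AddCommGroup M] [Module R M] : Prop :=
  ∃ X : CompleteResolution R M, X.IsMinimal

open scoped Classical in
variable (R) in
/-- The `n`th stable Betti number of `M`: the rank of `T_n` for a minimal complete projective
resolution `T ⟶ P ⟶ M`. -/
def stableBetti [IsLocalRing R] (M : Type u) [AddCommGroup M] [Module R M] (n : ℤ) : ℕ :=
  if h : HasMinimalCompleteResolution R M then Module.finrank R (h.choose.T.X n) else 0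

variable (R) in
/-- `R` is (isomorphic to) a direct summand of `M`. -/
def HasFreeSummand (M : Type u) [AddCommGroup M] [Module R M] : Prop :=
  ∃ (i : R →ₗ[R] M) (p : M →ₗ[R] R), p ∘ₗ i = LinearMap.id

end Pinched

end

noncomputable section

namespace Pinched

variable {R : Type u} [CommRing R]

section

/-! ### Augmented double complexes and their pinched total complexes -/

/-! Write `N = C_0(T')`. The rows `T_p ⊗ T'_*` of the double complex `T ⊗ T'` are exact and spliced
together at `T_p ⊗ N`, between the columns `0` and `-1`, where the two quadrants of the pinched
tensor product meet. Resolving each `T_p ⊗ N` by its left half row in nonnegative degrees, and by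
its right half row in negative degrees, shows that `T ⊠ T'` is acyclic exactly when `T ⊗ N` is, that
is, when Tate homology vanishes. The dual of `T ⊠ T'` has the same shape: the reflection `n ↦ -1 -
n` exchanges the quadrants, and the rows `Hom(T_p, (T'_*)^*)` are spliced at `Hom(T_p, N^*)`. So its
acyclicity is the vanishing of Tate cohomology with coefficients in `N^*`. `PinchedSystem.exact_iff`
is the common argument, with instances `tensorSystem` and `dualSystem`. For finitely generated
terms, total acyclicity only has to be tested on `R`; this gives (i) ⇔ (ii).

For (i) ⇔ (iii), `C_0(T ⊠ T')` is `M ⊗ N` by right exactness, and cokernels of totally acyclic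
complexes are totally reflexive. Conversely, let `L` be acyclic with `C_0(L)` totally reflexive. The
vanishing of `Ext(C_0, R)` makes the dual exact on one side. On the other side one needs exactness
of `⋯ → (L_{-2})^* → (L_{-1})^* → C_0^* → 0`, whose dual is exact by reflexivity. Here the local
Noetherian hypothesis enters through `AugmentedComplex.IsHomExact.surjective`: one divides `R` by
regular elements until the residue field embeds in the quotient, and then a nonzero cokernel would
be detected by a map to that quotient.

Minimality is tested by functionals into `R`, which links it to free summands: the differential `T_0
→ T_{-1}` is minimal if and only if `C_0(T)` has no free summand. In the converse of (a), the
pinching map `d ⊗ d` only shows that one of the two modules has no free summand, whence the extra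
hypothesis. For (b), minimal syzygies, and cosyzygies obtained by dualizing syzygies of the dual,
yield minimal complete resolutions. Their ranks are determined by the module, by Nakayama applied to
retracts up to projective summands (`finrank_le_of_isStableRetract`). The formula then counts the
summands of the pinched tensor product of two minimal complexes; if a free summand occurs, all the
Betti numbers involved vanish. -/

variable (R) in
/-- A double complex `Y` whose rows are exact and spliced together at `Z`, with a complex `D`
that is its pinched total complex, described by components. -/
structure PinchedSystem where
  Y : ℤ → ℤ → ModuleCat.{u} R
  Z : ℤ → ModuleCat.{u} R
  D : ℤ → ModuleCat.{u} R
  dT : ∀ p p' q, Y p q →ₗ[R] Y p' q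
  dA : ∀ p q q', Y p q →ₗ[R] Y p q'
  dZ : ∀ p p', Z p →ₗ[R] Z p'
  d : ∀ n m, D n →ₗ[R] D m
  s : ℤ → ℤ → R
  e : ∀ p, Y p 0 →ₗ[R] Z p
  η : ∀ p, Z p →ₗ[R] Y p (-1)
  ι : ∀ n p q, Y p q →ₗ[R] D n
  π : ∀ n p q, D n →ₗ[R] Y p q
  s_mul_s : ∀ p q, s p q * s p q = 1
  π_ι : ∀ {n p q}, IsIndex n p q → ∀ y, π n p q (ι n p q y) = y
  π_ι_ne : ∀ {n p q p' q'}, p ≠ p' → ∀ y, π n p q (ι n p' q' y) = 0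
  π_of_not : ∀ {n p q}, ¬ IsIndex n p q → ∀ z, π n p q z = 0
  ext : ∀ {n} (z : D n), (∀ p q, IsIndex n p q → π n p q z = 0) → z = 0
  d_d : ∀ {n m k}, m + 1 = n → k + 1 = m → ∀ z, d m k (d n m z) = 0
  π_d : ∀ {n m p q}, m + 1 = n → m ≠ -1 → IsIndex m p q → ∀ z, π m p q (d n m z) =
    dT (p + 1) p q (π n (p + 1) q z) + s p q • dA p (q + 1) q (π n p (q + 1) z)
  π_d_zero : ∀ z, π (-1) (-1) (-1) (d 0 (-1) z) = dT 0 (-1) (-1) (η 0 (e 0 (π 0 0 0 z)))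
  e_dT : ∀ {p p'}, p' + 1 = p → ∀ y, e p' (dT p p' 0 y) = dZ p p' (e p y)
  dT_η : ∀ {p p'}, p' + 1 = p → ∀ y, dT p p' (-1) (η p y) = η p' (dZ p p' y)
  e_dA : ∀ p y, e p (dA p 1 0 y) = 0
  dA_η : ∀ p y, dA p (-1) (-2) (η p y) = 0
  e_surjective : ∀ p, Function.Surjective (e p)
  η_injective : ∀ p, Function.Injective (η p)
  exact_row : ∀ {p q}, q ≠ 0 → q ≠ -1 → ∀ y, dA p q (q - 1) y = 0 → ∃ y', dA p (q + 1) q y' = y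
  exact_zero : ∀ p y, e p y = 0 → ∃ y', dA p 1 0 y' = y
  exact_neg_one : ∀ p y, dA p (-1) (-2) y = 0 → ∃ z, η p z = y

namespace PinchedSystem

variable (S : PinchedSystem.{u} R)

/-- The comparison map from the total complex in nonnegative degrees. -/
def φ (n : ℤ) : S.D n →ₗ[R] S.Z n := S.e n ∘ₗ S.π n n 0

/-- The comparison map to the total complex in negative degrees. -/
def ψ (n : ℤ) : S.Z n →ₗ[R] S.D n := S.ι n n (-1) ∘ₗ S.η n

lemma φ_apply (n : ℤ) (z : S.D n) : S.φ n z = S.e n (S.π n n 0 z) := rfl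

lemma ψ_apply (n : ℤ) (y : S.Z n) : S.ψ n y = S.ι n n (-1) (S.η n y) := rfl

lemma ext' {n : ℤ} {z w : S.D n} (h : ∀ p q, IsIndex n p q → S.π n p q z = S.π n p q w) :
    z = w := by
  rw [← sub_eq_zero]
  refine S.ext _ fun p q hpq => ?_
  rw [map_sub, h p q hpq, sub_self]

lemma eq_zero_of_s_smul {p q : ℤ} {M : Type*} [AddCommGroup M] [Module R M] {y : M}
    (h : S.s p q • y = 0) : y = 0 := by
  rw [← one_smul R y, ← S.s_mul_s p q, mul_smul, h, smul_zero]

lemma φ_surjective {n : ℤ} (hn : 0 ≤ n) : Function.Surjective (S.φ n) := fun y => by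
  obtain ⟨x, rfl⟩ := S.e_surjective n y
  exact ⟨S.ι n n 0 x, by rw [φ_apply, S.π_ι (by unfold IsIndex; omega)]⟩

lemma ψ_injective {n : ℤ} (hn : n < 0) : Function.Injective (S.ψ n) := by
  rw [injective_iff_map_eq_zero]
  intro y hy
  have h := congrArg (S.π n n (-1)) hy
  rw [ψ_apply, S.π_ι (by unfold IsIndex; omega), map_zero] at h
  exact (injective_iff_map_eq_zero _).1 (S.η_injective n) y h

lemma φ_d {n m : ℤ} (hm : m + 1 = n) (h0 : 0 ≤ m) (z : S.D n) :
    S.φ m (S.d n m z) = S.dZ n m (S.φ n z) := by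
  subst hm
  rw [φ_apply, S.π_d rfl (by omega) (by unfold IsIndex; omega), map_add, S.e_dT rfl, map_smul,
    zero_add, S.e_dA, smul_zero, add_zero, φ_apply]

lemma d_ψ {n m : ℤ} (hm : m + 1 = n) (h0 : n < 0) (y : S.Z n) :
    S.d n m (S.ψ n y) = S.ψ m (S.dZ n m y) := by
  subst hm
  refine S.ext' fun p q hpq => ?_
  rw [S.π_d rfl (by omega) hpq, ψ_apply, ψ_apply]
  by_cases h1 : p = m
  · have : q = -1 := by unfold IsIndex at hpq; omega
    subst h1 this
    rw [S.π_ι (by unfold IsIndex; omega), S.dT_η rfl, S.π_ι_ne (by omega), map_zero, smul_zero,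
      add_zero, S.π_ι hpq]
  rw [S.π_ι_ne (by omega : p + 1 ≠ m + 1), S.π_ι_ne h1, map_zero, zero_add]
  by_cases h2 : p = m + 1
  · have : q = -2 := by unfold IsIndex at hpq; omega
    subst h2 this
    rw [show (-2 + 1 : ℤ) = -1 by norm_num, S.π_ι (by unfold IsIndex; omega), S.dA_η, smul_zero]
  · rw [S.π_ι_ne h2, map_zero, smul_zero]

lemma d_zero (z : S.D 0) : S.d 0 (-1) z = S.ψ (-1) (S.dZ 0 (-1) (S.φ 0 z)) := by
  refine S.ext' fun p q hpq => ?_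
  obtain ⟨rfl, rfl⟩ : p = -1 ∧ q = -1 := by unfold IsIndex at hpq; omega
  rw [S.π_d_zero, ψ_apply, S.π_ι hpq, S.dT_η (by norm_num)]
  rfl

/-- Subtracting a boundary removes the components with the largest first index. -/
lemma exists_sub_d {n p q : ℤ} (hn : n ≠ -1) (hpq : IsIndex n p q) (z : S.D n)
    (hz : ∀ p' q', IsIndex n p' q' → p < p' → S.π n p' q' z = 0)
    (hq : ∃ y, S.dA p (q + 1) q y = S.π n p q z) (hi : IsIndex (n + 1) p (q + 1)) :
    ∃ y : S.Y p (q + 1), ∀ p' q', IsIndex n p' q' → p ≤ p' →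
      S.π n p' q' (z - S.d (n + 1) n (S.ι (n + 1) p (q + 1) y)) = 0 := by
  obtain ⟨y, hy⟩ := hq
  -- The boundary of an element of `Y p (q + 1)` only meets the first indices `p` and `p - 1`. The
  -- factor `s p q` cancels the sign of the differential, its square being `1`.
  refine ⟨S.s p q • y, fun p' q' h' hp => ?_⟩
  rw [map_sub, S.π_d rfl hn h', S.π_ι_ne (by omega), map_zero, zero_add]
  by_cases hpp : p' = p
  · obtain rfl : q' = q := by unfold IsIndex at hpq h'; omega
    subst hpp
    rw [S.π_ι hi, map_smul, smul_smul, S.s_mul_s, one_smul, hy, sub_self]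
  · rw [S.π_ι_ne hpp, map_zero, smul_zero, sub_zero, hz p' q' h' (by omega)]

/-- Elimination along the rows, by induction on a bound `k` for the first indices that occur in `z`.
The top component is a row cycle: for `p = n` because `φ z = 0`, and for `p < n` because `z` is a
cycle and nothing lies above. So it is a row boundary and can be subtracted. In degree `0` the
condition on `φ` replaces the cycle condition. -/
lemma exists_d_eq_of_φ_eq_zero {n : ℤ} (hn : 0 ≤ n) (z : S.D n) (hφ : S.φ n z = 0)
    (hd : 0 < n → S.d n (n - 1) z = 0) : ∃ w, S.φ (n + 1) w = 0 ∧ S.d (n + 1) n w = z := by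
  suffices H : ∀ (k : ℕ) (z : S.D n), S.φ n z = 0 → (0 < n → S.d n (n - 1) z = 0) →
      (∀ p q, IsIndex n p q → (k : ℤ) ≤ p → S.π n p q z = 0) →
      ∃ w, S.φ (n + 1) w = 0 ∧ S.d (n + 1) n w = z by
    refine H (n + 1).toNat z hφ hd fun p q hpq hp => ?_
    exfalso
    unfold IsIndex at hpq
    omega
  intro k
  induction k with
  | zero =>
    intro z _ _ hz
    refine ⟨0, map_zero _, ?_⟩
    rw [map_zero, S.ext z fun p q hpq => hz p q hpq (by unfold IsIndex at hpq; omega)]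
  | succ k ih =>
    intro z hφ hd hz
    by_cases hk : n < k
    · exact ih z hφ hd fun p q hpq hp => by exfalso; unfold IsIndex at hpq; omega
    obtain ⟨q, hq⟩ : ∃ q, q = n - k := ⟨_, rfl⟩
    have hi : IsIndex n k q := by unfold IsIndex; omega
    have hrow : ∃ y, S.dA k (q + 1) q y = S.π n k q z := by
      by_cases h0 : n = k
      · obtain rfl : q = 0 := by omega
        subst h0
        exact S.exact_zero _ _ hφ
      · refine S.exact_row (by omega) (by omega) _ ?_
        have h1 := congrArg (S.π (n - 1) k (q - 1)) (hd (by omega))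
        rw [S.π_d (by ring) (by omega) (by unfold IsIndex; omega), map_zero, sub_add_cancel,
          hz (k + 1) (q - 1) (by unfold IsIndex; omega) (by push_cast; omega), map_zero,
          zero_add] at h1
        exact S.eq_zero_of_s_smul h1
    obtain ⟨y, hy⟩ := S.exists_sub_d (by omega) hi z
      (fun p' q' h' hp => hz p' q' h' (by push_cast; omega)) hrow (by unfold IsIndex; omega)
    -- The correction has first index `k ≤ n`, whereas `φ` in degree `n + 1` only sees first index
    -- `n + 1`.
    have hw : S.φ (n + 1) (S.ι (n + 1) k (q + 1) y) = 0 := by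
      rw [φ_apply, S.π_ι_ne (by omega), map_zero]
    obtain ⟨w, hw1, hw2⟩ := ih _ (by rw [map_sub, hφ, S.φ_d rfl hn, hw, map_zero, sub_zero])
      (fun h => by rw [map_sub, hd h, S.d_d rfl (by ring), sub_zero])
      (fun p q hpq hp => hy p q hpq hp)
    refine ⟨w + S.ι (n + 1) k (q + 1) y, by rw [map_add, hw1, hw, add_zero], ?_⟩
    rw [map_add, hw2, sub_add_cancel]

/-- The same elimination in the negative quadrant. The image of `ψ` lies in the column `-1`, so all
other components of the boundary of `z` vanish, and row exactness removes the components of `z` from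
the top. The last one, with `p = n` and `q = -1`, is a row cycle and so comes from `Z` through `η`.
Allowing `y ≠ 0` is what later shows that a boundary lying in `Z` is already a boundary in `Z`. -/
lemma exists_sub_d_eq_ψ {n : ℤ} (hn : n < 0) (z : S.D n) (y : S.Z (n - 1))
    (hd : S.d n (n - 1) z = S.ψ (n - 1) y) : ∃ w x,
      z - S.d (n + 1) n w = S.ψ n x := by
  suffices H : ∀ (k : ℕ) (z : S.D n), S.d n (n - 1) z = S.ψ (n - 1) y →
      (∀ p q, IsIndex n p q → n + k ≤ p → S.π n p q z = 0) →
      ∃ w x, z - S.d (n + 1) n w = S.ψ n x by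
    refine H (-n).toNat z hd fun p q hpq hp => ?_
    exfalso
    unfold IsIndex at hpq
    omega
  intro k
  induction k with
  | zero =>
    intro z _ hz
    refine ⟨0, 0, ?_⟩
    rw [map_zero, map_zero, sub_zero,
      S.ext z fun p q hpq => hz p q hpq (by unfold IsIndex at hpq; omega)]
  | succ k ih =>
    intro z hd hz
    by_cases hk : 0 ≤ n + k
    · exact ih z hd fun p q hpq hp => by exfalso; unfold IsIndex at hpq; omega
    obtain ⟨p, hp⟩ : ∃ p, p = n + k := ⟨_, rfl⟩
    obtain ⟨q, hq⟩ : ∃ q : ℤ, q = -1 - k := ⟨_, rfl⟩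
    have hi : IsIndex n p q := by unfold IsIndex; omega
    have h1 := congrArg (S.π (n - 1) p (q - 1)) hd
    have h2 : S.π n (p + 1) (q - 1) z = 0 := by
      by_cases h : IsIndex n (p + 1) (q - 1)
      · exact hz _ _ h (by push_cast; omega)
      · exact S.π_of_not h z
    rw [S.π_d (by ring) (by omega) (by unfold IsIndex; omega), ψ_apply, S.π_ι_ne (by omega),
      sub_add_cancel, h2, map_zero, zero_add] at h1
    have h3 := S.eq_zero_of_s_smul h1
    by_cases h0 : k = 0
    · obtain rfl : q = -1 := by omega
      obtain rfl : p = n := by omega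
      obtain ⟨x, hx⟩ := S.exact_neg_one p _ h3
      refine ⟨0, x, ?_⟩
      rw [map_zero, sub_zero]
      refine S.ext' fun p' q hpq => ?_
      rw [ψ_apply, hx]
      by_cases hp : p' = p
      · obtain rfl : q = -1 := by unfold IsIndex at hpq; omega
        subst hp
        rw [S.π_ι hpq]
      · rw [S.π_ι_ne hp, hz p' q hpq (by unfold IsIndex at hpq; push_cast; omega)]
    obtain ⟨v, hv⟩ := S.exists_sub_d (by omega) hi z
      (fun p' q' h' hp => hz p' q' h' (by push_cast; omega))
      (S.exact_row (by omega) (by omega) _ h3) (by unfold IsIndex; omega)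
    obtain ⟨w, x, hw2⟩ := ih _ (by rw [map_sub, hd, S.d_d rfl (by ring), sub_zero])
      (fun p' q hpq hp' => hv p' q hpq (by omega))
    refine ⟨w + S.ι (n + 1) p (q + 1) v, x, ?_⟩
    rw [map_add, ← hw2]
    abel

/-- The pinched total complex is acyclic if and only if the complex `Z` is. -/
theorem exact_iff :
    (∀ n (z : S.D n), S.d n (n - 1) z = 0 → ∃ w, S.d (n + 1) n w = z) ↔
      ∀ n (y : S.Z n), S.dZ n (n - 1) y = 0 → ∃ x, S.dZ (n + 1) n x = y := by
  constructor
  · intro H n y hy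
    rcases lt_or_ge n 0 with hn | hn
    · obtain ⟨z, hz⟩ := H n (S.ψ n y) (by rw [S.d_ψ (by ring) hn, hy, map_zero])
      by_cases h1 : n = -1
      · subst h1
        refine ⟨S.φ 0 z, S.ψ_injective (by norm_num) ?_⟩
        rw [← hz]
        exact (S.d_zero z).symm
      · obtain ⟨w, x, hx⟩ := S.exists_sub_d_eq_ψ (by omega : n + 1 < 0) z
          (cast (by rw [add_sub_cancel_right]) y) (by
            have : ∀ m, m = n → ∀ h : (S.Z n : Type u) = S.Z m,
              S.d (n + 1) m z = S.ψ m (cast h y) := by rintro m rfl h; exact hz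
            exact this _ (by ring) _)
        refine ⟨x, S.ψ_injective hn ?_⟩
        rw [← S.d_ψ rfl (by omega), ← hx, map_sub, hz, S.d_d rfl rfl, sub_zero]
    · obtain ⟨z, rfl⟩ := S.φ_surjective hn y
      by_cases h0 : n = 0
      · subst h0
        obtain ⟨w, hw⟩ := H 0 z (by
          rw [zero_sub] at hy ⊢
          rw [d_zero, hy, map_zero])
        exact ⟨S.φ (0 + 1) w, by rw [← S.φ_d rfl le_rfl, hw]⟩
      -- The lift `z` of a cycle need not be a cycle, but its boundary lies in the kernel of `φ`.
      -- Hence it is the boundary of some `w` with `φ w = 0`, and `z - w` is a cycle that lifts the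
      -- same element.
      · have key := S.exists_d_eq_of_φ_eq_zero (n := n - 1) (by omega)
          (S.d n (n - 1) z) (by rw [S.φ_d (by ring) (by omega), hy])
          (fun _ => S.d_d (by ring) (by ring) z)
        rw [sub_add_cancel] at key
        obtain ⟨w, hw1, hw2⟩ := key
        obtain ⟨v, hv⟩ := H n (z - w) (by rw [map_sub, hw2, sub_self])
        exact ⟨S.φ (n + 1) v, by rw [← S.φ_d rfl hn, hv, map_sub, hw1, sub_zero]⟩
  · intro H n z hz
    rcases lt_or_ge n 0 with hn | hn
    · obtain ⟨w, x, hx⟩ := S.exists_sub_d_eq_ψ hn z 0 (by rw [hz, map_zero])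
      obtain ⟨y, hy⟩ := H n x (by
        apply S.ψ_injective (by omega : n - 1 < 0)
        rw [← S.d_ψ (by ring) hn, ← hx, map_sub, hz, S.d_d rfl (by ring), sub_zero, map_zero])
      suffices h : ∃ v, S.d (n + 1) n v = S.ψ n x by
        obtain ⟨v, hv⟩ := h
        exact ⟨w + v, by rw [map_add, hv, ← hx, add_sub_cancel]⟩
      by_cases h1 : n = -1
      · subst h1
        obtain ⟨v, rfl⟩ := S.φ_surjective le_rfl y
        exact ⟨v, by rw [← hy]; exact S.d_zero v⟩
      · exact ⟨S.ψ (n + 1) y, by rw [S.d_ψ rfl (by omega), hy]⟩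
    · obtain ⟨y, hy⟩ := H n (S.φ n z) (by
        by_cases h0 : n = 0
        · subst h0
          rw [zero_sub] at hz ⊢
          apply S.ψ_injective (by norm_num)
          rw [← S.d_zero, hz, map_zero]
        · rw [← S.φ_d (by ring) (by omega), hz, map_zero])
      obtain ⟨v, rfl⟩ := S.φ_surjective (by omega : 0 ≤ n + 1) y
      obtain ⟨w, -, hw⟩ := S.exists_d_eq_of_φ_eq_zero hn (z - S.d (n + 1) n v)
        (by rw [map_sub, S.φ_d rfl hn, hy, sub_self])
        (fun _ => by rw [map_sub, hz, S.d_d rfl (by ring), sub_zero])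
      exact ⟨w + v, by rw [map_add, hw, sub_add_cancel]⟩

end PinchedSystem

end

section

/-! ### Exactness in terms of elements -/

/-- Exactness of a complex in all degrees, in terms of elements. -/
def IsExact (C : ChainComplex (ModuleCat.{u} R) ℤ) : Prop :=
  ∀ a b c : ℤ, b + 1 = a → c + 1 = b → ∀ z : C.X b, (C.d b c).hom z = 0 →
    ∃ w : C.X a, (C.d a b).hom w = z

/-- Exactness of `Hom(C, N)` in all degrees, in terms of elements. -/
def IsHomExact (C : ChainComplex (ModuleCat.{u} R) ℤ)
    (N : Type u) [AddCommGroup N] [Module R N] : Prop :=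
  ∀ a b c : ℤ, b + 1 = a → c + 1 = b → ∀ f : C.X b →ₗ[R] N, f ∘ₗ (C.d a b).hom = 0 →
    ∃ g : C.X c →ₗ[R] N, g ∘ₗ (C.d b c).hom = f

lemma d_d_apply (C : ChainComplex (ModuleCat.{u} R) ℤ) (a b c : ℤ) (z : C.X a) :
    (C.d b c).hom ((C.d a b).hom z) = 0 := by
  rw [← LinearMap.comp_apply, ← ModuleCat.hom_comp, C.d_comp_d]
  rfl

lemma exactAt_iff (C : ChainComplex (ModuleCat.{u} R) ℤ) {a b c : ℤ} (hab : b + 1 = a)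
    (hbc : c + 1 = b) : C.ExactAt b ↔
      ∀ z : C.X b, (C.d b c).hom z = 0 → ∃ w : C.X a, (C.d a b).hom w = z := by
  rw [C.exactAt_iff' a b c (by simp [← hab]) (by simp [← hbc]), ShortComplex.moduleCat_exact_iff]
  rfl

lemma acyclic_iff (C : ChainComplex (ModuleCat.{u} R) ℤ) : C.Acyclic ↔ IsExact C :=
  ⟨fun h _ b _ hab hbc => (exactAt_iff C hab hbc).1 (h b),
    fun h b => (exactAt_iff C rfl (by ring : b - 1 + 1 = b)).2 (h _ _ _ rfl (by ring))⟩

lemma acyclic_iff_isZero (C : ChainComplex (ModuleCat.{u} R) ℤ) :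
    (∀ n, Limits.IsZero (C.homology n)) ↔ C.Acyclic :=
  forall_congr' fun n => (C.exactAt_iff_isZero_homology n).symm

/-- The signs in the differential are units, so they change neither kernels nor images; the degrees
are negated. -/
lemma homComplex_acyclic_iff (C : ChainComplex (ModuleCat.{u} R) ℤ)
    (N : Type u) [AddCommGroup N] [Module R N] :
    (homComplex C N).Acyclic ↔ IsHomExact C N := by
  rw [acyclic_iff]
  have hd : ∀ (n m : ℤ) (f : C.X (-n) →ₗ[R] N), ((homComplex C N).d n m).hom f =
      -(n.negOnePow • f ∘ₗ (C.d (-m) (-n)).hom) := fun _ _ _ => rfl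
  have hz : ∀ (n m : ℤ) (f : C.X (-n) →ₗ[R] N), ((homComplex C N).d n m).hom f = 0 ↔
      f ∘ₗ (C.d (-m) (-n)).hom = 0 := fun n m f => by
    rw [hd]
    exact (neg_eq_zero (α := C.X (-m) →ₗ[R] N)).trans (smul_eq_zero_iff_eq _)
  constructor
  · intro h a b c hab hbc f hf
    obtain ⟨a, rfl⟩ : ∃ x, a = -x := ⟨-a, by ring⟩
    obtain ⟨b, rfl⟩ : ∃ x, b = -x := ⟨-b, by ring⟩
    obtain ⟨c, rfl⟩ : ∃ x, c = -x := ⟨-c, by ring⟩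
    obtain ⟨g, hg⟩ := h c b a (by omega) (by omega) f ((hz b a f).2 hf)
    refine ⟨-(c.negOnePow • (g : C.X (-c) →ₗ[R] N)), ?_⟩
    rw [← hg]
    rfl
  · intro h a b c hab hbc f hf
    obtain ⟨g, hg⟩ := h (-c) (-b) (-a) (by omega) (by omega) f ((hz b c f).1 hf)
    refine ⟨(-(a.negOnePow • g) : C.X (-a) →ₗ[R] N), ?_⟩
    refine (hd _ _ _).trans ?_
    rw [LinearMap.neg_comp, smul_neg, neg_neg, ← hg]
    change a.negOnePow • (a.negOnePow • (g ∘ₗ (C.d (-b) (-a)).hom)) = _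
    rw [smul_smul, Int.units_mul_self, one_smul]

/-- A module `N` at which an exact complex `A` is spliced together, between the degrees `a`
and `b`. -/
structure Splice (A : ChainComplex (ModuleCat.{u} R) ℤ)
    (N : Type u) [AddCommGroup N] [Module R N] (a b : ℤ) where
  ε : A.X a →ₗ[R] N
  η : N →ₗ[R] A.X b
  ε_surjective : Function.Surjective ε
  η_injective : Function.Injective η
  η_ε : ∀ x, η (ε x) = (A.d a b).hom x
  exact_ε : ∀ x, ε x = 0 → ∃ y, (A.d (a + 1) a).hom y = x
  exact_η : ∀ y, (A.d b (b - 1)).hom y = 0 → ∃ z, η z = y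

namespace Splice

variable {A : ChainComplex (ModuleCat.{u} R) ℤ} {N : Type u} [AddCommGroup N] [Module R N]
  {a b : ℤ} (s : Splice A N a b)

lemma ε_d (c : ℤ) (y : A.X c) : s.ε ((A.d c a).hom y) = 0 := by
  apply s.η_injective
  rw [s.η_ε, d_d_apply, map_zero]

lemma exact_η' {c : ℤ} (hc : c + 1 = b) (y : A.X b) (hy : (A.d b c).hom y = 0) :
    ∃ z, s.η z = y := by
  obtain rfl : c = b - 1 := by omega
  exact s.exact_η y hy

lemma d_η (c : ℤ) (z : N) : (A.d b c).hom (s.η z) = 0 := by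
  obtain ⟨x, rfl⟩ := s.ε_surjective z
  rw [s.η_ε, d_d_apply]

end Splice

/-- The splicing of an exact complex at one of its cokernels. -/
def IsExact.splice {A : ChainComplex (ModuleCat.{u} R) ℤ} (hA : IsExact A) {a b : ℤ}
    (hab : b + 1 = a) {N : Type u} [AddCommGroup N] [Module R N] (e : Coker A a ≃ₗ[R] N) :
    Splice A N a b where
  ε := e.toLinearMap ∘ₗ Submodule.mkQ _
  η := Submodule.liftQ _ (A.d a b).hom (by
    rintro _ ⟨y, rfl⟩
    exact d_d_apply A _ _ _ y) ∘ₗ e.symm.toLinearMap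
  ε_surjective := e.surjective.comp (Submodule.mkQ_surjective _)
  η_injective := by
    have h : Function.Injective (Submodule.liftQ (LinearMap.range (A.d (a + 1) a).hom)
        (A.d a b).hom (by
          rintro _ ⟨y, rfl⟩
          exact d_d_apply A _ _ _ y)) :=
      LinearMap.ker_eq_bot.1 (Submodule.ker_liftQ_eq_bot _ _ _ fun x hx => hA _ _ _ rfl hab x hx)
    exact h.comp e.symm.injective
  η_ε x := by simp
  exact_ε x hx := by
    have := e.injective (hx.trans (map_zero e).symm)
    exact (Submodule.Quotient.mk_eq_zero _).1 this
  exact_η y hy := by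
    obtain ⟨w, hw⟩ := hA a b (b - 1) hab (by ring) y hy
    exact ⟨e (Submodule.Quotient.mk w), by simpa using hw⟩

/-! ### The pinched tensor product as a pinched total complex -/

variable (T A : ChainComplex (ModuleCat.{u} R) ℤ)

/-- The projection from `(T ⊠ A)_n` to `T_p ⊗ A_q`, or zero. -/
def pinchedπ (n p q : ℤ) : pinchedX T A n →ₗ[R] T.X p ⊗[R] A.X q :=
  if h : IsIndex n p q then
    DirectSum.component R (Index n) (fun x => T.X x.1.1 ⊗[R] A.X x.1.2) ⟨(p, q), h⟩
  else 0

/-- The sign in the differential of the pinched tensor product. -/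
def pinchedSign (p q : ℤ) : R := ((if 0 ≤ q then p.negOnePow else -p.negOnePow : ℤˣ) : ℤ)

lemma pinchedSign_mul_self (p q : ℤ) : (pinchedSign p q : R) * pinchedSign p q = 1 := by
  rw [pinchedSign, ← Int.cast_mul, ← Units.val_mul, Int.units_mul_self, Units.val_one,
    Int.cast_one]

lemma pinchedSign_smul (p q : ℤ) {V : Type*} [AddCommGroup V] [Module R V] (x : V) :
    (pinchedSign p q : R) • x = (if 0 ≤ q then p.negOnePow else -p.negOnePow) • x := by
  rw [pinchedSign, Units.smul_def]
  exact Int.cast_smul_eq_zsmul R _ x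

lemma pinchedπ_ι {n p q : ℤ} (h : IsIndex n p q) (y : T.X p ⊗[R] A.X q) :
    pinchedπ T A n p q (pinchedι T A n p q y) = y := by
  rw [pinchedπ, pinchedι, dif_pos h, dif_pos h]
  exact DirectSum.component.lof_self R (M := fun x : Index n => T.X x.1.1 ⊗[R] A.X x.1.2)
    ⟨(p, q), h⟩ y

lemma pinchedπ_ι_ne {n p q p' q' : ℤ} (h : p ≠ p') (y : T.X p' ⊗[R] A.X q') :
    pinchedπ T A n p q (pinchedι T A n p' q' y) = 0 := by
  rw [pinchedπ, pinchedι]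
  split_ifs with h1 h2
  · rw [DirectSum.component.of, dif_neg]
    simp only [Subtype.mk.injEq, Prod.mk.injEq, not_and]
    intro h3
    exact absurd h3.symm h
  all_goals simp

lemma pinchedπ_of_not {n p q : ℤ} (h : ¬ IsIndex n p q) (z : pinchedX T A n) :
    pinchedπ T A n p q z = 0 := by
  rw [pinchedπ, dif_neg h, LinearMap.zero_apply]

lemma pinchedX_ext {n : ℤ} (z : pinchedX T A n)
    (h : ∀ p q, IsIndex n p q → pinchedπ T A n p q z = 0) : z = 0 := by
  refine DirectSum.ext_component R fun x => ?_
  have := h x.1.1 x.1.2 x.2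
  rw [pinchedπ, dif_pos x.2] at this
  rw [map_zero]
  exact this

lemma pinchedD_ι_tmul {n m p q p' q' : ℤ} (hp : p' + 1 = p) (hq : q' + 1 = q)
    (h : IsIndex n p q) (t : T.X p) (a : A.X q) :
    pinchedD T A n m (pinchedι T A n p q (t ⊗ₜ a)) =
      pinchedι T A m p' q ((T.d p p').hom t ⊗ₜ a)
      + (pinchedSign p q : R) • pinchedι T A m p q' (t ⊗ₜ (A.d q q').hom a)
      + (if p = 0 ∧ q = 0 then pinchedι T A m p' q' ((T.d p p').hom t ⊗ₜ (A.d q q').hom a)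
        else 0) := by
  obtain rfl : p' = p - 1 := by omega
  obtain rfl : q' = q - 1 := by omega
  rw [← LinearMap.comp_apply, pinchedD_ι, if_pos h, pinchedDAux_tmul]
  congr 2
  exact (pinchedSign_smul p q _).symm

lemma pinchedπ_d {n m p q : ℤ} (hm : m + 1 = n) (h1 : m ≠ -1) (h : IsIndex m p q)
    (z : pinchedX T A n) : pinchedπ T A m p q (pinchedD T A n m z) =
      LinearMap.rTensor (A.X q) (T.d (p + 1) p).hom (pinchedπ T A n (p + 1) q z)
      + (pinchedSign p (q + 1) : R) •
        LinearMap.lTensor (T.X p) (A.d (q + 1) q).hom (pinchedπ T A n p (q + 1) z) := by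
  suffices H : pinchedπ T A m p q ∘ₗ pinchedD T A n m =
      LinearMap.rTensor (A.X q) (T.d (p + 1) p).hom ∘ₗ pinchedπ T A n (p + 1) q
      + (pinchedSign p (q + 1) : R) • (LinearMap.lTensor (T.X p) (A.d (q + 1) q).hom ∘ₗ
          pinchedπ T A n p (q + 1)) from LinearMap.congr_fun H z
  refine pinchedX_hom_ext T A fun p' q' h' => TensorProduct.ext' fun t a => ?_
  simp only [LinearMap.comp_apply, LinearMap.add_apply, LinearMap.smul_apply]
  obtain ⟨p'', hp⟩ : ∃ p'', p'' + 1 = p' := ⟨p' - 1, by ring⟩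
  obtain ⟨q'', hq⟩ : ∃ q'', q'' + 1 = q' := ⟨q' - 1, by ring⟩
  rw [pinchedD_ι_tmul T A hp hq h', if_neg (by unfold IsIndex at h h'; omega), add_zero,
    map_add, map_smul]
  subst hp hq
  by_cases c1 : p'' = p
  · subst c1
    obtain rfl : q'' + 1 = q := by unfold IsIndex at h h'; omega
    rw [pinchedπ_ι T A h, pinchedπ_ι_ne T A (by omega), smul_zero, pinchedπ_ι T A h',
      pinchedπ_ι_ne T A (by omega), map_zero, smul_zero, LinearMap.rTensor_tmul]
  · rw [pinchedπ_ι_ne T A (Ne.symm c1), zero_add, pinchedπ_ι_ne T A (by omega : p + 1 ≠ p'' + 1),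
      map_zero, zero_add]
    by_cases c2 : p = p'' + 1
    · subst c2
      obtain rfl : q'' = q := by unfold IsIndex at h h'; omega
      rw [pinchedπ_ι T A h, pinchedπ_ι T A h', LinearMap.lTensor_tmul]
    · rw [pinchedπ_ι_ne T A c2, pinchedπ_ι_ne T A c2, map_zero, smul_zero, smul_zero]

lemma pinchedπ_d_zero (z : pinchedX T A 0) :
    pinchedπ T A (-1) (-1) (-1) (pinchedD T A 0 (-1) z) =
      TensorProduct.map (T.d 0 (-1)).hom (A.d 0 (-1)).hom (pinchedπ T A 0 0 0 z) := by
  suffices H : pinchedπ T A (-1) (-1) (-1) ∘ₗ pinchedD T A 0 (-1) =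
      TensorProduct.map (T.d 0 (-1)).hom (A.d 0 (-1)).hom ∘ₗ pinchedπ T A 0 0 0 from
    LinearMap.congr_fun H z
  refine pinchedX_hom_ext T A fun p q h => TensorProduct.ext' fun t a => ?_
  obtain ⟨rfl, rfl⟩ : p = 0 ∧ q = 0 := by unfold IsIndex at h; omega
  simp only [LinearMap.comp_apply]
  rw [pinchedD_ι_tmul T A (p' := -1) (q' := -1) (by norm_num) (by norm_num) h,
    if_pos ⟨rfl, rfl⟩, pinchedι_of_not T A (by unfold IsIndex; omega : ¬ IsIndex (-1) (-1) 0),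
    pinchedι_of_not T A (by unfold IsIndex; omega : ¬ IsIndex (-1) 0 (-1)), LinearMap.zero_apply,
    LinearMap.zero_apply, smul_zero, zero_add, zero_add, pinchedπ_ι T A (by unfold IsIndex; omega),
    pinchedπ_ι T A h, TensorProduct.map_tmul]

variable {T A}

/-- The pinched tensor product of `T` and `A` as the pinched total complex of `T ⊗ A`, the
complex `Z` being `T ⊗ N`. -/
def tensorSystem (hT : ∀ n, Module.Flat R (T.X n)) (hA : IsExact A)
    {N : Type u} [AddCommGroup N] [Module R N] (s : Splice A N 0 (-1)) : PinchedSystem.{u} R where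
  Y p q := ModuleCat.of R (T.X p ⊗[R] A.X q)
  Z p := ModuleCat.of R (T.X p ⊗[R] N)
  D n := ModuleCat.of R (pinchedX T A n)
  dT p p' q := LinearMap.rTensor (A.X q) (T.d p p').hom
  dA p q q' := LinearMap.lTensor (T.X p) (A.d q q').hom
  dZ p p' := LinearMap.rTensor N (T.d p p').hom
  d n m := pinchedD T A n m
  -- The sign belongs to the source: the map into the component `(p, q)` comes from `T_p ⊗ A_{q+1}`.
  s p q := pinchedSign p (q + 1)
  e p := LinearMap.lTensor (T.X p) s.ε
  η p := LinearMap.lTensor (T.X p) s.η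
  ι n p q := pinchedι T A n p q
  π n p q := pinchedπ T A n p q
  s_mul_s p q := pinchedSign_mul_self p _
  π_ι h y := pinchedπ_ι T A h y
  π_ι_ne h y := pinchedπ_ι_ne T A h y
  π_of_not h z := pinchedπ_of_not T A h z
  ext z h := pinchedX_ext T A z h
  d_d h h' z := LinearMap.congr_fun (pinchedD_comp T A h h') z
  π_d h h' h'' z := pinchedπ_d T A h h' h'' z
  π_d_zero z := by
    refine (pinchedπ_d_zero T A z).trans ?_
    have H : TensorProduct.map (T.d 0 (-1)).hom (A.d 0 (-1)).hom =
        LinearMap.rTensor (A.X (-1)) (T.d 0 (-1)).hom ∘ₗ LinearMap.lTensor (T.X 0) s.η ∘ₗ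
          LinearMap.lTensor (T.X 0) s.ε := TensorProduct.ext' fun t a => by simp [s.η_ε]
    exact LinearMap.congr_fun H _
  e_dT _ y := by
    simp only [← LinearMap.comp_apply, LinearMap.lTensor_comp_rTensor,
      LinearMap.rTensor_comp_lTensor]
  dT_η _ y := by
    simp only [← LinearMap.comp_apply, LinearMap.lTensor_comp_rTensor,
      LinearMap.rTensor_comp_lTensor]
  e_dA p y := by
    rw [← LinearMap.comp_apply, ← LinearMap.lTensor_comp,
      show s.ε ∘ₗ (A.d 1 0).hom = 0 from LinearMap.ext fun x => s.ε_d 1 x, LinearMap.lTensor_zero,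
      LinearMap.zero_apply]
  dA_η p y := by
    rw [← LinearMap.comp_apply, ← LinearMap.lTensor_comp,
      show (A.d (-1) (-2)).hom ∘ₗ s.η = 0 from LinearMap.ext fun x => s.d_η (-2) x,
      LinearMap.lTensor_zero, LinearMap.zero_apply]
  e_surjective p := LinearMap.lTensor_surjective _ s.ε_surjective
  η_injective p := Module.Flat.lTensor_preserves_injective_linearMap _ s.η_injective
  exact_row {p q} _ _ y hy := by
    refine (Module.Flat.lTensor_exact (T.X p) (f := (A.d (q + 1) q).hom)
      (g := (A.d q (q - 1)).hom) (fun x => ⟨hA _ _ _ rfl (by ring) x, ?_⟩) y).1 hy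
    rintro ⟨w, rfl⟩
    exact d_d_apply A _ _ _ w
  exact_zero p y hy := by
    refine (lTensor_exact (T.X p) (f := (A.d 1 0).hom)
      (g := s.ε) (fun x => ⟨s.exact_ε x, ?_⟩) s.ε_surjective y).1 hy
    rintro ⟨w, rfl⟩
    exact s.ε_d _ w
  exact_neg_one p y hy := by
    refine (Module.Flat.lTensor_exact (T.X p) (f := s.η)
      (g := (A.d (-1) (-2)).hom) (fun x => ⟨s.exact_η' (by norm_num) x, ?_⟩) y).1 hy
    rintro ⟨w, rfl⟩
    exact s.d_η _ w

lemma isExact_iff (C : ChainComplex (ModuleCat.{u} R) ℤ) : IsExact C ↔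
    ∀ n (z : C.X n), (C.d n (n - 1)).hom z = 0 → ∃ w, (C.d (n + 1) n).hom w = z := by
  refine ⟨fun h n => h _ _ _ rfl (by ring), fun h a b c hab hbc => ?_⟩
  subst hab
  obtain rfl : c = b - 1 := by omega
  exact h b

/-- The pinched tensor product `T ⊠ A` is acyclic if and only if `T ⊗ C_0(A)` is. -/
theorem isExact_pinchedTensor_iff (hT : ∀ n, Module.Flat R (T.X n)) (hA : IsExact A)
    {N : Type u} [AddCommGroup N] [Module R N] (s : Splice A N 0 (-1)) :
    IsExact (pinchedTensor T A) ↔ IsExact (tensorComplex T N) := by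
  rw [isExact_iff, isExact_iff]
  exact (tensorSystem hT hA s).exact_iff

/-- Pointwise preimages suffice, because a projective module lifts linearly along the surjection
onto the range. This turns exactness of `Hom(A, R)` into exactness of the rows `Hom(T_p, Hom(A,
R))`. -/
lemma exists_lift_of_forall_mem_range {P U V : Type*} [AddCommGroup P] [Module R P]
    [AddCommGroup U] [Module R U] [AddCommGroup V] [Module R V] [Module.Projective R P]
    (α : U →ₗ[R] V) (f : P →ₗ[R] V) (h : ∀ x, ∃ y, α y = f x) : ∃ g : P →ₗ[R] U, α ∘ₗ g = f := by
  obtain ⟨g, hg⟩ := Module.projective_lifting_property α.rangeRestrict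
    (f.codRestrict (LinearMap.range α) h) α.surjective_rangeRestrict
  refine ⟨g, LinearMap.ext fun x => ?_⟩
  exact congrArg Subtype.val (LinearMap.congr_fun hg x)

/-- The dual of the pinched tensor product of `T` and `A` as a pinched total complex, the
complex `Z` being `Hom(T, N^*)`. -/
def dualSystem (hT : ∀ n, Module.Projective R (T.X n)) (hA : IsHomExact A R)
    {N : Type u} [AddCommGroup N] [Module R N] (s : Splice A N (-1 - -1) (-1 - 0)) :
    PinchedSystem.{u} R where
  -- The reflection `x ↦ -1 - x` in all indices exchanges the two alternatives of `IsIndex` and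
  -- keeps the pinching between degrees `0` and `-1`. Dualizing interchanges the roles of `ε` and
  -- `η`.
  Y p q := ModuleCat.of R (T.X (-1 - p) →ₗ[R] A.X (-1 - q) →ₗ[R] R)
  Z p := ModuleCat.of R (T.X (-1 - p) →ₗ[R] Module.Dual R N)
  D n := ModuleCat.of R (pinchedX T A (-1 - n) →ₗ[R] R)
  dT p p' q := LinearMap.lcomp R _ (T.d (-1 - p') (-1 - p)).hom
  dA p q q' := LinearMap.compRight R (LinearMap.lcomp R R (A.d (-1 - q') (-1 - q)).hom)
  dZ p p' := LinearMap.lcomp R _ (T.d (-1 - p') (-1 - p)).hom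
  d n m := LinearMap.lcomp R R (pinchedD T A (-1 - m) (-1 - n))
  s p q := pinchedSign (-1 - p) (-1 - q)
  e p := LinearMap.compRight R (LinearMap.lcomp R R s.η)
  η p := LinearMap.compRight R (LinearMap.lcomp R R s.ε)
  ι n p q := LinearMap.lcomp R R (pinchedπ T A (-1 - n) (-1 - p) (-1 - q)) ∘ₗ
    (TensorProduct.lift.equiv (.id R) (T.X (-1 - p)) (A.X (-1 - q)) R).toLinearMap
  π n p q := (TensorProduct.lift.equiv (.id R) (T.X (-1 - p)) (A.X (-1 - q)) R).symm.toLinearMap ∘ₗ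
    LinearMap.lcomp R R (pinchedι T A (-1 - n) (-1 - p) (-1 - q))
  s_mul_s p q := pinchedSign_mul_self _ _
  π_ι {n p q} h y := by
    refine LinearMap.ext fun t => LinearMap.ext fun a => ?_
    simp [pinchedπ_ι T A (by unfold IsIndex at *; omega : IsIndex (-1 - n) (-1 - p) (-1 - q))]
  π_ι_ne {n p q p' q'} h y := by
    refine LinearMap.ext fun t => LinearMap.ext fun a => ?_
    simp [pinchedπ_ι_ne T A (by omega : -1 - p' ≠ -1 - p)]
  π_of_not {n p q} h z := by
    refine LinearMap.ext fun t => LinearMap.ext fun a => ?_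
    simp [pinchedι_of_not T A (by unfold IsIndex at *; omega :
      ¬ IsIndex (-1 - n) (-1 - p) (-1 - q))]
  ext {n} z h := by
    refine pinchedX_hom_ext T A fun p q hpq => TensorProduct.ext' fun t a => ?_
    obtain ⟨p, rfl⟩ : ∃ x, p = -1 - x := ⟨-1 - p, by ring⟩
    obtain ⟨q, rfl⟩ : ∃ x, q = -1 - x := ⟨-1 - q, by ring⟩
    exact LinearMap.congr_fun (LinearMap.congr_fun
      (h p q (by unfold IsIndex at *; omega)) t) a
  d_d {n m k} h h' z := by
    refine LinearMap.ext fun x => ?_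
    have := LinearMap.congr_fun (pinchedD_comp T A (by omega : -1 - m + 1 = -1 - k)
      (by omega : -1 - n + 1 = -1 - m)) x
    simp only [LinearMap.comp_apply, LinearMap.zero_apply] at this
    simp [this]
  π_d {n m p q} h h' h'' z := by
    refine LinearMap.ext fun t => LinearMap.ext fun a => ?_
    have := pinchedD_ι_tmul T A (n := -1 - m) (m := -1 - n) (p' := -1 - (p + 1))
      (q' := -1 - (q + 1)) (p := -1 - p) (q := -1 - q) (by ring) (by ring)
      (by unfold IsIndex at *; omega) t a
    rw [if_neg (by unfold IsIndex at *; omega), add_zero] at this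
    simp [this]
  π_d_zero z := by
    refine LinearMap.ext fun t => LinearMap.ext fun a => ?_
    have := pinchedD_ι_tmul T A (n := -1 - -1) (m := -1 - 0) (p' := -1 - 0)
      (q' := -1 - 0) (p := -1 - -1) (q := -1 - -1) (by ring) (by ring)
      (by unfold IsIndex; omega) t a
    rw [if_pos (by norm_num),
      pinchedι_of_not T A (by unfold IsIndex; omega : ¬ IsIndex (-1 - 0) (-1 - 0) (-1 - -1)),
      pinchedι_of_not T A (by unfold IsIndex; omega : ¬ IsIndex (-1 - 0) (-1 - -1) (-1 - 0)),
      LinearMap.zero_apply, LinearMap.zero_apply, smul_zero, zero_add, zero_add] at this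
    change z (pinchedD T A (-1 - -1) (-1 - 0) _) = z (pinchedι T A (-1 - 0) (-1 - 0) (-1 - 0)
      ((T.d (-1 - -1) (-1 - 0)).hom t ⊗ₜ s.η (s.ε a)))
    rw [s.η_ε, ← this]
    rfl
  e_dT _ y := rfl
  dT_η _ y := rfl
  e_dA p y := by
    refine LinearMap.ext fun t => LinearMap.ext fun a => ?_
    change y t ((A.d (-1 - 0) (-1 - 1)).hom (s.η a)) = 0
    rw [s.d_η, map_zero]
  dA_η p y := by
    refine LinearMap.ext fun t => LinearMap.ext fun a => ?_
    change y t (s.ε ((A.d (-1 - -2) (-1 - -1)).hom a)) = 0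
    rw [s.ε_d, map_zero]
  e_surjective p := fun y => by
    have := hT (-1 - p)
    -- A functional on `N` extends along `η`: composed with `ε` it kills boundaries, so exactness of
    -- `Hom(A, R)` factors it through the differential `η ∘ ε`.
    refine exists_lift_of_forall_mem_range (LinearMap.lcomp R R s.η) y fun x => ?_
    obtain ⟨g, hg⟩ := hA (-1 - -1 + 1) (-1 - -1) (-1 - 0) rfl (by norm_num) (y x ∘ₗ s.ε)
      (LinearMap.ext fun w => (congrArg (y x) (s.ε_d _ w)).trans (map_zero _))
    refine ⟨g, LinearMap.ext fun z => ?_⟩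
    obtain ⟨w, rfl⟩ := s.ε_surjective z
    have := LinearMap.congr_fun hg w
    simpa [s.η_ε] using this
  η_injective p := fun f g h => by
    refine LinearMap.ext fun t => LinearMap.ext fun z => ?_
    obtain ⟨w, rfl⟩ := s.ε_surjective z
    exact LinearMap.congr_fun (LinearMap.congr_fun h t) w
  exact_row {p q} _ _ y hy := by
    have := hT (-1 - p)
    refine exists_lift_of_forall_mem_range (LinearMap.lcomp R R (A.d (-1 - q) (-1 - (q + 1))).hom)
      y fun x => ?_
    exact hA (-1 - (q - 1)) (-1 - q) (-1 - (q + 1)) (by ring) (by ring) (y x)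
      (LinearMap.congr_fun hy x)
  exact_zero p y hy := by
    have := hT (-1 - p)
    refine exists_lift_of_forall_mem_range (LinearMap.lcomp R R (A.d (-1 - 0) (-1 - 1)).hom)
      y fun x => ?_
    refine hA (-1 - -1) (-1 - 0) (-1 - 1) (by ring) (by ring) (y x)
      (LinearMap.ext fun w => ?_)
    rw [LinearMap.comp_apply, ← s.η_ε]
    exact LinearMap.congr_fun (LinearMap.congr_fun hy x) (s.ε w)
  exact_neg_one p y hy := by
    have := hT (-1 - p)
    refine exists_lift_of_forall_mem_range (LinearMap.lcomp R R s.ε) y fun x => ?_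
    have hle : LinearMap.ker s.ε ≤ LinearMap.ker (y x) := fun w hw => by
      obtain ⟨v, rfl⟩ := s.exact_ε w hw
      exact LinearMap.congr_fun (LinearMap.congr_fun hy x) v
    refine ⟨(LinearMap.ker s.ε).liftQ (y x) hle ∘ₗ
      (s.ε.quotKerEquivOfSurjective s.ε_surjective).symm.toLinearMap, LinearMap.ext fun w => ?_⟩
    have : (s.ε.quotKerEquivOfSurjective s.ε_surjective).symm (s.ε w) = Submodule.Quotient.mk w :=
      (LinearEquiv.symm_apply_eq _).2 rfl
    change ((LinearMap.ker s.ε).liftQ (y x) hle)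
      ((s.ε.quotKerEquivOfSurjective s.ε_surjective).symm (s.ε w)) = _
    rw [this]
    rfl

lemma isHomExact_iff (C : ChainComplex (ModuleCat.{u} R) ℤ)
    (N : Type u) [AddCommGroup N] [Module R N] : IsHomExact C N ↔
    ∀ (n : ℤ) (f : C.X (-1 - n) →ₗ[R] N), f ∘ₗ (C.d (-1 - (n - 1)) (-1 - n)).hom = 0 →
      ∃ g : C.X (-1 - (n + 1)) →ₗ[R] N, g ∘ₗ (C.d (-1 - n) (-1 - (n + 1))).hom = f := by
  refine ⟨fun h n => h _ _ _ (by ring) (by ring), fun h a b c hab hbc => ?_⟩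
  obtain ⟨n, rfl⟩ : ∃ n, b = -1 - n := ⟨-1 - b, by ring⟩
  obtain rfl : a = -1 - (n - 1) := by omega
  obtain rfl : c = -1 - (n + 1) := by omega
  exact h n

/-- The complex `Hom(T ⊠ A, R)` is acyclic if and only if `Hom(T, C_0(A)^*)` is. -/
theorem isHomExact_pinchedTensor_iff (hT : ∀ n, Module.Projective R (T.X n))
    (hA : IsHomExact A R) {N : Type u} [AddCommGroup N] [Module R N] (s : Splice A N 0 (-1)) :
    IsHomExact (pinchedTensor T A) R ↔ IsHomExact T (Module.Dual R N) := by
  rw [isHomExact_iff, isHomExact_iff]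
  exact (dualSystem hT hA (show Splice A N (-1 - -1) (-1 - 0) from
    cast (by rw [sub_self, sub_zero]) s)).exact_iff

end

section

/-! ### Freeness, ranks and the cokernel in degree zero -/

variable {T A : ChainComplex (ModuleCat.{u} R) ℤ}

instance (n : ℤ) : Finite (Index n) := by
  refine Set.Finite.to_subtype (s := {x : ℤ × ℤ | IsIndex n x.1 x.2})
    (((Set.finite_Icc (-|n| - 1) |n|).prod (Set.finite_Icc (-|n| - 1) |n|)).subset ?_)
  rintro ⟨p, q⟩ h
  have h1 := le_abs_self n
  have h2 := neg_abs_le n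
  simp only [Set.mem_ofPred_eq, IsIndex] at h
  simp only [Set.mem_prod, Set.mem_Icc]
  omega

lemma free_pinchedTensor (hT : ∀ n, Module.Free R (T.X n)) (hA : ∀ n, Module.Free R (A.X n))
    (n : ℤ) : Module.Free R ((pinchedTensor T A).X n) := by
  change Module.Free R (pinchedX T A n)
  infer_instance

lemma finite_pinchedTensor (hT : ∀ n, Module.Finite R (T.X n))
    (hA : ∀ n, Module.Finite R (A.X n)) (n : ℤ) :
    Module.Finite R ((pinchedTensor T A).X n) := by
  classical
  have := Fintype.ofFinite (Index n)
  change Module.Finite R (pinchedX T A n)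
  infer_instance

/-- The nonnegative part of the index set, parametrized by the first index. -/
def indexEquivOfNonneg {n : ℤ} (hn : 0 ≤ n) : Finset.Icc 0 n ≃ Index n where
  toFun j := ⟨(j.1, n - j.1), by
    have := Finset.mem_Icc.1 j.2
    exact Or.inl (by dsimp only; omega)⟩
  invFun x := ⟨x.1.1, Finset.mem_Icc.2 (by
    obtain ⟨⟨p, q⟩, h⟩ := x
    unfold IsIndex at h
    dsimp only at *
    omega)⟩
  left_inv j := rfl
  right_inv x := by
    obtain ⟨⟨p, q⟩, h⟩ := x
    unfold IsIndex at h
    dsimp only at *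
    ext
    · rfl
    · dsimp only
      omega

/-- The negative part of the index set, parametrized by the first index. -/
def indexEquivOfNeg {n : ℤ} (hn : n < 0) : Finset.Ico n 0 ≃ Index n where
  toFun j := ⟨(j.1, n - j.1 - 1), by
    have := Finset.mem_Ico.1 j.2
    exact Or.inr (by dsimp only; omega)⟩
  invFun x := ⟨x.1.1, Finset.mem_Ico.2 (by
    obtain ⟨⟨p, q⟩, h⟩ := x
    unfold IsIndex at h
    dsimp only at *
    omega)⟩
  left_inv j := rfl
  right_inv x := by
    obtain ⟨⟨p, q⟩, h⟩ := x
    unfold IsIndex at h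
    dsimp only at *
    ext
    · rfl
    · dsimp only
      omega

section Rank

variable [Nontrivial R] (hT : ∀ n, Module.Free R (T.X n)) (hA : ∀ n, Module.Free R (A.X n))
  (hT' : ∀ n, Module.Finite R (T.X n)) (hA' : ∀ n, Module.Finite R (A.X n))

include hT hA hT' hA' in
lemma finrank_pinchedTensor_of_nonneg {n : ℤ} (hn : 0 ≤ n) :
    Module.finrank R ((pinchedTensor T A).X n) =
      ∑ j ∈ Finset.Icc 0 n, Module.finrank R (T.X j) * Module.finrank R (A.X (n - j)) := by
  classical
  have := Fintype.ofFinite (Index n)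
  change Module.finrank R (pinchedX T A n) = _
  rw [Module.finrank_directSum]
  refine ((indexEquivOfNonneg hn).sum_comp
    fun x : Index n => Module.finrank R (T.X x.1.1 ⊗[R] A.X x.1.2)).symm.trans ?_
  refine Eq.trans ?_ (Finset.sum_coe_sort (Finset.Icc 0 n)
    fun j => Module.finrank R (T.X j) * Module.finrank R (A.X (n - j)))
  exact Finset.sum_congr rfl fun j _ => Module.finrank_tensorProduct

include hT hA hT' hA' in
lemma finrank_pinchedTensor_of_neg {n : ℤ} (hn : n < 0) :
    Module.finrank R ((pinchedTensor T A).X n) =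
      ∑ j ∈ Finset.Ico n 0, Module.finrank R (T.X j) * Module.finrank R (A.X (n - j - 1)) := by
  classical
  have := Fintype.ofFinite (Index n)
  change Module.finrank R (pinchedX T A n) = _
  rw [Module.finrank_directSum]
  refine ((indexEquivOfNeg hn).sum_comp
    fun x : Index n => Module.finrank R (T.X x.1.1 ⊗[R] A.X x.1.2)).symm.trans ?_
  refine Eq.trans ?_ (Finset.sum_coe_sort (Finset.Ico n 0)
    fun j => Module.finrank R (T.X j) * Module.finrank R (A.X (n - j - 1)))
  exact Finset.sum_congr rfl fun j _ => Module.finrank_tensorProduct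

end Rank

/-- The cokernel of the differential ending in degree zero of the pinched tensor product. -/
lemma nonempty_coker_pinchedTensor {M N : Type u} [AddCommGroup M] [Module R M]
    [AddCommGroup N] [Module R N] (s : Splice T M 0 (-1)) (t : Splice A N 0 (-1)) :
    Nonempty (Coker (pinchedTensor T A) 0 ≃ₗ[R] M ⊗[R] N) := by
  have hi : IsIndex 0 0 0 := by unfold IsIndex; omega
  let θ : pinchedX T A 0 →ₗ[R] M ⊗[R] N := TensorProduct.map s.ε t.ε ∘ₗ pinchedπ T A 0 0 0
  have hθ : Function.Surjective θ := by
    refine (TensorProduct.map_surjective s.ε_surjective t.ε_surjective).comp fun y => ?_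
    exact ⟨_, pinchedπ_ι T A hi y⟩
  have hs : Function.Exact (T.d (0 + 1) 0).hom s.ε := fun x => ⟨s.exact_ε x, by
    rintro ⟨y, rfl⟩
    exact s.ε_d _ y⟩
  have ht : Function.Exact (A.d (0 + 1) 0).hom t.ε := fun x => ⟨t.exact_ε x, by
    rintro ⟨y, rfl⟩
    exact t.ε_d _ y⟩
  have hπ : ∀ w : pinchedX T A 1, pinchedπ T A 0 0 0 (pinchedD T A 1 0 w) =
      LinearMap.rTensor (A.X 0) (T.d (0 + 1) 0).hom (pinchedπ T A 1 (0 + 1) 0 w)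
      + (pinchedSign 0 (0 + 1) : R) •
        LinearMap.lTensor (T.X 0) (A.d (0 + 1) 0).hom (pinchedπ T A 1 0 (0 + 1) w) :=
    pinchedπ_d T A (n := 1) (m := 0) (by norm_num) (by norm_num) hi
  -- By right exactness, the kernel of `ε ⊗ ε` is the sum of the images of `d ⊗ id` and `id ⊗ d`.
  -- These are the two components, up to sign, of the differential from degree `1`.
  have hker : LinearMap.range (pinchedD T A 1 0) = LinearMap.ker θ := by
    refine le_antisymm ?_ fun z hz => ?_
    · rintro _ ⟨w, rfl⟩
      rw [LinearMap.mem_ker, LinearMap.comp_apply, hπ, ← LinearMap.mem_ker,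
        TensorProduct.map_ker hs s.ε_surjective ht t.ε_surjective]
      exact add_mem (Submodule.mem_sup_right ⟨_, rfl⟩)
        (Submodule.smul_mem _ _ (Submodule.mem_sup_left ⟨_, rfl⟩))
    · rw [LinearMap.mem_ker, LinearMap.comp_apply, ← LinearMap.mem_ker,
        TensorProduct.map_ker hs s.ε_surjective ht t.ε_surjective, Submodule.mem_sup] at hz
      obtain ⟨_, ⟨y, rfl⟩, _, ⟨x, rfl⟩, hxy⟩ := hz
      refine ⟨pinchedι T A 1 (0 + 1) 0 x +
        (pinchedSign 0 (0 + 1) : R) • pinchedι T A 1 0 (0 + 1) y, ?_⟩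
      have h1 : pinchedπ T A 1 (0 + 1) 0 (pinchedι T A 1 (0 + 1) 0 x +
          (pinchedSign 0 (0 + 1) : R) • pinchedι T A 1 0 (0 + 1) y) = x := by
        rw [map_add, map_smul, pinchedπ_ι T A (by unfold IsIndex; omega),
          pinchedπ_ι_ne T A (by norm_num), smul_zero, add_zero]
      have h2 : pinchedπ T A 1 0 (0 + 1) (pinchedι T A 1 (0 + 1) 0 x +
          (pinchedSign 0 (0 + 1) : R) • pinchedι T A 1 0 (0 + 1) y) =
          (pinchedSign 0 (0 + 1) : R) • y := by
        rw [map_add, map_smul, pinchedπ_ι T A (by unfold IsIndex; omega),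
          pinchedπ_ι_ne T A (by norm_num)]
        exact zero_add _
      rw [← sub_eq_zero]
      refine pinchedX_ext T A _ fun p q hpq => ?_
      obtain ⟨rfl, rfl⟩ : p = 0 ∧ q = 0 := by unfold IsIndex at hpq; omega
      rw [map_sub, hπ, ← hxy, h1, h2, map_smul, smul_smul, pinchedSign_mul_self, one_smul,
        add_comm, sub_self]
  exact ⟨(Submodule.quotEquivOfEq (LinearMap.range (pinchedD T A 1 0)) _ hker).trans
    (θ.quotKerEquivOfSurjective hθ)⟩

/-! ### Total acyclicity -/

/-- A section embeds `Q` in a free module. Since `T_b` is finitely generated, only finitely many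
coordinates of a map into it are nonzero; each of them factors through the differential by exactness
for `R`, and the factors are summed. -/
lemma IsHomExact.of_projective (hT : ∀ n, Module.Finite R (T.X n)) (h : IsHomExact T R)
    (Q : Type u) [AddCommGroup Q] [Module R Q] [hQ : Module.Projective R Q] :
    IsHomExact T Q := by
  intro a b c hab hbc f hf
  obtain ⟨s, hs⟩ := hQ.out
  have := hT b
  obtain ⟨S, hS⟩ : (⊤ : Submodule R (T.X b)).FG := Module.finite_def.1 inferInstance
  classical
  -- The coordinates that occur on a finite generating set contain all those that occur.
  let J : Finset Q := S.biUnion fun x => (s (f x)).support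
  have hJ : ∀ x, s (f x) ∈ Finsupp.supported R R (J : Set Q) := by
    have : (⊤ : Submodule R (T.X b)) ≤
        (Finsupp.supported R R (J : Set Q)).comap (s ∘ₗ f) := by
      rw [← hS, Submodule.span_le]
      intro x hx
      exact Finset.coe_subset.2 (Finset.subset_biUnion_of_mem (fun x => (s (f x)).support) hx)
    exact fun x => this (Submodule.mem_top)
  have hφ : ∀ j : Q, ∃ g : T.X c →ₗ[R] R, g ∘ₗ (T.d b c).hom = Finsupp.lapply j ∘ₗ s ∘ₗ f :=
    fun j => h a b c hab hbc _ (by rw [LinearMap.comp_assoc, LinearMap.comp_assoc, hf]; simp)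
  choose g hg using hφ
  refine ⟨∑ j ∈ J, (LinearMap.toSpanSingleton R Q j) ∘ₗ g j, LinearMap.ext fun x => ?_⟩
  have h1 := hs (f x)
  rw [Finsupp.linearCombination_apply, Finsupp.sum_of_support_subset _
    (Finset.coe_subset.1 (hJ x)) _ (by simp)] at h1
  rw [← h1]
  simp only [LinearMap.comp_apply, LinearMap.sum_apply, LinearMap.toSpanSingleton_apply, id]
  refine Finset.sum_congr rfl fun j _ => ?_
  rw [← LinearMap.comp_apply, hg]
  rfl

/-- Total acyclicity of complexes of finitely generated modules, in terms of elements. -/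
lemma isTotallyAcyclic_iff (hT : ∀ n, Module.Finite R (T.X n)) :
    IsTotallyAcyclic T ↔ (∀ n, Module.Projective R (T.X n)) ∧ IsExact T ∧ IsHomExact T R := by
  constructor
  · rintro ⟨h1, h2, h3⟩
    exact ⟨h1, (acyclic_iff T).1 h2, (homComplex_acyclic_iff T R).1 (h3 R inferInstance)⟩
  · rintro ⟨h1, h2, h3⟩
    exact ⟨h1, (acyclic_iff T).2 h2,
      fun Q _ _ _ => (homComplex_acyclic_iff T Q).2 (h3.of_projective hT Q)⟩

end

section

/-! ### Vanishing of Ext -/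

variable (R) in
/-- The vanishing of `Ext^i(X, Y)`. -/
abbrev ExtVanishes (X Y : Type u) [AddCommGroup X] [Module R X] [AddCommGroup Y] [Module R Y]
    (i : ℕ) : Prop :=
  Subsingleton (Abelian.Ext (ModuleCat.of R X) (ModuleCat.of R Y) i)

section Ext

open Abelian

variable {K F C Y : Type u} [AddCommGroup K] [Module R K] [AddCommGroup F] [Module R F]
  [AddCommGroup C] [Module R C] [AddCommGroup Y] [Module R Y]

lemma shortExact_of_exact {i : K →ₗ[R] F} {p : F →ₗ[R] C} (hi : Function.Injective i)
    (hp : Function.Surjective p) (h : Function.Exact i p) :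
    (ShortComplex.mk (ModuleCat.ofHom i) (ModuleCat.ofHom p)
      (by rw [← ModuleCat.ofHom_comp, h.linearMap_comp_eq_zero]; rfl)).ShortExact where
  exact := (ShortComplex.moduleCat_exact_iff _).2 fun x hx => (h x).1 hx
  mono_f := (ModuleCat.mono_iff_injective _).2 hi
  epi_g := (ModuleCat.epi_iff_surjective _).2 hp

lemma ExtVanishes.of_projective [Module.Projective R F] (n : ℕ) : ExtVanishes R F Y (n + 1) := by
  have : Projective (ModuleCat.of R F) := (IsProjective.iff_projective _).1 inferInstance
  exact subsingleton_of_forall_eq 0 fun e => Ext.eq_zero_of_projective e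

lemma ExtVanishes.of_equiv (e : K ≃ₗ[R] F) {n : ℕ} (h : ExtVanishes R K Y n) :
    ExtVanishes R F Y n := by
  refine subsingleton_of_forall_eq 0 fun x => ?_
  have h1 : (Ext.mk₀ e.symm.toModuleIso.hom).comp
      ((Ext.mk₀ e.toModuleIso.hom).comp x (zero_add n)) (zero_add n) = x := by
    rw [Ext.mk₀_comp_mk₀_assoc]
    have : e.symm.toModuleIso.hom ≫ e.toModuleIso.hom = 𝟙 _ := by
      ext x
      simp
    rw [this, Ext.mk₀_id_comp]
  rw [← h1, Subsingleton.elim ((Ext.mk₀ e.toModuleIso.hom).comp x (zero_add n)) 0, Ext.comp_zero]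

lemma ExtVanishes.of_equiv_right (e : K ≃ₗ[R] F) {n : ℕ} (h : ExtVanishes R Y K n) :
    ExtVanishes R Y F n := by
  refine subsingleton_of_forall_eq 0 fun x => ?_
  have h1 : (x.comp (Ext.mk₀ e.symm.toModuleIso.hom) (add_zero n)).comp
      (Ext.mk₀ e.toModuleIso.hom) (add_zero n) = x := by
    rw [Ext.comp_assoc (a₁₂ := n) (a₂₃ := 0) _ _ _ (add_zero n) (add_zero 0) (by omega),
      Ext.mk₀_comp_mk₀]
    have : e.symm.toModuleIso.hom ≫ e.toModuleIso.hom = 𝟙 _ := by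
      ext x
      simp
    rw [this, Ext.comp_mk₀_id]
  rw [← h1, Subsingleton.elim (x.comp (Ext.mk₀ e.symm.toModuleIso.hom) (add_zero n)) 0,
    Ext.zero_comp]

variable {i : K →ₗ[R] F} {p : F →ₗ[R] C}

lemma ExtVanishes.exists_extension (hi : Function.Injective i) (hp : Function.Surjective p)
    (h : Function.Exact i p) (hC : ExtVanishes R C Y 1) (f : K →ₗ[R] Y) :
    ∃ g : F →ₗ[R] Y, g ∘ₗ i = f := by
  obtain ⟨x, hx⟩ := Ext.contravariant_sequence_exact₁ (shortExact_of_exact hi hp h)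
    (ModuleCat.of R Y) (Ext.mk₀ (ModuleCat.ofHom f)) (n₁ := 1) rfl (Subsingleton.elim _ _)
  obtain ⟨g, rfl⟩ := Ext.homEquiv₀.symm.surjective x
  refine ⟨g.hom, ?_⟩
  erw [Ext.mk₀_comp_mk₀] at hx
  have := Ext.homEquiv₀.symm.injective hx
  exact congrArg ModuleCat.Hom.hom this

/-- As `F` is projective, every class in `Ext^1(C, Y)` is the extension class composed with some `f
: K → Y`. If `f` factors through `i`, the composite is zero. -/
lemma ExtVanishes.of_exists_extension [Module.Projective R F] (hi : Function.Injective i)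
    (hp : Function.Surjective p) (h : Function.Exact i p)
    (H : ∀ f : K →ₗ[R] Y, ∃ g : F →ₗ[R] Y, g ∘ₗ i = f) : ExtVanishes R C Y 1 := by
  have hF : ExtVanishes R F Y 1 := .of_projective 0
  refine subsingleton_of_forall_eq 0 fun x => ?_
  obtain ⟨y, rfl⟩ := Ext.contravariant_sequence_exact₃ (shortExact_of_exact hi hp h)
    (ModuleCat.of R Y) x (Subsingleton.elim (α := Ext (ModuleCat.of R F) (ModuleCat.of R Y) 1) _ _)
    (n₀ := 0) rfl
  obtain ⟨f, rfl⟩ := Ext.homEquiv₀.symm.surjective y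
  obtain ⟨g, hg⟩ := H f.hom
  have hf : f = (ModuleCat.ofHom i) ≫ (ModuleCat.ofHom g) := ModuleCat.hom_ext hg.symm
  change (shortExact_of_exact hi hp h).extClass.comp (Ext.mk₀ f) _ = 0
  rw [hf, ← Ext.mk₀_comp_mk₀, ← Ext.comp_assoc (a₁₂ := 1) (a₂₃ := 0) _ _ _ rfl rfl rfl]
  erw [(shortExact_of_exact hi hp h).extClass_comp]
  rw [Ext.zero_comp]

lemma ExtVanishes.syzygy [Module.Projective R F] (hi : Function.Injective i)
    (hp : Function.Surjective p) (h : Function.Exact i p) {n : ℕ}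
    (hC : ExtVanishes R C Y (n + 2)) : ExtVanishes R K Y (n + 1) := by
  have hF : ExtVanishes R F Y (n + 1) := .of_projective n
  refine subsingleton_of_forall_eq 0 fun x => ?_
  obtain ⟨y, rfl⟩ := Ext.contravariant_sequence_exact₁ (shortExact_of_exact hi hp h)
    (ModuleCat.of R Y) x (n₁ := n + 2) (by omega) (Subsingleton.elim _ _)
  rw [Subsingleton.elim (α := Ext (ModuleCat.of R F) (ModuleCat.of R Y) (n + 1)) y 0,
    Ext.comp_zero]

lemma ExtVanishes.of_syzygy [Module.Projective R F] (hi : Function.Injective i)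
    (hp : Function.Surjective p) (h : Function.Exact i p) {n : ℕ}
    (hK : ExtVanishes R K Y (n + 1)) : ExtVanishes R C Y (n + 2) := by
  have hF : ExtVanishes R F Y (n + 2) := .of_projective (n + 1)
  refine subsingleton_of_forall_eq 0 fun x => ?_
  obtain ⟨y, rfl⟩ := Ext.contravariant_sequence_exact₃ (shortExact_of_exact hi hp h)
    (ModuleCat.of R Y) x
    (Subsingleton.elim (α := Ext (ModuleCat.of R F) (ModuleCat.of R Y) (n + 2)) _ _)
    (n₀ := n + 1) (by omega)
  rw [Subsingleton.elim (α := Ext (ModuleCat.of R K) (ModuleCat.of R Y) (n + 1)) y 0,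
    Ext.comp_zero]

lemma ExtVanishes.exists_lift (hi : Function.Injective i) (hp : Function.Surjective p)
    (h : Function.Exact i p) (hK : ExtVanishes R Y K 1) (f : Y →ₗ[R] C) :
    ∃ g : Y →ₗ[R] F, p ∘ₗ g = f := by
  obtain ⟨x, hx⟩ := Ext.covariant_sequence_exact₃ (ModuleCat.of R Y) (shortExact_of_exact hi hp h)
    (Ext.mk₀ (ModuleCat.ofHom f)) (n₁ := 1) rfl (Subsingleton.elim _ _)
  obtain ⟨g, rfl⟩ := Ext.homEquiv₀.symm.surjective x
  refine ⟨g.hom, ?_⟩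
  erw [Ext.mk₀_comp_mk₀] at hx
  have := Ext.homEquiv₀.symm.injective hx
  exact congrArg ModuleCat.Hom.hom this

lemma ExtVanishes.quotient (hi : Function.Injective i) (hp : Function.Surjective p)
    (h : Function.Exact i p) {n : ℕ} (hF : ExtVanishes R Y F n)
    (hK : ExtVanishes R Y K (n + 1)) : ExtVanishes R Y C n := by
  refine subsingleton_of_forall_eq 0 fun x => ?_
  obtain ⟨y, rfl⟩ := Ext.covariant_sequence_exact₃ (ModuleCat.of R Y) (shortExact_of_exact hi hp h)
    x rfl (Subsingleton.elim (α := Ext (ModuleCat.of R Y) (ModuleCat.of R K) (n + 1)) _ _)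
  rw [Subsingleton.elim (α := Ext (ModuleCat.of R Y) (ModuleCat.of R F) n) y 0, Ext.zero_comp]

end Ext

end

section

/-! ### Short exact sequences and totally reflexive modules -/

/-- The sequence `0 → K → F → C → 0` is exact. -/
structure IsShortExact {K F C : Type*} [AddCommGroup K] [Module R K] [AddCommGroup F] [Module R F]
    [AddCommGroup C] [Module R C] (i : K →ₗ[R] F) (p : F →ₗ[R] C) : Prop where
  injective : Function.Injective i
  surjective : Function.Surjective p
  exact : Function.Exact i p

section

variable {K F C Y : Type u} [AddCommGroup K] [Module R K] [AddCommGroup F] [Module R F]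
  [AddCommGroup C] [Module R C] [AddCommGroup Y] [Module R Y]

lemma exists_desc {p : F →ₗ[R] C} (hp : Function.Surjective p) (f : F →ₗ[R] Y)
    (hf : ∀ x, p x = 0 → f x = 0) : ∃ g : C →ₗ[R] Y, g ∘ₗ p = f := by
  refine ⟨(LinearMap.ker p).liftQ f hf ∘ₗ (p.quotKerEquivOfSurjective hp).symm.toLinearMap,
    LinearMap.ext fun w => ?_⟩
  have : (p.quotKerEquivOfSurjective hp).symm (p w) = Submodule.Quotient.mk w :=
    (LinearEquiv.symm_apply_eq _).2 rfl
  change ((LinearMap.ker p).liftQ f hf) ((p.quotKerEquivOfSurjective hp).symm (p w)) = _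
  rw [this]
  rfl

variable {i : K →ₗ[R] F} {p : F →ₗ[R] C}

namespace IsShortExact

lemma comp_apply (h : IsShortExact i p) (x : K) : p (i x) = 0 := h.exact.apply_apply_eq_zero x

lemma exists_desc (h : IsShortExact i p) (f : F →ₗ[R] Y) (hf : f ∘ₗ i = 0) :
    ∃ g : C →ₗ[R] Y, g ∘ₗ p = f :=
  Pinched.exists_desc h.surjective f fun x hx => by
    obtain ⟨y, rfl⟩ := (h.exact x).1 hx
    exact LinearMap.congr_fun hf y

/-- Dualizing a short exact sequence, if functionals extend. -/
lemma dual (h : IsShortExact i p) (hext : ∀ f : K →ₗ[R] R, ∃ g : F →ₗ[R] R, g ∘ₗ i = f) :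
    IsShortExact p.dualMap i.dualMap where
  injective := LinearMap.dualMap_injective_of_surjective h.surjective
  surjective := hext
  exact f := ⟨fun hf => h.exists_desc f hf, by
    rintro ⟨g, rfl⟩
    refine LinearMap.ext fun x => ?_
    simp [h.comp_apply]⟩

/-- The dual sequence presents `K^*` by the projective module `F^*` with kernel `C^*`. A functional
on `C^*` is evaluation at some `c`, and evaluation at a lift of `c` to `F` extends it. -/
lemma extVanishes_dual_one (h : IsShortExact i p) [Module.Finite R F] [Module.Projective R F]
    (hext : ∀ f : K →ₗ[R] R, ∃ g : F →ₗ[R] R, g ∘ₗ i = f)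
    (hC : Function.Surjective (Module.Dual.eval R C)) :
    ExtVanishes R (Module.Dual R K) R 1 := by
  have h' := h.dual hext
  refine ExtVanishes.of_exists_extension h'.injective h'.surjective h'.exact fun ξ => ?_
  obtain ⟨c, rfl⟩ := hC ξ
  obtain ⟨x, rfl⟩ := h.surjective c
  exact ⟨Module.Dual.eval R F x, rfl⟩

/-- A comparison of the sequence with its bidual. An element of `K^**` gives one of `F^** = F`,
whose image in `C` is killed by all functionals; so `C` need only be torsionless. -/
lemma isReflexive_left (h : IsShortExact i p) [Module.IsReflexive R F]
    (hext : ∀ f : K →ₗ[R] R, ∃ g : F →ₗ[R] R, g ∘ₗ i = f)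
    (hC : Function.Injective (Module.Dual.eval R C)) : Module.IsReflexive R K where
  bijective_dual_eval' := by
    have hF := Module.bijective_dual_eval R F
    constructor
    · intro x y hxy
      apply h.injective
      apply hF.1
      refine LinearMap.ext fun φ => ?_
      exact LinearMap.congr_fun hxy (φ ∘ₗ i)
    · intro ξ
      obtain ⟨x, hx⟩ := hF.2 (ξ ∘ₗ i.dualMap)
      have hx' : ∀ φ : F →ₗ[R] R, φ x = ξ (φ ∘ₗ i) := fun φ => LinearMap.congr_fun hx φ
      have : p x = 0 := by
        apply hC
        refine LinearMap.ext fun κ => ?_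
        have h1 : (κ ∘ₗ p) ∘ₗ i = 0 := LinearMap.ext fun y => by simp [h.comp_apply]
        have := hx' (κ ∘ₗ p)
        rw [h1, map_zero] at this
        simpa using this
      obtain ⟨y, rfl⟩ := (h.exact x).1 this
      refine ⟨y, LinearMap.ext fun f => ?_⟩
      obtain ⟨φ, rfl⟩ := hext f
      exact hx' φ

end IsShortExact

lemma IsTotallyReflexive.of_equiv {G G' : Type u} [AddCommGroup G] [Module R G] [AddCommGroup G']
    [Module R G'] (e : G ≃ₗ[R] G') (h : IsTotallyReflexive R G) : IsTotallyReflexive R G' where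
  finite := have := h.finite; Module.Finite.equiv e
  reflexive := have := h.reflexive; Module.equiv e
  ext_eq_zero i hi := ExtVanishes.of_equiv e (h.ext_eq_zero i hi)
  ext_dual_eq_zero i hi := ExtVanishes.of_equiv e.symm.dualMap (h.ext_dual_eq_zero i hi)

lemma IsTotallyReflexive.dual [IsNoetherianRing R] {G : Type u} [AddCommGroup G] [Module R G]
    (h : IsTotallyReflexive R G) : IsTotallyReflexive R (Module.Dual R G) where
  finite := have := h.finite; inferInstance
  reflexive := have := h.reflexive; inferInstance
  ext_eq_zero := h.ext_dual_eq_zero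
  ext_dual_eq_zero i hi :=
    have := h.reflexive
    ExtVanishes.of_equiv (Module.evalEquiv R G) (h.ext_eq_zero i hi)

lemma IsTotallyReflexive.exists_extension (h : IsShortExact i p) (hC : IsTotallyReflexive R C)
    (f : K →ₗ[R] R) : ∃ g : F →ₗ[R] R, g ∘ₗ i = f :=
  ExtVanishes.exists_extension h.injective h.surjective h.exact (hC.ext_eq_zero 1 le_rfl) f

/-- A syzygy of a totally reflexive module is totally reflexive. -/
lemma IsTotallyReflexive.syzygy [IsNoetherianRing R] [Module.Finite R F] [Module.Projective R F]
    (h : IsShortExact i p) (hC : IsTotallyReflexive R C) : IsTotallyReflexive R K where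
  finite := Module.Finite.of_injective i h.injective
  reflexive := h.isReflexive_left (hC.exists_extension h)
    hC.reflexive.bijective_dual_eval'.1
  ext_eq_zero n hn := by
    obtain ⟨n, rfl⟩ := Nat.exists_eq_add_of_le' hn
    exact ExtVanishes.syzygy h.injective h.surjective h.exact (hC.ext_eq_zero (n + 2) (by omega))
  ext_dual_eq_zero n hn := by
    have h' := h.dual (hC.exists_extension h)
    obtain ⟨n, rfl⟩ := Nat.exists_eq_add_of_le' hn
    -- The first `Ext` of `K^*` vanishes because `C` is reflexive; the higher ones shift to `C^*`,
    -- which is a syzygy of `K^*`.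
    cases n with
    | zero =>
      exact h.extVanishes_dual_one (hC.exists_extension h) hC.reflexive.bijective_dual_eval'.2
    | succ n =>
      exact ExtVanishes.of_syzygy h'.injective h'.surjective h'.exact
        (hC.ext_dual_eq_zero (n + 1) (by omega))

end

/-! ### Cokernels of complexes -/

variable {T : ChainComplex (ModuleCat.{u} R) ℤ}

variable (T) in
/-- The map `C_a(T) → T_b` induced by the differential. -/
def cokerι (a b : ℤ) : Coker T a →ₗ[R] T.X b :=
  Submodule.liftQ _ (T.d a b).hom (by
    rintro _ ⟨y, rfl⟩
    exact d_d_apply T _ _ _ y)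

lemma isShortExact_coker {a b : ℤ} (hab : b + 1 = a)
    (h : ∀ z : T.X a, (T.d a b).hom z = 0 → ∃ w : T.X (a + 1), (T.d (a + 1) a).hom w = z) :
    IsShortExact (cokerι T a b) (Submodule.mkQ (LinearMap.range (T.d (b + 1) b).hom)) where
  injective := LinearMap.ker_eq_bot.1
    (Submodule.ker_liftQ_eq_bot _ _ _ fun x hx => h x hx)
  surjective := Submodule.mkQ_surjective _
  exact x := by
    subst hab
    rw [Submodule.mkQ_apply, Submodule.Quotient.mk_eq_zero]
    constructor
    · rintro ⟨y, rfl⟩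
      exact ⟨Submodule.Quotient.mk y, rfl⟩
    · rintro ⟨y, rfl⟩
      obtain ⟨y, rfl⟩ := Submodule.mkQ_surjective _ y
      exact ⟨y, rfl⟩

lemma IsExact.isShortExact (hT : IsExact T) {a b : ℤ} (hab : b + 1 = a) :
    IsShortExact (cokerι T a b) (Submodule.mkQ (LinearMap.range (T.d (b + 1) b).hom)) :=
  isShortExact_coker hab (hT _ _ _ rfl hab)

lemma mkQ_d_apply {a b : ℤ} (hab : b + 1 = a) (x : T.X a) :
    Submodule.mkQ (LinearMap.range (T.d (b + 1) b).hom) ((T.d a b).hom x) = 0 := by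
  subst hab
  exact (Submodule.Quotient.mk_eq_zero _).2 ⟨x, rfl⟩

lemma IsHomExact.exists_extension {Y : Type u} [AddCommGroup Y] [Module R Y]
    (hT : IsHomExact T Y) {a b : ℤ} (hab : b + 1 = a) (f : Coker T a →ₗ[R] Y) :
    ∃ g : T.X b →ₗ[R] Y, g ∘ₗ cokerι T a b = f := by
  obtain ⟨g, hg⟩ := hT (a + 1) a b rfl hab (f ∘ₗ Submodule.mkQ _) (LinearMap.ext fun x => by
    simp only [LinearMap.comp_apply, mkQ_d_apply, map_zero, LinearMap.zero_apply])
  exact ⟨g, Submodule.linearMap_qext _ hg⟩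

/-- By exactness the cokernel embeds in the projective module `T_{n-1}`, where functionals separate
points. -/
lemma IsExact.injective_eval_coker (hT : IsExact T) (hP : ∀ n, Module.Projective R (T.X n))
    (n : ℤ) : Function.Injective (Module.Dual.eval R (Coker T n)) := by
  have h := hT.isShortExact (sub_add_cancel n 1)
  intro x y hxy
  apply h.injective
  have := hP (n - 1)
  apply Module.eval_apply_injective R
  refine LinearMap.ext fun φ => ?_
  exact LinearMap.congr_fun hxy (φ ∘ₗ cokerι T n (n - 1))

/-- The cokernels of a totally acyclic complex of finitely generated projective modules are
totally reflexive. -/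
theorem isTotallyReflexive_coker [IsNoetherianRing R] (hfin : ∀ n, Module.Finite R (T.X n))
    (hP : ∀ n, Module.Projective R (T.X n)) (hT : IsExact T) (hT' : IsHomExact T R) (n : ℤ) :
    IsTotallyReflexive R (Coker T n) := by
  have hrefl : ∀ n, Module.IsReflexive R (Coker T n) := fun n => by
    obtain ⟨n, rfl⟩ : ∃ m, n = m + 1 := ⟨n - 1, by ring⟩
    exact (hT.isShortExact rfl).isReflexive_left (hT'.exists_extension rfl)
      (hT.injective_eval_coker hP n)
  -- Dimension shifting moves to a neighbouring cokernel, so the induction on `i` treats all `n` at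
  -- once. It moves to `n + 1` here, and to `n - 1` for the duals in `h2`.
  have h1 : ∀ (i : ℕ) (n : ℤ), ExtVanishes R (Coker T n) R (i + 1) := fun i => by
    induction i with
    | zero =>
      intro n
      have h := hT.isShortExact (rfl : n + 1 = n + 1)
      exact ExtVanishes.of_exists_extension h.injective h.surjective h.exact
        (hT'.exists_extension rfl)
    | succ i ih =>
      intro n
      have h := hT.isShortExact (rfl : n + 1 = n + 1)
      exact ExtVanishes.of_syzygy h.injective h.surjective h.exact (ih (n + 1))
  have h2 : ∀ (i : ℕ) (n : ℤ), ExtVanishes R (Module.Dual R (Coker T n)) R (i + 1) := fun i => by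
    induction i with
    | zero =>
      intro n
      obtain ⟨n, rfl⟩ : ∃ m, n = m + 1 := ⟨n - 1, by ring⟩
      exact (hT.isShortExact rfl).extVanishes_dual_one (hT'.exists_extension rfl)
        (hrefl n).bijective_dual_eval'.2
    | succ i ih =>
      intro n
      obtain ⟨n, rfl⟩ : ∃ m, n = m + 1 := ⟨n - 1, by ring⟩
      have h := (hT.isShortExact rfl).dual (hT'.exists_extension (rfl : n + 1 = n + 1))
      exact ExtVanishes.of_syzygy h.injective h.surjective h.exact (ih n)
  exact {
    finite := inferInstance
    reflexive := hrefl n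
    ext_eq_zero := fun i hi => by
      obtain ⟨i, rfl⟩ := Nat.exists_eq_add_of_le' hi
      exact h1 i n
    ext_dual_eq_zero := fun i hi => by
      obtain ⟨i, rfl⟩ := Nat.exists_eq_add_of_le' hi
      exact h2 i n }

end

section

/-! ### Complexes with acyclic dual -/

section HomExactAt

variable {A B C D U V : Type u} [AddCommGroup A] [Module R A] [AddCommGroup B] [Module R B]
  [AddCommGroup C] [Module R C] [AddCommGroup D] [Module R D] [AddCommGroup U] [Module R U]
  [AddCommGroup V] [Module R V]

/-- Exactness of `Hom(A, Y) → Hom(B, Y) → Hom(C, Y)`, for maps `C → B → A`. -/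
def HomExactAt (α : B →ₗ[R] A) (β : C →ₗ[R] B) (Y : Type u) [AddCommGroup Y] [Module R Y] : Prop :=
  ∀ f : B →ₗ[R] Y, f ∘ₗ β = 0 → ∃ g : A →ₗ[R] Y, g ∘ₗ α = f

/-- A piece of the long exact homology sequence: a cocycle with values in `V` is lifted to `U`, the
defect is a cocycle one place further on, and exactness at both places for `U` corrects the lift. -/
lemma HomExactAt.quotient {α : B →ₗ[R] A} {β : C →ₗ[R] B} {γ : D →ₗ[R] C} (hβγ : β ∘ₗ γ = 0)
    {i : U →ₗ[R] U} {q : U →ₗ[R] V} (h : IsShortExact i q)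
    (hlift : ∀ f : B →ₗ[R] V, ∃ g : B →ₗ[R] U, q ∘ₗ g = f)
    (hB : HomExactAt α β U) (hC : HomExactAt β γ U) : HomExactAt α β V := by
  intro f hf
  obtain ⟨f, rfl⟩ := hlift f
  let e := LinearEquiv.ofInjective i h.injective
  have hmem : ∀ c, f (β c) ∈ LinearMap.range i := fun c =>
    (h.exact _).1 (LinearMap.congr_fun hf c)
  let k : C →ₗ[R] U := e.symm.toLinearMap ∘ₗ (f ∘ₗ β).codRestrict (LinearMap.range i) hmem
  have hk : ∀ c, i (k c) = f (β c) := fun c =>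
    congrArg Subtype.val (e.apply_symm_apply ⟨f (β c), hmem c⟩)
  obtain ⟨g, hg⟩ := hC k (LinearMap.ext fun d => h.injective (by
    rw [LinearMap.comp_apply, hk, ← LinearMap.comp_apply β, hβγ]
    simp))
  obtain ⟨l, hl⟩ := hB (f - i ∘ₗ g) (LinearMap.ext fun c => by
    have := LinearMap.congr_fun hg c
    simp only [LinearMap.comp_apply, LinearMap.sub_apply, LinearMap.zero_apply] at this ⊢
    rw [this, hk, sub_self])
  refine ⟨q ∘ₗ l, LinearMap.ext fun b => ?_⟩
  have := LinearMap.congr_fun hl b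
  simp only [LinearMap.comp_apply, LinearMap.sub_apply] at this ⊢
  rw [this, map_sub, h.comp_apply, sub_zero]

lemma HomExactAt.of_equiv {α : B →ₗ[R] A} {β : C →ₗ[R] B} (e : U ≃ₗ[R] V)
    (h : HomExactAt α β U) : HomExactAt α β V := by
  intro f hf
  obtain ⟨g, hg⟩ := h (e.symm.toLinearMap ∘ₗ f) (by
    rw [LinearMap.comp_assoc, hf, LinearMap.comp_zero])
  refine ⟨e.toLinearMap ∘ₗ g, ?_⟩
  rw [LinearMap.comp_assoc, hg]
  ext x
  simp

end HomExactAt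

/-- A complex `⋯ → P_1 → P_0 → X → 0`. -/
structure AugmentedComplex (R : Type u) [CommRing R] where
  X : ModuleCat.{u} R
  P : ℕ → ModuleCat.{u} R
  ε : P 0 →ₗ[R] X
  d : ∀ n, P (n + 1) →ₗ[R] P n
  ε_d : ε ∘ₗ d 0 = 0
  d_d : ∀ n, d n ∘ₗ d (n + 1) = 0

namespace AugmentedComplex

variable (W : AugmentedComplex.{u} R)

/-- The complex `Hom(W, Y)` is acyclic. -/
structure IsHomExact (Y : Type u) [AddCommGroup Y] [Module R Y] : Prop where
  zero : HomExactAt (0 : W.X →ₗ[R] PUnit.{u + 1}) W.ε Y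
  one : HomExactAt W.ε (W.d 0) Y
  add_two : ∀ n, HomExactAt (W.d n) (W.d (n + 1)) Y

variable {W}

/-- Among the terms of `W` only `X` need not be projective; maps out of it lift because `Ext^1(X, U)
= 0`. -/
lemma IsHomExact.quotient (hP : ∀ n, Module.Projective R (W.P n))
    {U V : Type u} [AddCommGroup U] [Module R U] [AddCommGroup V] [Module R V]
    {i : U →ₗ[R] U} {q : U →ₗ[R] V} (h : IsShortExact i q)
    (hX : ExtVanishes R W.X U 1) (hU : W.IsHomExact U) : W.IsHomExact V where
  zero := HomExactAt.quotient W.ε_d h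
    (ExtVanishes.exists_lift h.injective h.surjective h.exact hX) hU.zero hU.one
  one := HomExactAt.quotient (W.d_d 0) h
    (fun f => Module.projective_lifting_property q f h.surjective) hU.one (hU.add_two 0)
  add_two n := HomExactAt.quotient (W.d_d (n + 1)) h
    (fun f => Module.projective_lifting_property q f h.surjective) (hU.add_two n)
      (hU.add_two (n + 1))

/-- The sequence `0 → R/I → R/I → R/(I + x) → 0` for an `R/I`-regular element `x`. -/
lemma isShortExact_smul_quotient (I : Ideal R) (x : R) (hx : ∀ y, x * y ∈ I → y ∈ I) :
    IsShortExact (LinearMap.lsmul R (R ⧸ I) x)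
      (Submodule.factor (le_sup_left : I ≤ I ⊔ Ideal.span {x})) where
  injective := by
    rw [injective_iff_map_eq_zero]
    intro y hy
    obtain ⟨y, rfl⟩ := Submodule.mkQ_surjective _ y
    exact (Submodule.Quotient.mk_eq_zero I).2 (hx y ((Submodule.Quotient.mk_eq_zero I).1 hy))
  surjective := Submodule.factor_surjective _
  exact y := by
    obtain ⟨y, rfl⟩ := Submodule.mkQ_surjective _ y
    have h1 : Submodule.factor (le_sup_left : I ≤ I ⊔ Ideal.span {x}) (Submodule.mkQ I y) =
      Submodule.Quotient.mk y := rfl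
    rw [h1, Submodule.Quotient.mk_eq_zero]
    constructor
    · intro h
      obtain ⟨a, ha, b, hb, rfl⟩ := Submodule.mem_sup.1 h
      obtain ⟨c, rfl⟩ := Ideal.mem_span_singleton'.1 hb
      refine ⟨Submodule.Quotient.mk c, ?_⟩
      refine (Submodule.Quotient.eq I).2 ?_
      have : x • c - (a + c * x) = -a := by rw [smul_eq_mul]; ring
      rw [this]
      exact neg_mem ha
    · rintro ⟨c, hc⟩
      obtain ⟨c, rfl⟩ := Submodule.mkQ_surjective _ c
      have : x • c - y ∈ I := (Submodule.Quotient.eq I).1 hc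
      have h2 : y = x • c - (x • c - y) := by ring
      rw [h2]
      refine sub_mem ?_ (Submodule.mem_sup_left this)
      exact Submodule.mem_sup_right (Ideal.mem_span_singleton'.2 ⟨c, mul_comm c x⟩)

/-- If every element of the maximal ideal is a zero divisor on `R/I`, then the residue field embeds
in `R/I`. -/
lemma exists_injective_residue [IsLocalRing R] [IsNoetherianRing R] (I : Ideal R)
    (h : ∀ x ∈ IsLocalRing.maximalIdeal R, ∃ y, x * y ∈ I ∧ y ∉ I) :
    ∃ f : (R ⧸ IsLocalRing.maximalIdeal R) →ₗ[R] R ⧸ I, Function.Injective f := by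
  have h1 : (IsLocalRing.maximalIdeal R : Set R) ⊆ ⋃ p ∈ associatedPrimes R (R ⧸ I), (p : Set R) := by
    rw [biUnion_associatedPrimes_eq_zero_divisors]
    intro x hx
    obtain ⟨y, hy, hy'⟩ := h x hx
    exact ⟨Submodule.Quotient.mk y, fun h0 => hy' ((Submodule.Quotient.mk_eq_zero I).1 h0),
      (Submodule.Quotient.mk_eq_zero I).2 hy⟩
  -- Prime avoidance puts the maximal ideal inside one of the finitely many associated primes, to
  -- which it is then equal. The two ideals `⊥` are placeholders for the exceptional ones, as all
  -- ideals involved are prime.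
  obtain ⟨p, hp, hle⟩ := (Ideal.subset_union_prime_finite (f := id) (associatedPrimes.finite R (R ⧸ I))
    ⊥ ⊥ (fun p hp _ _ => hp.isPrime)).1 h1
  have hpm : p = IsLocalRing.maximalIdeal R :=
    ((IsLocalRing.maximalIdeal.isMaximal R).eq_of_le hp.isPrime.ne_top hle).symm
  obtain ⟨-, y, hy⟩ := isAssociatedPrime_iff.1 hp
  have hy' : ∀ r, r ∈ IsLocalRing.maximalIdeal R ↔ r • y = 0 := fun r => by
    rw [← hpm, hy, Submodule.mem_colon_singleton, Submodule.mem_bot]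
  exact ⟨Submodule.liftQ _ (LinearMap.toSpanSingleton R (R ⧸ I) y) fun r hr => (hy' r).1 hr,
    LinearMap.ker_eq_bot.1 (Submodule.ker_liftQ_eq_bot _ _ _ fun r hr => (hy' r).2 hr)⟩

/-- A proper submodule of a finitely generated module lies in a maximal one, and the only simple
module over a local ring is the residue field. -/
lemma exists_surjective_residue [IsLocalRing R] {X : Type u} [AddCommGroup X] [Module R X]
    [Module.Finite R X] (N : Submodule R X) (hN : N ≠ ⊤) :
    ∃ f : X →ₗ[R] (R ⧸ IsLocalRing.maximalIdeal R), Function.Surjective f ∧ ∀ x ∈ N, f x = 0 := by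
  obtain ⟨N', hN', hle⟩ := (eq_top_or_exists_le_coatom N).resolve_left hN
  obtain ⟨J, hJ, ⟨e⟩⟩ := isSimpleModule_iff_quot_maximal.1 (isSimpleModule_iff_isCoatom.2 hN')
  obtain rfl := IsLocalRing.eq_maximalIdeal hJ
  refine ⟨e.toLinearMap ∘ₗ N'.mkQ, e.surjective.comp N'.mkQ_surjective, fun x hx => ?_⟩
  have : N'.mkQ x = 0 := (Submodule.Quotient.mk_eq_zero N').2 (hle hx)
  rw [LinearMap.comp_apply, this, map_zero]

variable [IsLocalRing R] [IsNoetherianRing R]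

/-- If `Hom(W, R)` is acyclic and `Ext(X, R)` vanishes in positive degrees, then the augmentation
is surjective. -/
lemma IsHomExact.surjective (hP : ∀ n, Module.Projective R (W.P n)) [Module.Finite R W.X]
    (hX : ∀ i, ExtVanishes R W.X R (i + 1)) (h : W.IsHomExact R) : Function.Surjective W.ε := by
  -- Both conditions survive division by an element of the maximal ideal that is regular on `R ⧸ I`.
  -- Hence for a maximal member no such element exists, and the residue field embeds in `R ⧸ I`.
  let S : Set (Ideal R) := {I | I ≠ ⊤ ∧ W.IsHomExact (R ⧸ I) ∧
    ∀ i, ExtVanishes R W.X (R ⧸ I) (i + 1)}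
  have hS : S.Nonempty := by
    let e : R ≃ₗ[R] R ⧸ (⊥ : Ideal R) := (Submodule.quotEquivOfEqBot _ rfl).symm
    exact ⟨⊥, bot_ne_top, ⟨h.zero.of_equiv e, h.one.of_equiv e, fun n => (h.add_two n).of_equiv e⟩,
      fun i => ExtVanishes.of_equiv_right e (hX i)⟩
  obtain ⟨I, ⟨hI, hWI, hXI⟩, hmax⟩ := wellFounded_gt.has_min S hS
  have hzero : ∀ x ∈ IsLocalRing.maximalIdeal R, ∃ y, x * y ∈ I ∧ y ∉ I := by
    by_contra! hx
    obtain ⟨x, hxm, hx⟩ := hx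
    have hses := isShortExact_smul_quotient I x hx
    refine hmax (I ⊔ Ideal.span {x}) ⟨?_, hWI.quotient hP hses (hXI 0), fun i => ?_⟩ ?_
    · refine ne_top_of_le_ne_top (IsLocalRing.maximalIdeal.isMaximal R).ne_top
        (sup_le (IsLocalRing.le_maximalIdeal hI) ?_)
      rwa [Ideal.span_singleton_le_iff_mem]
    · exact ExtVanishes.quotient hses.injective hses.surjective hses.exact (hXI i) (hXI (i + 1))
    · refine lt_of_le_of_ne le_sup_left fun heq => hI ?_
      have hxI : x ∈ I := by
        rw [heq]
        exact Submodule.mem_sup_right (Ideal.mem_span_singleton_self x)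
      exact (Ideal.eq_top_iff_one I).2 (hx 1 (by rwa [mul_one]))
  obtain ⟨f, hf⟩ := exists_injective_residue I hzero
  by_contra hε
  obtain ⟨g, hg, hg0⟩ := exists_surjective_residue (LinearMap.range W.ε)
    (fun h => hε (LinearMap.range_eq_top.1 h))
  -- A map `X → R ⧸ I` that vanishes on the image of the augmentation must be zero; this one is not.
  obtain ⟨k, hk⟩ := hWI.zero (f ∘ₗ g) (LinearMap.ext fun y => by
    simp [hg0 (W.ε y) ⟨y, rfl⟩])
  have hone : (Submodule.Quotient.mk 1 : R ⧸ IsLocalRing.maximalIdeal R) = 0 := by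
    obtain ⟨x, hx⟩ := hg (Submodule.Quotient.mk 1)
    apply hf
    rw [← hx, map_zero]
    have := LinearMap.congr_fun hk x
    simpa using this.symm
  exact (IsLocalRing.maximalIdeal.isMaximal R).ne_top
    ((Ideal.eq_top_iff_one _).2 ((Submodule.Quotient.mk_eq_zero _).1 hone))

/-- The truncation `⋯ → P_2 → P_1 → Ker(P_0 → X) → 0`. -/
def truncation (W : AugmentedComplex.{u} R) : AugmentedComplex.{u} R where
  X := ModuleCat.of R (LinearMap.ker W.ε)
  P n := W.P (n + 1)
  ε := (W.d 0).codRestrict (LinearMap.ker W.ε) fun x => LinearMap.congr_fun W.ε_d x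
  d n := W.d (n + 1)
  ε_d := LinearMap.ext fun x => Subtype.ext (LinearMap.congr_fun (W.d_d 0) x)
  d_d n := W.d_d (n + 1)

omit [IsLocalRing R] [IsNoetherianRing R] in
lemma isShortExact_ker {F C : Type u} [AddCommGroup F] [Module R F] [AddCommGroup C] [Module R C]
    (p : F →ₗ[R] C) (hp : Function.Surjective p) :
    IsShortExact (LinearMap.ker p).subtype p :=
  ⟨Subtype.val_injective, hp, LinearMap.exact_subtype_ker_map p⟩

/-- If `Hom(W, R)` is acyclic and `Ext(X, R)` vanishes in positive degrees, then `W` is exact. -/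
theorem IsHomExact.exact (hP : ∀ n, Module.Projective R (W.P n))
    (hfin : ∀ n, Module.Finite R (W.P n)) [Module.Finite R W.X]
    (hX : ∀ i, ExtVanishes R W.X R (i + 1)) (h : W.IsHomExact R) :
    Function.Exact (W.d 0) W.ε ∧ ∀ n, Function.Exact (W.d (n + 1)) (W.d n) := by
  -- All hypotheses pass to the truncation, and exactness at `P_0` is surjectivity of the
  -- augmentation of the truncation. Iterating gives exactness everywhere.
  have key : ∀ {W : AugmentedComplex.{u} R} (_ : ∀ n, Module.Projective R (W.P n))
    (_ : ∀ n, Module.Finite R (W.P n)) (_ : Module.Finite R W.X)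
    (_ : ∀ i, ExtVanishes R W.X R (i + 1)) (_ : W.IsHomExact R),
    Module.Finite R W.truncation.X ∧ (∀ i, ExtVanishes R W.truncation.X R (i + 1)) ∧
      W.truncation.IsHomExact R ∧ Function.Exact (W.d 0) W.ε := by
    intro W hP hfin _ hX h
    have hses := isShortExact_ker W.ε (h.surjective hP hX)
    have h0 : Module.Finite R W.truncation.X :=
      inferInstanceAs (Module.Finite R (LinearMap.ker W.ε))
    have h1 : ∀ i, ExtVanishes R W.truncation.X R (i + 1) := fun i =>
      ExtVanishes.syzygy hses.injective hses.surjective hses.exact (hX (i + 1))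
    have h2 : W.truncation.IsHomExact R :=
      { zero := fun f hf => by
          -- The functional extends from the kernel to `P_0`; killing the image of `P_1`, the
          -- extension factors through `X`, so it vanishes on the kernel.
          obtain ⟨g, hg⟩ := ExtVanishes.exists_extension hses.injective hses.surjective hses.exact
            (hX 0) f
          obtain ⟨k, hk⟩ := h.one g (LinearMap.ext fun x => by
            have := LinearMap.congr_fun hf x
            rw [← hg] at this
            exact this)
          refine ⟨0, LinearMap.ext fun x => ?_⟩
          rw [← hg, ← hk]
          have : W.ε x.1 = 0 := x.2
          change (0 : R) = k (W.ε x.1)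
          rw [this, map_zero]
        one := fun f hf => by
          obtain ⟨g, hg⟩ := h.add_two 0 f hf
          exact ⟨g ∘ₗ (LinearMap.ker W.ε).subtype, hg⟩
        add_two := fun n => h.add_two (n + 1) }
    refine ⟨h0, h1, h2, fun x => ⟨fun hx => ?_, ?_⟩⟩
    · obtain ⟨y, hy⟩ := h2.surjective (fun n => hP (n + 1)) h1 ⟨x, hx⟩
      exact ⟨y, congrArg Subtype.val hy⟩
    · rintro ⟨y, rfl⟩
      exact LinearMap.congr_fun W.ε_d y
  refine ⟨(key hP hfin inferInstance hX h).2.2.2, fun n => ?_⟩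
  induction n generalizing W with
  | zero =>
    obtain ⟨h0, h1, h2, -⟩ := key hP hfin inferInstance hX h
    have := (key (fun n => hP (n + 1)) (fun n => hfin (n + 1)) h0 h1 h2).2.2.2
    intro x
    refine Iff.trans ?_ (this x)
    exact (Subtype.ext_iff (a1 := W.truncation.ε x) (a2 := 0)).symm
  | succ n ih =>
    obtain ⟨h0, h1, h2, -⟩ := key hP hfin inferInstance hX h
    exact ih (W := W.truncation) (fun n => hP (n + 1)) (fun n => hfin (n + 1)) h1 h2

end AugmentedComplex

end

section

/-! ### Total acyclicity and total reflexivity -/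

section

variable {L : ChainComplex (ModuleCat.{u} R) ℤ}

variable (L) in
/-- The augmented complex `⋯ → (L_{-2})^* → (L_{-1})^* → C_0(L)^* → 0`. -/
def dualAugmentedComplex : AugmentedComplex.{u} R where
  X := ModuleCat.of R (Module.Dual R (Coker L 0))
  P n := ModuleCat.of R (Module.Dual R (L.X (-1 - (n : ℤ))))
  ε := (cokerι L 0 (-1 - ((0 : ℕ) : ℤ))).dualMap
  d n := (L.d (-1 - (n : ℤ)) (-1 - ((n + 1 : ℕ) : ℤ))).hom.dualMap
  ε_d := LinearMap.ext fun f => Submodule.linearMap_qext _ (LinearMap.ext fun x => by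
    change f ((L.d _ _).hom ((L.d _ _).hom x)) = 0
    rw [d_d_apply, map_zero])
  d_d n := LinearMap.ext fun f => LinearMap.ext fun x => by
    change f ((L.d _ _).hom ((L.d _ _).hom x)) = 0
    rw [d_d_apply, map_zero]

lemma exists_desc_coker {Y : Type u} [AddCommGroup Y] [Module R Y] {a b : ℤ} (hab : b + 1 = a)
    (f : L.X b →ₗ[R] Y) (hf : f ∘ₗ (L.d a b).hom = 0) :
    ∃ g : Coker L b →ₗ[R] Y, g ∘ₗ Submodule.mkQ _ = f := by
  subst hab
  exact ⟨Submodule.liftQ _ f (by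
    rintro _ ⟨y, rfl⟩
    exact LinearMap.congr_fun hf y), Submodule.liftQ_mkQ _ _ _⟩

/-- By reflexivity of `C_0(L)` and of the terms `L_n`, the dual is `0 → C_0(L) → L_{-1} → L_{-2} →
⋯`, which is exact because `L` is. -/
lemma dualAugmentedComplex_isHomExact (hfin : ∀ n, Module.Finite R (L.X n))
    (hP : ∀ n, Module.Projective R (L.X n)) (hL : IsExact L)
    (hG : Module.IsReflexive R (Coker L 0)) : (dualAugmentedComplex L).IsHomExact R := by
  have hinj : ∀ n (x : L.X n), (∀ φ : Module.Dual R (L.X n), φ x = 0) → x = 0 := fun n x hx =>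
    have := hP n
    (Module.forall_dual_apply_eq_zero_iff R x).1 hx
  have hsurj : ∀ n (f : Module.Dual R (L.X n) →ₗ[R] R), ∃ x : L.X n, Module.Dual.eval R _ x = f :=
    fun n f =>
      have := hP n
      have := hfin n
      (Module.bijective_dual_eval R (L.X n)).2 f
  refine ⟨fun f hf => ?_, fun f hf => ?_, fun n f hf => ?_⟩
  · obtain ⟨c, rfl⟩ := hG.bijective_dual_eval'.2 f
    have : c = 0 := by
      apply (hL.isShortExact (a := 0) (b := -1 - ((0 : ℕ) : ℤ)) (by simp)).injective
      rw [map_zero]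
      exact hinj _ _ fun φ => LinearMap.congr_fun hf φ
    subst this
    exact ⟨0, LinearMap.ext fun φ => (LinearMap.map_zero (φ : Coker L 0 →ₗ[R] R)).symm⟩
  · obtain ⟨x, rfl⟩ := hsurj _ f
    have : (L.d (-1 - ((0 : ℕ) : ℤ)) (-1 - ((0 + 1 : ℕ) : ℤ))).hom x = 0 :=
      hinj _ _ fun φ => LinearMap.congr_fun hf φ
    obtain ⟨w, rfl⟩ := hL 0 _ _ (by simp) (by simp) x this
    exact ⟨Module.Dual.eval R _ (Submodule.mkQ _ w), rfl⟩
  · obtain ⟨x, rfl⟩ := hsurj _ f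
    have : (L.d (-1 - ((n + 1 : ℕ) : ℤ)) (-1 - ((n + 1 + 1 : ℕ) : ℤ))).hom x = 0 :=
      hinj _ _ fun φ => LinearMap.congr_fun hf φ
    obtain ⟨w, rfl⟩ := hL (-1 - (n : ℤ)) _ _ (by push_cast; ring) (by push_cast; ring) x this
    exact ⟨Module.Dual.eval R _ w, rfl⟩

/-- An acyclic complex of finitely generated projective modules over a local ring is totally acyclic
if one of its cokernels is totally reflexive. -/
theorem isHomExact_of_isTotallyReflexive [IsLocalRing R] [IsNoetherianRing R]
    (hfin : ∀ n, Module.Finite R (L.X n)) (hP : ∀ n, Module.Projective R (L.X n)) (hL : IsExact L)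
    (hG : IsTotallyReflexive R (Coker L 0)) : IsHomExact L R := by
  have hG' := hG.dual
  have hWfin : Module.Finite R (dualAugmentedComplex L).X := hG'.finite
  have hWP : ∀ n, Module.Projective R ((dualAugmentedComplex L).P n) := fun n => by
    have := hP (-1 - n)
    have := hfin (-1 - n)
    exact inferInstanceAs (Module.Projective R (Module.Dual R (L.X (-1 - (n : ℤ)))))
  have hWF : ∀ n, Module.Finite R ((dualAugmentedComplex L).P n) := fun n => by
    have := hfin (-1 - n)
    exact inferInstanceAs (Module.Finite R (Module.Dual R (L.X (-1 - (n : ℤ)))))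
  have hWX : ∀ i, ExtVanishes R (dualAugmentedComplex L).X R (i + 1) := fun i =>
    hG'.ext_eq_zero (i + 1) (by omega)
  have hW := dualAugmentedComplex_isHomExact hfin hP hL hG.reflexive
  obtain ⟨h0, h1⟩ := hW.exact hWP hWF hWX
  -- The cokernels in nonnegative degrees are iterated syzygies of `C_0(L)`.
  have hpos : ∀ n i : ℕ, ExtVanishes R (Coker L n) R (i + 1) := fun n => by
    induction n with
    | zero => exact fun i => hG.ext_eq_zero (i + 1) (by omega)
    | succ n ih =>
      intro i
      have h := hL.isShortExact (a := ((n + 1 : ℕ) : ℤ)) (b := n) (by push_cast; ring)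
      exact ExtVanishes.syzygy h.injective h.surjective h.exact (ih (i + 1))
  intro a b c hab hbc f hf
  -- Degrees below `0` use exactness of the dual augmented complex, degree `0` uses surjectivity of
  -- its augmentation, and degrees above `0` use the vanishing of `Ext^1(C_c(L), R)`.
  rcases lt_trichotomy b 0 with hb | hb | hb
  · obtain ⟨n, hn⟩ : ∃ n : ℕ, b = -1 - n := ⟨(-1 - b).toNat, by omega⟩
    subst hn
    cases n with
    | zero =>
      obtain rfl : c = -1 - ((0 + 1 : ℕ) : ℤ) := by omega
      obtain rfl : a = 0 := by omega
      refine (h0 f).1 (Submodule.linearMap_qext _ ?_)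
      exact hf
    | succ n =>
      obtain rfl : c = -1 - ((n + 1 + 1 : ℕ) : ℤ) := by omega
      obtain rfl : a = -1 - (n : ℤ) := by omega
      exact (h1 n f).1 hf
  · subst hb
    obtain rfl : c = -1 - ((0 : ℕ) : ℤ) := by omega
    obtain ⟨g, rfl⟩ := exists_desc_coker hab f hf
    obtain ⟨k, rfl⟩ := hW.surjective hWP hWX g
    exact ⟨k, rfl⟩
  · obtain ⟨g, rfl⟩ := exists_desc_coker hab f hf
    obtain ⟨n, rfl⟩ : ∃ n : ℕ, c = n := ⟨c.toNat, by omega⟩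
    have h := hL.isShortExact hbc
    obtain ⟨k, rfl⟩ := ExtVanishes.exists_extension h.injective h.surjective h.exact (hpos n 0) g
    exact ⟨k, rfl⟩

end

end

section

/-! ### Stable retracts -/

variable (R) in
/-- The module `C'` is a retract of `C` up to a projective direct summand. -/
def IsStableRetract (C' C : Type u) [AddCommGroup C'] [Module R C'] [AddCommGroup C] [Module R C] :
    Prop :=
  ∃ (F : ModuleCat.{u} R) (a : C' →ₗ[R] C) (b : C →ₗ[R] C') (s : C' →ₗ[R] F) (t : F →ₗ[R] C'),
    Module.Projective R F ∧ ∀ x, b (a x) + t (s x) = x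

section

variable {K F C K' F' C' : Type u} [AddCommGroup K] [Module R K] [AddCommGroup F] [Module R F]
  [AddCommGroup C] [Module R C] [AddCommGroup K'] [Module R K'] [AddCommGroup F'] [Module R F']
  [AddCommGroup C'] [Module R C']

lemma IsStableRetract.of_equiv (e : C' ≃ₗ[R] C) : IsStableRetract R C' C :=
  ⟨ModuleCat.of R PUnit.{u + 1}, e, e.symm, 0, 0,
    inferInstanceAs (Module.Projective R PUnit.{u + 1}),
    fun x => by simp⟩

lemma IsStableRetract.of_projective [h : Module.Projective R C'] : IsStableRetract R C' C :=
  ⟨ModuleCat.of R C', 0, 0, LinearMap.id, LinearMap.id, h, fun x => by simp⟩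

lemma IsStableRetract.congr_left (h : IsStableRetract R K C) (e : K ≃ₗ[R] C') :
    IsStableRetract R C' C := by
  obtain ⟨F, a, b, s, t, hF, h⟩ := h
  refine ⟨F, a ∘ₗ e.symm, e.toLinearMap ∘ₗ b, s ∘ₗ e.symm, e.toLinearMap ∘ₗ t, hF, fun x => ?_⟩
  simp [← map_add, h]

lemma IsStableRetract.congr_right (h : IsStableRetract R C' K) (e : K ≃ₗ[R] C) :
    IsStableRetract R C' C := by
  obtain ⟨F, a, b, s, t, hF, h⟩ := h
  refine ⟨F, e.toLinearMap ∘ₗ a, b ∘ₗ e.symm.toLinearMap, s, t, hF, fun x => ?_⟩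
  simp [h]

variable {i : K →ₗ[R] F} {p : F →ₗ[R] C} {i' : K' →ₗ[R] F'} {p' : F' →ₗ[R] C'}

lemma IsShortExact.exists_factor {Y : Type u} [AddCommGroup Y] [Module R Y]
    (h : IsShortExact i p) (f : Y →ₗ[R] F) (hf : ∀ y, p (f y) = 0) :
    ∃ g : Y →ₗ[R] K, ∀ y, i (g y) = f y := by
  let e := LinearEquiv.ofInjective i h.injective
  have hmem : ∀ y, f y ∈ LinearMap.range i := fun y => (h.exact _).1 (hf y)
  exact ⟨e.symm.toLinearMap ∘ₗ f.codRestrict (LinearMap.range i) hmem, fun y =>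
    congrArg Subtype.val (e.apply_symm_apply ⟨f y, hmem y⟩)⟩

lemma IsStableRetract.syzygy [Module.Projective R F] [Module.Projective R F']
    (h : IsShortExact i p) (h' : IsShortExact i' p') (hC : IsStableRetract R C' C) :
    IsStableRetract R K' K := by
  obtain ⟨V, a, b, s, t, hV, hst⟩ := hC
  obtain ⟨a0, ha0⟩ := Module.projective_lifting_property p (a ∘ₗ p') h.surjective
  obtain ⟨b0, hb0⟩ := Module.projective_lifting_property p' (b ∘ₗ p) h'.surjective
  obtain ⟨t0, ht0⟩ := Module.projective_lifting_property p' t h'.surjective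
  replace ha0 : ∀ x, p (a0 x) = a (p' x) := fun x => LinearMap.congr_fun ha0 x
  replace hb0 : ∀ x, p' (b0 x) = b (p x) := fun x => LinearMap.congr_fun hb0 x
  replace ht0 : ∀ x, p' (t0 x) = t x := fun x => LinearMap.congr_fun ht0 x
  obtain ⟨a1, ha1⟩ := h.exists_factor (a0 ∘ₗ i') fun x => by
    simp [ha0, h'.comp_apply]
  obtain ⟨b1, hb1⟩ := h'.exists_factor (b0 ∘ₗ i) fun x => by
    simp [hb0, h.comp_apply]
  -- The lifts to the projective modules satisfy the retract identity only modulo `K'`. The defect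
  -- `θ : F' → K'`, together with `i'`, is the new part through a projective module.
  obtain ⟨θ, hθ⟩ := h'.exists_factor (LinearMap.id - b0 ∘ₗ a0 - t0 ∘ₗ s ∘ₗ p') fun x => by
    have := hst (p' x)
    simp only [LinearMap.sub_apply, LinearMap.id_apply, LinearMap.comp_apply, map_sub, hb0, ha0,
      ht0]
    rw [sub_sub, this, sub_self]
  refine ⟨ModuleCat.of R F', a1, b1, i', θ, inferInstanceAs (Module.Projective R F'), fun x => ?_⟩
  apply h'.injective
  simp only [map_add, hb1, ha1, hθ, LinearMap.sub_apply, LinearMap.id_apply, LinearMap.comp_apply,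
    h'.comp_apply, map_zero, sub_zero]
  abel

/-- Dual to the case of syzygies, with extension of maps into projective modules along `i` and `i'`
in place of lifting; the defect now factors through `p'`. -/
lemma IsStableRetract.cosyzygy [Module.Projective R F] [Module.Projective R F']
    (h : IsShortExact i p) (h' : IsShortExact i' p')
    (hi : ∀ (V : Type u) [AddCommGroup V] [Module R V] [Module.Projective R V] (f : K →ₗ[R] V),
      ∃ g : F →ₗ[R] V, g ∘ₗ i = f)
    (hi' : ∀ (V : Type u) [AddCommGroup V] [Module R V] [Module.Projective R V] (f : K' →ₗ[R] V),
      ∃ g : F' →ₗ[R] V, g ∘ₗ i' = f) (hK : IsStableRetract R K' K) :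
    IsStableRetract R C' C := by
  obtain ⟨V, a, b, s, t, hV, hst⟩ := hK
  obtain ⟨a0, ha0⟩ := hi' F (i ∘ₗ a)
  obtain ⟨b0, hb0⟩ := hi F' (i' ∘ₗ b)
  obtain ⟨s0, hs0⟩ := hi' V s
  replace ha0 : ∀ x, a0 (i' x) = i (a x) := fun x => LinearMap.congr_fun ha0 x
  replace hb0 : ∀ x, b0 (i x) = i' (b x) := fun x => LinearMap.congr_fun hb0 x
  replace hs0 : ∀ x, s0 (i' x) = s x := fun x => LinearMap.congr_fun hs0 x
  obtain ⟨a1, ha1⟩ := h'.exists_desc (p ∘ₗ a0) (LinearMap.ext fun x => by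
    simp [ha0, h.comp_apply])
  obtain ⟨b1, hb1⟩ := h.exists_desc (p' ∘ₗ b0) (LinearMap.ext fun x => by
    simp [hb0, h'.comp_apply])
  obtain ⟨θ, hθ⟩ := h'.exists_desc (LinearMap.id - b0 ∘ₗ a0 - i' ∘ₗ t ∘ₗ s0)
    (LinearMap.ext fun x => by
      have := congrArg i' (hst x)
      rw [map_add] at this
      simp only [LinearMap.sub_apply, LinearMap.id_apply, LinearMap.comp_apply, hb0, ha0, hs0,
        LinearMap.zero_apply]
      rw [sub_sub, this, sub_self])
  refine ⟨ModuleCat.of R F', a1, b1, θ, p', inferInstanceAs (Module.Projective R F'), fun x => ?_⟩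
  obtain ⟨y, rfl⟩ := h'.surjective x
  have h1 : a1 (p' y) = p (a0 y) := LinearMap.congr_fun ha1 y
  have h2 : ∀ z, b1 (p z) = p' (b0 z) := fun z => LinearMap.congr_fun hb1 z
  have h3 : θ (p' y) = y - b0 (a0 y) - i' (t (s0 y)) := LinearMap.congr_fun hθ y
  rw [h1, h2, h3, map_sub, map_sub, h'.comp_apply]
  abel

end

/-! ### Stable retracts and totally acyclic complexes; invariance of ranks -/

section

variable {T U : ChainComplex (ModuleCat.{u} R) ℤ}

lemma IsTotallyAcyclic.isExact (hT : IsTotallyAcyclic T) : IsExact T := (acyclic_iff T).1 hT.acyclic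

lemma IsTotallyAcyclic.isHomExact (hT : IsTotallyAcyclic T) (Q : Type u) [AddCommGroup Q]
    [Module R Q] [Module.Projective R Q] : IsHomExact T Q :=
  (homComplex_acyclic_iff T Q).1 (hT.acyclic_hom Q inferInstance)

lemma IsTotallyAcyclic.isStableRetract (hT : IsTotallyAcyclic T) (hU : IsTotallyAcyclic U) {n : ℤ}
    (h : IsStableRetract R (Coker U n) (Coker T n)) (m : ℤ) :
    IsStableRetract R (Coker U m) (Coker T m) := by
  have hT' := hT.projective
  have hU' := hU.projective
  refine Int.inductionOn' (motive := fun m => IsStableRetract R (Coker U m) (Coker T m)) m n h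
    (fun k _ ih => ?_) (fun k _ ih => ?_)
  · exact ih.syzygy (hT.isExact.isShortExact rfl) (hU.isExact.isShortExact rfl)
  · exact ih.cosyzygy (hT.isExact.isShortExact (by ring)) (hU.isExact.isShortExact (by ring))
      (fun V _ _ _ f => (hT.isHomExact V).exists_extension (by ring) f)
      (fun V _ _ _ f => (hU.isHomExact V).exists_extension (by ring) f)

lemma rTensor_mkQ_eq_zero_iff (N : Type u) [AddCommGroup N] [Module R N] {a b : ℤ}
    (hab : b + 1 = a) (w : T.X b ⊗[R] N) :
    LinearMap.rTensor N (Submodule.mkQ (LinearMap.range (T.d (b + 1) b).hom)) w = 0 ↔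
      ∃ v, LinearMap.rTensor N (T.d a b).hom v = w := by
  subst hab
  refine rTensor_exact N (f := (T.d (b + 1) b).hom) (fun x => ?_) (Submodule.mkQ_surjective _) w
  rw [Submodule.mkQ_apply, Submodule.Quotient.mk_eq_zero]
  rfl

/-- The differential factors as `T_b → C_b → T_c`. By right exactness the boundaries in `T_b ⊗ N`
are the kernel of the map to `C_b ⊗ N`, so any homology is the kernel of `C_b ⊗ N → T_c ⊗ N`. -/
lemma isExact_tensorComplex_iff (N : Type u) [AddCommGroup N] [Module R N] :
    IsExact (tensorComplex T N) ↔
      ∀ b c : ℤ, c + 1 = b → ∀ z, LinearMap.rTensor N (cokerι T b c) z = 0 → z = 0 := by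
  have hcomp : ∀ (b c : ℤ) (w : T.X b ⊗[R] N), LinearMap.rTensor N (cokerι T b c)
      (LinearMap.rTensor N (Submodule.mkQ _) w) = LinearMap.rTensor N (T.d b c).hom w :=
    fun b c w => by
      rw [← LinearMap.comp_apply, ← LinearMap.rTensor_comp]
      rfl
  constructor
  · intro h b c hbc z hz
    obtain ⟨w, rfl⟩ := LinearMap.rTensor_surjective N (Submodule.mkQ_surjective _) z
    rw [hcomp] at hz
    exact (rTensor_mkQ_eq_zero_iff N rfl w).2 (h _ _ _ rfl hbc w hz)
  · intro h a b c hab hbc w hw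
    exact (rTensor_mkQ_eq_zero_iff N hab w).1 (h b c hbc _ ((hcomp b c w).trans hw))

/-- This makes the vanishing of Tate homology independent of the resolution. A class `z` that dies
in `U_c ⊗ N` dies under every map from `C_b(U)` to a projective module, since such a map extends
over `U_c`. So both parts of the retract identity send `z` to zero. -/
lemma IsTotallyAcyclic.isExact_tensorComplex (hT : IsTotallyAcyclic T) (hU : IsTotallyAcyclic U)
    {n : ℤ} (h : IsStableRetract R (Coker U n) (Coker T n)) (N : Type u) [AddCommGroup N]
    [Module R N] (hN : IsExact (tensorComplex T N)) : IsExact (tensorComplex U N) := by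
  rw [isExact_tensorComplex_iff] at hN ⊢
  intro b c hbc z hz
  obtain ⟨V, α, β, s, t, hV, hst⟩ := hT.isStableRetract hU h b
  have hT' := hT.projective
  obtain ⟨a0, ha0⟩ := (hU.isHomExact (T.X c)).exists_extension hbc (cokerι T b c ∘ₗ α)
  obtain ⟨s0, hs0⟩ := (hU.isHomExact V).exists_extension hbc s
  have h1 : LinearMap.rTensor N α z = 0 := by
    apply hN b c hbc
    rw [← LinearMap.comp_apply, ← LinearMap.rTensor_comp, ← ha0, LinearMap.rTensor_comp,
      LinearMap.comp_apply, hz, map_zero]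
  have h2 : LinearMap.rTensor N s z = 0 := by
    rw [← hs0, LinearMap.rTensor_comp, LinearMap.comp_apply, hz, map_zero]
  have h3 : LinearMap.rTensor N (β ∘ₗ α + t ∘ₗ s) = LinearMap.id := by
    rw [show β ∘ₗ α + t ∘ₗ s = LinearMap.id from LinearMap.ext hst, LinearMap.rTensor_id]
  have h4 := LinearMap.congr_fun h3 z
  rw [LinearMap.rTensor_add, LinearMap.rTensor_comp, LinearMap.rTensor_comp, LinearMap.add_apply,
    LinearMap.comp_apply, LinearMap.comp_apply, h1, h2, map_zero, map_zero, add_zero] at h4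
  exact h4.symm

variable [IsLocalRing R]

lemma IsMinimal.range_le (hT : IsMinimal T) {a b : ℤ} (hab : b + 1 = a) :
    LinearMap.range (T.d a b).hom ≤ IsLocalRing.maximalIdeal R • (⊤ : Submodule R (T.X b)) := by
  subst hab
  exact hT b

/-- The part of the identity of `C_n(U)` through a projective module factors through `C_n(U) →
U_{n-1}`, so by minimality it vanishes modulo `𝔪`. By Nakayama `C_n(T)` maps onto `C_n(U)`; as `U_n`
is a minimal cover, a second use of Nakayama gives a surjection `T_n → U_n`. -/
lemma finrank_le_of_isStableRetract (hU : IsTotallyAcyclic U)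
    (hmU : IsMinimal U) (hfU : ∀ n, Module.Finite R (U.X n))
    (hfT : ∀ n, Module.Finite R (T.X n)) (hT : ∀ n, Module.Free R (T.X n))
    {n : ℤ}
    (h : IsStableRetract R (Coker U n) (Coker T n)) :
    Module.finrank R (U.X n) ≤ Module.finrank R (T.X n) := by
  obtain ⟨V, α, β, s, t, hV, hst⟩ := h
  set 𝔪 := IsLocalRing.maximalIdeal R
  have hJ : 𝔪 ≤ Ideal.jacobson ⊥ := (IsLocalRing.jacobson_eq_maximalIdeal ⊥ bot_ne_top).ge
  obtain ⟨s0, hs0⟩ := (hU.isHomExact V).exists_extension (sub_add_cancel n 1) s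
  have hts : ∀ x, t (s x) ∈ 𝔪 • (⊤ : Submodule R (Coker U n)) := fun x => by
    obtain ⟨y, rfl⟩ := Submodule.mkQ_surjective _ x
    rw [← hs0]
    have h1 : (U.d n (n - 1)).hom y ∈ 𝔪 • (⊤ : Submodule R (U.X (n - 1))) :=
      hmU.range_le (by ring) ⟨y, rfl⟩
    have h2 := Submodule.mem_map_of_mem (f := t ∘ₗ s0) h1
    rw [Submodule.map_smul''] at h2
    exact Submodule.smul_mono le_rfl le_top h2
  have hβ : Function.Surjective β := by
    rw [← LinearMap.range_eq_top, eq_top_iff]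
    refine Submodule.le_of_le_smul_of_le_jacobson_bot (I := 𝔪) (Module.finite_def.1 inferInstance)
      hJ fun x _ => ?_
    rw [← hst x]
    exact add_mem (Submodule.mem_sup_left ⟨_, rfl⟩) (Submodule.mem_sup_right (hts x))
  obtain ⟨f, hf⟩ := Module.projective_lifting_property
    (Submodule.mkQ (LinearMap.range (U.d (n + 1) n).hom))
    (β ∘ₗ Submodule.mkQ (LinearMap.range (T.d (n + 1) n).hom)) (Submodule.mkQ_surjective _)
  have hfs : Function.Surjective f := by
    rw [← LinearMap.range_eq_top, eq_top_iff]
    refine Submodule.le_of_le_smul_of_le_jacobson_bot (I := 𝔪) (Module.finite_def.1 inferInstance)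
      hJ fun x _ => ?_
    obtain ⟨y, hy⟩ := hβ (Submodule.mkQ _ x)
    obtain ⟨z, rfl⟩ := Submodule.mkQ_surjective _ y
    have h1 : x - f z ∈ LinearMap.range (U.d (n + 1) n).hom := by
      rw [← Submodule.Quotient.eq, ← Submodule.mkQ_apply, ← Submodule.mkQ_apply, ← hy]
      exact (LinearMap.congr_fun hf z).symm
    rw [← add_sub_cancel (f z) x]
    exact add_mem (Submodule.mem_sup_left ⟨_, rfl⟩) (Submodule.mem_sup_right (hmU n h1))
  exact LinearMap.finrank_le_finrank_of_surjective hfs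

/-- Minimal totally acyclic complexes with stably equivalent cokernels have the same ranks. -/
lemma finrank_eq_of_isStableRetract (hT : IsTotallyAcyclic T) (hU : IsTotallyAcyclic U)
    (hmT : IsMinimal T) (hmU : IsMinimal U) (hfT : ∀ n, Module.Finite R (T.X n))
    (hfU : ∀ n, Module.Finite R (U.X n)) (hTf : ∀ n, Module.Free R (T.X n))
    (hUf : ∀ n, Module.Free R (U.X n)) {m : ℤ}
    (h : IsStableRetract R (Coker U m) (Coker T m)) (h' : IsStableRetract R (Coker T m) (Coker U m))
    (n : ℤ) : Module.finrank R (T.X n) = Module.finrank R (U.X n) :=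
  le_antisymm (finrank_le_of_isStableRetract hT hmT hfT hfU hUf (hU.isStableRetract hT h' n))
    (finrank_le_of_isStableRetract hU hmU hfU hfT hTf (hT.isStableRetract hU h n))

/-- In a complete resolution `T → P → M`, only high syzygies relate `T` to `M`. The comparison with
`U` is carried along syzygies from `M` up to a degree `m` where `C_m(T)` and `C_m(P)` agree, and
total acyclicity brings it back to every degree. -/
lemma CompleteResolution.finrank_eq {M : Type u} [AddCommGroup M] [Module R M]
    (X : CompleteResolution R M) (hX : X.IsMinimal) (hU : IsTotallyAcyclic U) (hmU : Pinched.IsMinimal U)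
    (hfU : ∀ n, Module.Finite R (U.X n)) (hUf : ∀ n, Module.Free R (U.X n))
    (h : IsStableRetract R (Coker U 0) M) (h' : IsStableRetract R M (Coker U 0)) (n : ℤ) :
    Module.finrank R (X.T.X n) = Module.finrank R (U.X n) := by
  have hP := X.projective
  have hUP := hU.projective
  have hex : ∀ n : ℕ, IsShortExact (cokerι X.P ((n + 1 : ℕ) : ℤ) n)
      (Submodule.mkQ (LinearMap.range (X.P.d (n + 1) n).hom)) := fun n =>
    isShortExact_coker (by push_cast; ring) ((exactAt_iff X.P rfl (by push_cast; ring)).1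
      (X.exactAt_of_pos _ (by positivity)))
  have e0 : Coker X.P 0 ≃ₗ[R] M :=
    X.exact_zero.linearEquivOfSurjective X.surjective
  have key : ∀ n : ℕ, IsStableRetract R (Coker U n) (Coker X.P n) ∧
      IsStableRetract R (Coker X.P n) (Coker U n) := fun n => by
    induction n with
    | zero => exact ⟨h.congr_right e0.symm, h'.congr_left e0.symm⟩
    | succ n ih =>
      have hexU : IsShortExact (cokerι U ((n + 1 : ℕ) : ℤ) n) _ :=
        hU.isExact.isShortExact (by push_cast; ring)
      exact ⟨ih.1.syzygy (hex n) hexU, ih.2.syzygy hexU (hex n)⟩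
  obtain ⟨g, hg⟩ := X.isIso
  obtain ⟨m, hm⟩ : ∃ m : ℕ, g ≤ m := ⟨g.toNat, Int.self_le_toNat g⟩
  have := hg m hm
  have := hg (m + 1) (by omega)
  have e : Coker X.T m ≃ₗ[R] Coker X.P m := by
    refine Submodule.Quotient.equiv _ _ (asIso (X.τ.f m)).toLinearEquiv ?_
    ext x
    constructor
    · rintro ⟨_, ⟨y, rfl⟩, rfl⟩
      refine ⟨(X.τ.f (m + 1)).hom y, ?_⟩
      exact LinearMap.congr_fun (congrArg ModuleCat.Hom.hom (X.τ.comm (m + 1) m)) y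
    · rintro ⟨y, rfl⟩
      obtain ⟨y, rfl⟩ := (asIso (X.τ.f (m + 1))).toLinearEquiv.surjective y
      refine ⟨_, ⟨y, rfl⟩, ?_⟩
      exact (LinearMap.congr_fun (congrArg ModuleCat.Hom.hom (X.τ.comm (m + 1) m)) y).symm
  exact finrank_eq_of_isStableRetract X.totallyAcyclic hU hX.minimal_T hmU hX.finite_T hfU
    hX.free_T hUf ((key m).1.congr_right e.symm) ((key m).2.congr_left e.symm) n

lemma stableBetti_eq {M : Type u} [AddCommGroup M] [Module R M]
    (hM : HasMinimalCompleteResolution R M) (hU : IsTotallyAcyclic U) (hmU : IsMinimal U)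
    (hfU : ∀ n, Module.Finite R (U.X n)) (hUf : ∀ n, Module.Free R (U.X n))
    (h : IsStableRetract R (Coker U 0) M) (h' : IsStableRetract R M (Coker U 0)) (n : ℤ) :
    stableBetti R M n = Module.finrank R (U.X n) := by
  rw [stableBetti, dif_pos hM]
  exact hM.choose.finrank_eq hM.choose_spec hU hmU hfU hUf h h' n

end

end

section

/-! ### Minimal covers and minimal complete resolutions -/

lemma exists_int_sequence {S : Type*} (r : S → S → Prop) (up : ∀ s, ∃ s', r s s')
    (down : ∀ s, ∃ s', r s' s) (s : S) (m : ℤ) :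
    ∃ f : ℤ → S, f m = s ∧ ∀ n, r (f n) (f (n + 1)) := by
  choose g hg using up
  choose h hh using down
  let f : ℤ → S
    | .ofNat n => g^[n] s
    | .negSucc n => h^[n + 1] s
  have hf : ∀ n, r (f n) (f (n + 1)) := by
    rintro (n | _ | n)
    · change r (g^[n] s) (g^[n + 1] s)
      rw [Function.iterate_succ_apply']
      exact hg _
    · exact hh s
    · change r (h^[n + 1 + 1] s) (h^[n + 1] s)
      rw [Function.iterate_succ_apply' h (n + 1)]
      exact hh _
  refine ⟨fun n => f (n - m), ?_, fun n => ?_⟩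
  · simp only [sub_self]
    rfl
  · have := hf (n - m)
    rwa [sub_add_eq_add_sub] at this

/-- For a free module the coordinate functionals already decide membership. This translates
minimality into a statement about functionals, as for free summands in `not_hasFreeSummand_iff`. -/
lemma mem_smul_top_iff {F : Type*} [AddCommGroup F] [Module R F] [Module.Free R F] (I : Ideal R)
    (x : F) : x ∈ I • (⊤ : Submodule R F) ↔ ∀ φ : F →ₗ[R] R, φ x ∈ I := by
  constructor
  · intro hx φ
    induction hx using Submodule.smul_induction_on' with
    | smul r hr y _ =>
      rw [map_smul]
      exact Ideal.mul_mem_right _ _ hr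
    | add y _ z _ hy hz =>
      rw [map_add]
      exact add_mem hy hz
  · intro h
    let b := Module.Free.chooseBasis R F
    rw [← b.linearCombination_repr x, Finsupp.linearCombination_apply]
    exact Submodule.sum_mem _ fun i _ => Submodule.smul_mem_smul (h (b.coord i)) Submodule.mem_top

section Local

variable [IsLocalRing R]

open IsLocalRing

lemma hasFreeSummand_iff {M : Type u} [AddCommGroup M] [Module R M] :
    HasFreeSummand R M ↔ ∃ (p : M →ₗ[R] R) (x : M), p x ∉ maximalIdeal R := by
  simp only [mem_maximalIdeal, mem_nonunits_iff, not_not]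
  constructor
  · rintro ⟨i, p, h⟩
    exact ⟨p, i 1, by rw [← LinearMap.comp_apply, h]; exact isUnit_one⟩
  · rintro ⟨p, x, u, hu⟩
    refine ⟨LinearMap.toSpanSingleton R M ((↑u⁻¹ : R) • x), p, LinearMap.ext_ring ?_⟩
    simp [← hu]

lemma not_hasFreeSummand_iff {M : Type u} [AddCommGroup M] [Module R M] :
    ¬ HasFreeSummand R M ↔ ∀ (p : M →ₗ[R] R) (x : M), p x ∈ maximalIdeal R := by
  rw [hasFreeSummand_iff]
  push Not
  rfl

/-- Every finitely generated module over a local ring has a minimal cover by a free module. -/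
lemma exists_minimal_cover (X : Type u) [AddCommGroup X] [Module R X] [Module.Finite R X] :
    ∃ (n : ℕ) (p : (Fin n → R) →ₗ[R] X), Function.Surjective p ∧
      LinearMap.ker p ≤ maximalIdeal R • ⊤ := by
  let k := ResidueField R
  -- Lifts of a basis of `k ⊗ X` generate `X` by Nakayama, and a relation among them has
  -- coefficients in the maximal ideal by linear independence.
  let b := Module.finBasis k (k ⊗[R] X)
  have hs : Function.Surjective (TensorProduct.mk R k X 1) :=
    TensorProduct.mk_surjective R X k Ideal.Quotient.mk_surjective
  choose v hv using fun i => hs (b i)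
  have hspan := span_eq_top_of_tmul_eq_basis v b hv
  refine ⟨_, Fintype.linearCombination R v, ?_, fun x hx => ?_⟩
  · rw [← LinearMap.range_eq_top, Fintype.range_linearCombination, hspan]
  · have h1 : ∑ i, residue R (x i) • b i = 0 := by
      have := congrArg (TensorProduct.mk R k X 1) hx
      rw [Fintype.linearCombination_apply, map_sum, map_zero] at this
      rw [← this]
      refine Finset.sum_congr rfl fun i _ => ?_
      rw [map_smul, hv]
      exact algebraMap_smul k (x i) (b i)
    have h2 : ∀ i, x i ∈ maximalIdeal R := fun i => by
      have := Fintype.linearIndependent_iff.1 b.linearIndependent _ h1 i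
      exact (residue_eq_zero_iff _).1 this
    rw [mem_smul_top_iff]
    intro φ
    rw [pi_eq_sum_univ x, map_sum]
    exact Submodule.sum_mem _ fun i _ => by
      rw [map_smul]
      exact Ideal.mul_mem_right _ _ (h2 i)

variable (R) in
/-- The module `K'` is a minimal first syzygy of `K`, and a submodule of `𝔪 F` for a free
module `F` of finite rank. -/
def IsMinimalSyzygy (K K' : ModuleCat.{u} R) : Prop :=
  ∃ (F : ModuleCat.{u} R) (i : K' →ₗ[R] F) (p : F →ₗ[R] K), Module.Free R F ∧ Module.Finite R F ∧
    IsShortExact i p ∧ LinearMap.range i ≤ maximalIdeal R • ⊤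

variable [IsNoetherianRing R]

/-- A minimal syzygy lies in `𝔪 F`, and its functionals extend to `F` because `Ext^1(K, R) = 0`. So
they take values in `𝔪`, and there is no free summand. -/
lemma IsTotallyReflexive.exists_syzygy {K : ModuleCat.{u} R} (hK : IsTotallyReflexive R K) :
    ∃ K' : ModuleCat.{u} R, IsTotallyReflexive R K' ∧ ¬ HasFreeSummand R K' ∧
      IsMinimalSyzygy R K K' := by
  have := hK.finite
  obtain ⟨n, p, hp, hmin⟩ := exists_minimal_cover (R := R) K
  have h := AugmentedComplex.isShortExact_ker p hp
  refine ⟨ModuleCat.of R (LinearMap.ker p), hK.syzygy h, ?_, ModuleCat.of R (Fin n → R),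
    (LinearMap.ker p).subtype, p, inferInstanceAs (Module.Free R (Fin n → R)),
    inferInstanceAs (Module.Finite R (Fin n → R)), h, by rwa [Submodule.range_subtype]⟩
  rw [not_hasFreeSummand_iff]
  intro f x
  obtain ⟨g, rfl⟩ := hK.exists_extension h f
  exact (mem_smul_top_iff _ _).1 (hmin x.2) g

/-- Dualizing a minimal cover `F → K^*` with kernel `Z` embeds `K = K^{**}` in `F^*` with cokernel
`Z^*`. The image lies in `𝔪 F^*` because `K` has no free summand, and `Z^*` has none because the
reflexive module `Z` has none. -/
lemma IsTotallyReflexive.exists_cosyzygy {K : ModuleCat.{u} R} (hK : IsTotallyReflexive R K)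
    (hK' : ¬ HasFreeSummand R K) :
    ∃ C : ModuleCat.{u} R, IsTotallyReflexive R C ∧ ¬ HasFreeSummand R C ∧
      IsMinimalSyzygy R C K := by
  obtain ⟨Z, hZ, hZ', F, i, p, hF, hF', h, -⟩ :=
    IsTotallyReflexive.exists_syzygy (K := ModuleCat.of R (Module.Dual R K)) hK.dual
  have h' := h.dual (hK.dual.exists_extension h)
  have hrefl := hK.reflexive
  refine ⟨ModuleCat.of R (Module.Dual R Z), hZ.dual, ?_, ModuleCat.of R (Module.Dual R F),
    p.dualMap ∘ₗ Module.Dual.eval R K, i.dualMap,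
    inferInstanceAs (Module.Free R (Module.Dual R F)),
    inferInstanceAs (Module.Finite R (Module.Dual R F)), ⟨?_, h'.surjective, ?_⟩, ?_⟩
  · rw [not_hasFreeSummand_iff] at hZ' ⊢
    intro f ζ
    obtain ⟨z, rfl⟩ := hZ.reflexive.bijective_dual_eval'.2 f
    exact hZ' ζ z
  · exact h'.injective.comp (Module.bijective_dual_eval R K).1
  · intro f
    rw [h'.exact f]
    constructor
    · rintro ⟨ξ, rfl⟩
      obtain ⟨x, rfl⟩ := (Module.bijective_dual_eval R K).2 ξ
      exact ⟨x, rfl⟩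
    · rintro ⟨x, rfl⟩
      exact ⟨_, rfl⟩
  · rintro _ ⟨x, rfl⟩
    refine (mem_smul_top_iff (F := Module.Dual R F) _ _).2 fun φ => ?_
    exact not_hasFreeSummand_iff.1 hK' (φ ∘ₗ p.dualMap ∘ₗ Module.Dual.eval R K) x

/-- A totally reflexive module without free summands is a cokernel of a minimal totally acyclic
complex. -/
theorem IsTotallyReflexive.exists_minimal_totallyAcyclic {K : Type u} [AddCommGroup K] [Module R K]
    (hK : IsTotallyReflexive R K) (hK' : ¬ HasFreeSummand R K) (m : ℤ) :
    ∃ T : ChainComplex (ModuleCat.{u} R) ℤ, IsTotallyAcyclic T ∧ IsMinimal T ∧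
      (∀ n, Module.Free R (T.X n)) ∧ (∀ n, Module.Finite R (T.X n)) ∧
      Nonempty (Coker T m ≃ₗ[R] K) := by
  let S := {K : ModuleCat.{u} R // IsTotallyReflexive R K ∧ ¬ HasFreeSummand R K}
  obtain ⟨f, hf, hr⟩ := exists_int_sequence (S := S) (fun K K' => IsMinimalSyzygy R K.1 K'.1)
    (fun K => by
      obtain ⟨K', h1, h2, h3⟩ := K.2.1.exists_syzygy
      exact ⟨⟨K', h1, h2⟩, h3⟩)
    (fun K => by
      obtain ⟨K', h1, h2, h3⟩ := K.2.1.exists_cosyzygy K.2.2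
      exact ⟨⟨K', h1, h2⟩, h3⟩)
    ⟨ModuleCat.of R K, hK, hK'⟩ m
  choose F i p hF hF' hses hmin using hr
  let T : ChainComplex (ModuleCat.{u} R) ℤ := ChainComplex.of F
    (fun n => ModuleCat.ofHom (i n ∘ₗ p (n + 1))) (fun n => by
      ext x
      simp [(hses (n + 1)).comp_apply])
  have hd : ∀ n, (T.d (n + 1) n).hom = i n ∘ₗ p (n + 1) := fun n =>
    congrArg ModuleCat.Hom.hom (ChainComplex.of_d F (fun n => ModuleCat.ofHom (i n ∘ₗ p (n + 1))) n)
  have hex : IsExact T := by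
    intro a b c hab hbc z hz
    subst hab hbc
    rw [hd] at hz
    obtain ⟨y, rfl⟩ := ((hses (c + 1)).exact z).1 ((hses c).injective (hz.trans (map_zero _).symm))
    obtain ⟨w, rfl⟩ := (hses (c + 1 + 1)).surjective y
    exact ⟨w, LinearMap.congr_fun (hd (c + 1)) w⟩
  have hhom : IsHomExact T R := by
    intro a b c hab hbc g hg
    subst hab hbc
    rw [hd] at hg
    obtain ⟨k, rfl⟩ := (hses (c + 1)).exists_desc (g : F (c + 1) →ₗ[R] R)
      (LinearMap.ext fun y => by
        obtain ⟨w, rfl⟩ := (hses (c + 1 + 1)).surjective y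
        exact LinearMap.congr_fun hg w)
    obtain ⟨l, rfl⟩ := (f c).2.1.exists_extension (hses c) k
    exact ⟨l, by rw [hd]; rfl⟩
  have hfin : ∀ n, Module.Finite R (T.X n) := hF'
  refine ⟨T, (isTotallyAcyclic_iff hfin).2 ⟨fun n => ?_, hex, hhom⟩, fun n => ?_, hF, hfin, ?_⟩
  · have := hF n
    exact inferInstanceAs (Module.Projective R (F n))
  · rw [hd]
    exact (LinearMap.range_comp_le_range _ _).trans (hmin n)
  · have e : (f m).1 ≃ₗ[R] K := by
      rw [hf]
    have hexact : Function.Exact (T.d (m + 1) m).hom (p m) := fun x => by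
      rw [(hses m).exact x, hd]
      constructor
      · rintro ⟨y, rfl⟩
        obtain ⟨w, rfl⟩ := (hses (m + 1)).surjective y
        exact ⟨w, rfl⟩
      · rintro ⟨w, rfl⟩
        exact ⟨_, rfl⟩
    exact ⟨(hexact.linearEquivOfSurjective (hses m).surjective).trans e⟩

/-- Totally reflexive modules have minimal complete projective resolutions. -/
theorem IsTotallyReflexive.hasMinimalCompleteResolution {M : Type u} [AddCommGroup M] [Module R M]
    (hM : IsTotallyReflexive R M) : HasMinimalCompleteResolution R M := by
  -- `M` may have free summands, but its minimal first syzygy `K` has none. So `T` is built with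
  -- `C_1(T) = K`; then `P` is `T` in positive degrees, `F` in degree `0`, and zero below.
  obtain ⟨K, hK, hK', F, i, p, hF, hF', h, hmin⟩ :=
    IsTotallyReflexive.exists_syzygy (K := ModuleCat.of R M) hM
  obtain ⟨T, hT, hmT, hTf, hTfin, ⟨e⟩⟩ := hK.exists_minimal_totallyAcyclic hK' 1
  let j : T.X 1 →ₗ[R] F := i ∘ₗ e.toLinearMap ∘ₗ Submodule.mkQ _
  have hj : ∀ x, j x = 0 ↔ ∃ w, (T.d 2 1).hom w = x := fun x => by
    rw [← (i.comp e.toLinearMap).map_zero]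
    refine (h.injective.comp e.injective).eq_iff.trans ?_
    exact Submodule.Quotient.mk_eq_zero _
  have hjr : LinearMap.range j = LinearMap.range i := by
    refine le_antisymm (LinearMap.range_comp_le_range _ _) ?_
    rintro _ ⟨y, rfl⟩
    obtain ⟨x, hx⟩ := Submodule.mkQ_surjective _ (e.symm y)
    exact ⟨x, congrArg i (by rw [LinearMap.comp_apply, hx]; simp)⟩
  -- The component of `τ` in degree `0` exists because `Hom(T, F)` is exact; it need not be an
  -- isomorphism.
  obtain ⟨t, ht⟩ := hT.isHomExact F 2 1 0 rfl rfl j (LinearMap.ext fun w => (hj _).2 ⟨w, rfl⟩)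
  let X : ℤ → ModuleCat.{u} R
    | .ofNat 0 => F
    | .ofNat (n + 1) => T.X (.ofNat (n + 1))
    | .negSucc _ => ModuleCat.of R PUnit.{u + 1}
  let d : ∀ n : ℤ, X (n + 1) ⟶ X n
    | .ofNat 0 => ModuleCat.ofHom j
    | .ofNat (n + 1) => T.d (.ofNat (n + 1 + 1)) (.ofNat (n + 1))
    | .negSucc _ => 0
  have hd : ∀ n, d (n + 1) ≫ d n = 0 := by
    rintro ((_ | n) | n)
    · ext x
      exact (hj _).2 ⟨x, rfl⟩
    · exact T.d_comp_d _ _ _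
    · exact Limits.comp_zero
  let P : ChainComplex (ModuleCat.{u} R) ℤ := ChainComplex.of X d hd
  have hPd : ∀ n, P.d (n + 1) n = d n := fun n => ChainComplex.of_d X d n
  let f : ∀ n : ℤ, T.X n ⟶ X n
    | .ofNat 0 => ModuleCat.ofHom t
    | .ofNat (n + 1) => 𝟙 _
    | .negSucc _ => 0
  let τ : T ⟶ P := {
    f := f
    comm' := by
      rintro _ n rfl
      rw [hPd]
      obtain ((_ | n) | n) := n
      · ext x
        exact (LinearMap.congr_fun ht x).symm
      · exact (Category.id_comp _).trans (Category.comp_id _).symm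
      · exact Limits.comp_zero.trans Limits.comp_zero.symm }
  have hPfree : ∀ n, Module.Free R (P.X n) := by
    rintro ((_ | n) | n)
    · exact hF
    · exact hTf _
    · exact inferInstanceAs (Module.Free R PUnit.{u + 1})
  refine ⟨⟨T, P, τ, p, hT, fun n => ?_, ?_, ?_, ?_, h.surjective, 1, ?_⟩,
    hTf, hTfin, hmT, hPfree, ?_, ?_⟩
  · have := hPfree n
    infer_instance
  · rintro ((_ | n) | n) hn
    · exact absurd hn (by decide)
    · exact absurd hn (not_lt.2 (Int.natCast_nonneg (n + 1)))
    · exact inferInstanceAs (Subsingleton PUnit.{u + 1})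
  · rintro ((_ | _ | n) | n) hn
    · exact absurd hn (by decide)
    · refine (exactAt_iff P (a := 1 + 1) (b := 1) (c := 0) rfl rfl).2 fun z hz => ?_
      rw [show P.d (1 + 1) 1 = d 1 from hPd 1]
      rw [show P.d 1 0 = d 0 from hPd 0] at hz
      exact (hj z).1 hz
    · refine (exactAt_iff P (b := .ofNat (n + 1 + 1)) (c := .ofNat (n + 1)) rfl rfl).2
        fun z hz => ?_
      rw [hPd]
      rw [show P.d (.ofNat (n + 1 + 1)) (.ofNat (n + 1)) = d (.ofNat (n + 1)) from
        hPd (.ofNat (n + 1))] at hz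
      change T.X (.ofNat (n + 1 + 1)) at z
      change (T.d (.ofNat (n + 1 + 1)) (.ofNat (n + 1))).hom z = 0 at hz
      exact hT.isExact (Int.ofNat (n + 1 + 1) + 1) (Int.ofNat (n + 1 + 1)) (Int.ofNat (n + 1)) rfl rfl
        z hz
    · exact absurd hn (by simp)
  · intro x
    refine (h.exact x).trans ?_
    rw [show P.d 1 0 = d 0 from hPd 0, ← LinearMap.coe_range, ← LinearMap.coe_range, ← hjr]
    rfl
  · rintro ((_ | n) | n) hn
    · exact absurd hn (by decide)
    · exact inferInstanceAs (IsIso (𝟙 (T.X (.ofNat (n + 1)))))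
    · exact absurd hn (not_le.2 ((Int.negSucc_lt_zero n).trans one_pos))
  · rintro ((_ | n) | n)
    · exact hF'
    · exact hTfin _
    · exact inferInstanceAs (Module.Finite R PUnit.{u + 1})
  · intro n
    change LinearMap.range (P.d (n + 1) n).hom ≤ _
    rw [hPd]
    obtain ((_ | n) | n) := n
    · exact hjr.trans_le hmin
    · exact hmT (.ofNat (n + 1))
    · rintro _ ⟨x, rfl⟩
      exact zero_mem _

end Local

end

section

/-! ### Minimality of pinched tensor products -/

lemma map_mem_smul_top {F G : Type*} [AddCommGroup F] [Module R F] [AddCommGroup G] [Module R G]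
    (I : Ideal R) (f : F →ₗ[R] G) {x : F} (hx : x ∈ I • (⊤ : Submodule R F)) :
    f x ∈ I • (⊤ : Submodule R G) :=
  Submodule.smul_top_le_comap_smul_top I f hx

lemma exists_functional_eq_one (F : Type*) [AddCommGroup F] [Module R F] [Module.Free R F]
    [Nontrivial F] : ∃ (ψ : F →ₗ[R] R) (y : F), ψ y = 1 := by
  let b := Module.Free.chooseBasis R F
  obtain ⟨i⟩ := b.index_nonempty
  exact ⟨b.coord i, b i, by simp⟩

section

variable {F G : Type*} [AddCommGroup F] [Module R F] [AddCommGroup G] [Module R G]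

lemma mul_mem_of_tmul_mem {I : Ideal R} {x : F} {y : G}
    (h : x ⊗ₜ[R] y ∈ I • (⊤ : Submodule R (F ⊗[R] G))) (φ : F →ₗ[R] R) (ψ : G →ₗ[R] R) :
    φ x * ψ y ∈ I := by
  have := map_mem_smul_top I (LinearMap.mul' R R ∘ₗ TensorProduct.map φ ψ) h
  simpa using this

lemma mem_smul_top_of_tmul_mem_left [Module.Free R F] [Module.Free R G] [Nontrivial G] {I : Ideal R}
    {x : F} (h : ∀ y : G, x ⊗ₜ[R] y ∈ I • (⊤ : Submodule R (F ⊗[R] G))) :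
    x ∈ I • (⊤ : Submodule R F) := by
  obtain ⟨ψ, y, hy⟩ := exists_functional_eq_one (R := R) G
  refine (mem_smul_top_iff I x).2 fun φ => ?_
  have := mul_mem_of_tmul_mem (h y) φ ψ
  rwa [hy, mul_one] at this

lemma mem_smul_top_of_tmul_mem_right [Module.Free R F] [Module.Free R G] [Nontrivial F]
    {I : Ideal R} {y : G} (h : ∀ x : F, x ⊗ₜ[R] y ∈ I • (⊤ : Submodule R (F ⊗[R] G))) :
    y ∈ I • (⊤ : Submodule R G) := by
  obtain ⟨φ, x, hx⟩ := exists_functional_eq_one (R := R) F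
  refine (mem_smul_top_iff I y).2 fun ψ => ?_
  have := mul_mem_of_tmul_mem (h x) φ ψ
  rwa [hx, one_mul] at this

end

section Local

variable [IsLocalRing R]

open IsLocalRing

variable {T A : ChainComplex (ModuleCat.{u} R) ℤ}

lemma isMinimal_pinchedTensor (hT : IsMinimal T) (hA : IsMinimal A) :
    IsMinimal (pinchedTensor T A) := by
  intro n
  have hl : ∀ p p' q (_ : p' + 1 = p) (t : T.X p) (a : A.X q), (T.d p p').hom t ⊗ₜ[R] a ∈
      maximalIdeal R • (⊤ : Submodule R (T.X p' ⊗[R] A.X q)) := fun p p' q h t a =>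
    map_mem_smul_top _ ((TensorProduct.mk R (T.X p') (A.X q)).flip a) (hT.range_le h ⟨t, rfl⟩)
  have hr : ∀ p q q' (_ : q' + 1 = q) (t : T.X p) (a : A.X q), t ⊗ₜ[R] (A.d q q').hom a ∈
      maximalIdeal R • (⊤ : Submodule R (T.X p ⊗[R] A.X q')) := fun p q q' h t a =>
    map_mem_smul_top _ (TensorProduct.mk R (T.X p) (A.X q') t) (hA.range_le h ⟨a, rfl⟩)
  change LinearMap.range (pinchedD T A (n + 1) n) ≤
    maximalIdeal R • (⊤ : Submodule R (pinchedX T A n))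
  -- The inclusion becomes the vanishing of a map to the quotient, which can be checked on pure
  -- tensors in each summand.
  rw [← Submodule.ker_mkQ (maximalIdeal R • (⊤ : Submodule R (pinchedX T A n))),
    LinearMap.range_le_ker_iff]
  refine pinchedX_hom_ext T A fun p q h => TensorProduct.ext' fun t a => ?_
  refine (Submodule.Quotient.mk_eq_zero _).2 ?_
  rw [pinchedD_ι_tmul T A (sub_add_cancel p 1) (sub_add_cancel q 1) h]
  refine add_mem (add_mem ?_ (Submodule.smul_mem _ _ ?_)) ?_
  · exact map_mem_smul_top _ _ (hl _ _ _ (by ring) t a)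
  · exact map_mem_smul_top _ _ (hr _ _ _ (by ring) t a)
  · split_ifs
    · exact map_mem_smul_top _ _ (hl _ _ _ (by ring) t _)
    · exact zero_mem _

lemma isMinimal_iff : IsMinimal T ↔ ∀ a b : ℤ, b + 1 = a → ∀ t : T.X a, (T.d a b).hom t ∈
    maximalIdeal R • (⊤ : Submodule R (T.X b)) := by
  refine ⟨fun h a b hab t => h.range_le hab ⟨t, rfl⟩, ?_⟩
  rintro h n _ ⟨t, rfl⟩
  exact h _ _ rfl t

/-- A totally acyclic complex is minimal in degree `0` if and only if its cokernel has no free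
summand. -/
lemma not_hasFreeSummand_iff_of_splice (hT : IsHomExact T R) (hTf : ∀ n, Module.Free R (T.X n))
    {M : Type u} [AddCommGroup M] [Module R M] (s : Splice T M 0 (-1)) :
    ¬ HasFreeSummand R M ↔ ∀ t : T.X 0, (T.d 0 (-1)).hom t ∈
      maximalIdeal R • (⊤ : Submodule R (T.X (-1))) := by
  rw [not_hasFreeSummand_iff]
  constructor
  · intro h t
    rw [mem_smul_top_iff]
    intro φ
    rw [← s.η_ε]
    exact h (φ ∘ₗ s.η) (s.ε t)
  · intro h f x
    obtain ⟨t, rfl⟩ := s.ε_surjective x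
    obtain ⟨g, hg⟩ := hT 1 0 (-1) rfl rfl (f ∘ₗ s.ε) (LinearMap.ext fun y => by
      simp [s.ε_d])
    rw [← LinearMap.comp_apply, ← hg]
    exact (mem_smul_top_iff _ _).1 (h t) g

/-- Away from `T_0 → T_{-1}`, the differential of `T` appears in `T ⊠ A` tensored with the nonzero
free module `A_0` or `A_{-1}`, and a functional with value `1` removes that factor. The remaining
differential is governed by free summands. -/
lemma isMinimal_of_isMinimal_pinchedTensor (hTf : ∀ n, Module.Free R (T.X n))
    (hAf : ∀ n, Module.Free R (A.X n)) (hT : IsHomExact T R) (hA : IsHomExact A R)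
    {M N : Type u} [AddCommGroup M] [Module R M] [AddCommGroup N] [Module R N]
    [Nontrivial M] [Nontrivial N] (s : Splice T M 0 (-1)) (t : Splice A N 0 (-1))
    (hMN : HasFreeSummand R M ↔ HasFreeSummand R N) (h : IsMinimal (pinchedTensor T A)) :
    IsMinimal T ∧ IsMinimal A := by
  have hT0 : Nontrivial (T.X 0) := s.ε_surjective.nontrivial
  have hA0 : Nontrivial (A.X 0) := t.ε_surjective.nontrivial
  have hT1 : Nontrivial (T.X (-1)) := s.η_injective.nontrivial
  have hA1 : Nontrivial (A.X (-1)) := t.η_injective.nontrivial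
  have key : ∀ {n m p q p' q' : ℤ}, m + 1 = n → IsIndex n p q → ∀ (x : T.X p) (y : A.X q),
      pinchedπ T A m p' q' (pinchedD T A n m (pinchedι T A n p q (x ⊗ₜ y))) ∈
        maximalIdeal R • (⊤ : Submodule R (T.X p' ⊗[R] A.X q')) :=
    fun hm _ x y => map_mem_smul_top _ _ (h.range_le hm ⟨_, rfl⟩)
  have hl : ∀ {n p p' q : ℤ}, p' + 1 = p → IsIndex n p q → IsIndex (n - 1) p' q →
      ∀ (x : T.X p) (y : A.X q), (T.d p p').hom x ⊗ₜ[R] y ∈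
        maximalIdeal R • (⊤ : Submodule R (T.X p' ⊗[R] A.X q)) := fun {n p p' q} hp h1 h2 x y => by
    have := key (p' := p') (q' := q) (sub_add_cancel n 1) h1 x y
    rwa [pinchedD_ι_tmul T A hp (sub_add_cancel q 1) h1,
      if_neg (by unfold IsIndex at h1 h2; omega), add_zero, map_add, map_smul, pinchedπ_ι T A h2,
      pinchedπ_ι_ne T A (by omega), smul_zero, add_zero] at this
  have hr : ∀ {n p q q' : ℤ}, q' + 1 = q → IsIndex n p q → IsIndex (n - 1) p q' →
      ∀ (x : T.X p) (y : A.X q), x ⊗ₜ[R] (A.d q q').hom y ∈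
        maximalIdeal R • (⊤ : Submodule R (T.X p ⊗[R] A.X q')) := fun {n p q q'} hq h1 h2 x y => by
    have := Submodule.smul_mem _ (pinchedSign p q : R)
      (key (p' := p) (q' := q') (sub_add_cancel n 1) h1 x y)
    rwa [pinchedD_ι_tmul T A (sub_add_cancel p 1) hq h1,
      if_neg (by unfold IsIndex at h1 h2; omega), add_zero, map_add, map_smul, pinchedπ_ι T A h2,
      pinchedπ_ι_ne T A (by omega), zero_add, smul_smul, pinchedSign_mul_self, one_smul] at this
  have h0 : ∀ (x : T.X 0) (y : A.X 0), (T.d 0 (-1)).hom x ⊗ₜ[R] (A.d 0 (-1)).hom y ∈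
      maximalIdeal R • (⊤ : Submodule R (T.X (-1) ⊗[R] A.X (-1))) := fun x y => by
    have hi : IsIndex 0 0 0 := by unfold IsIndex; omega
    have := key (n := 0) (m := -1) (p' := -1) (q' := -1) rfl hi x y
    rwa [pinchedπ_d_zero, pinchedπ_ι T A hi, TensorProduct.map_tmul] at this
  have hsT := not_hasFreeSummand_iff_of_splice hT hTf s
  have hsA := not_hasFreeSummand_iff_of_splice hA hAf t
  -- If both modules had free summands, `d x` and `d y` would have unit values under some
  -- functionals, and so would `d x ⊗ d y`, against minimality in degree `-1`. The equivalence `hMN`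
  -- excludes that only one of them has.
  have hM : ¬ HasFreeSummand R M := by
    intro hM
    obtain ⟨x, hx⟩ := not_forall.1 (mt hsT.2 (not_not.2 hM))
    obtain ⟨y, hy⟩ := not_forall.1 (mt hsA.2 (not_not.2 (hMN.1 hM)))
    rw [mem_smul_top_iff] at hx hy
    obtain ⟨φ, hφ⟩ := not_forall.1 hx
    obtain ⟨ψ, hψ⟩ := not_forall.1 hy
    exact ((maximalIdeal.isMaximal R).isPrime.mem_or_mem
      (mul_mem_of_tmul_mem (h0 x y) φ ψ)).elim hφ hψ
  have hN : ¬ HasFreeSummand R N := mt hMN.2 hM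
  rw [isMinimal_iff, isMinimal_iff]
  constructor
  · intro a b hab x
    obtain hb | rfl | hb := lt_trichotomy b (-1)
    · exact mem_smul_top_of_tmul_mem_left
        (hl (n := a) (q := -1) hab (by unfold IsIndex; omega) (by unfold IsIndex; omega) x)
    · obtain rfl : a = 0 := by omega
      exact hsT.1 hM x
    · exact mem_smul_top_of_tmul_mem_left
        (hl (n := a) (q := 0) hab (by unfold IsIndex; omega) (by unfold IsIndex; omega) x)
  · intro a b hab y
    obtain hb | rfl | hb := lt_trichotomy b (-1)
    · exact mem_smul_top_of_tmul_mem_right fun x =>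
        hr (n := a) (p := -1) hab (by unfold IsIndex; omega) (by unfold IsIndex; omega) x y
    · obtain rfl : a = 0 := by omega
      exact hsA.1 hN y
    · exact mem_smul_top_of_tmul_mem_right fun x =>
        hr (n := a) (p := 0) hab (by unfold IsIndex; omega) (by unfold IsIndex; omega) x y

end Local

end

section

/-! ### Stable Betti numbers of tensor products -/

section Local

variable [IsLocalRing R]

/-- A projective module and the zero module are retracts of each other up to projective summands, so
the zero complex computes the ranks. -/
lemma stableBetti_eq_zero {M : Type u} [AddCommGroup M] [Module R M] [Module.Projective R M]
    (hM : HasMinimalCompleteResolution R M) (n : ℤ) : stableBetti R M n = 0 := by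
  let U : ChainComplex (ModuleCat.{u} R) ℤ :=
    ChainComplex.of (fun _ => ModuleCat.of R PUnit.{u + 1}) (fun _ => 0) fun _ => Limits.comp_zero
  have hU : ∀ n, Subsingleton (U.X n) := fun _ => inferInstanceAs (Subsingleton PUnit.{u + 1})
  have hfin : ∀ n, Module.Finite R (U.X n) := fun _ =>
    inferInstanceAs (Module.Finite R PUnit.{u + 1})
  have hfree : ∀ n, Module.Free R (U.X n) := fun _ =>
    inferInstanceAs (Module.Free R PUnit.{u + 1})
  have hta : IsTotallyAcyclic U := (isTotallyAcyclic_iff hfin).2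
    ⟨fun n => have := hfree n; inferInstance,
      fun _ _ _ _ _ _ _ => ⟨0, Subsingleton.elim _ _⟩,
      fun _ _ _ _ _ _ _ => ⟨0, LinearMap.ext fun x => by
        rw [Subsingleton.elim x 0, map_zero, map_zero]⟩⟩
  have hmin : IsMinimal U := isMinimal_iff.2 fun a b _ t => by
    rw [Subsingleton.elim ((U.d a b).hom t) 0]
    exact zero_mem _
  have hC : Subsingleton (Coker U 0) := (Submodule.mkQ_surjective _).subsingleton
  have : Module.Free R (Coker U 0) := Module.Free.of_subsingleton R _
  rw [stableBetti_eq hM hta hmin hfin hfree .of_projective .of_projective]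
  exact Module.finrank_zero_of_subsingleton

lemma hasFreeSummand_of_free (N : Type u) [AddCommGroup N] [Module R N] [Module.Free R N]
    [Nontrivial N] : HasFreeSummand R N := by
  obtain ⟨ψ, y, h⟩ := exists_functional_eq_one (R := R) N
  exact hasFreeSummand_iff.2 ⟨ψ, y, by rw [h, ← Ideal.ne_top_iff_one]; exact Ideal.IsPrime.ne_top'⟩

variable {M N : Type u} [AddCommGroup M] [Module R M] [AddCommGroup N]
  [Module R N]

/-- A free summand in one module makes the other free. If the latter is zero, so is the tensor
product; otherwise it has a free summand itself, and both modules are free. -/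
lemma stableBetti_tensorProduct_of_free (hM : HasMinimalCompleteResolution R M)
    (hN : HasMinimalCompleteResolution R N) (hMN : HasMinimalCompleteResolution R (M ⊗[R] N))
    (h1 : HasFreeSummand R M → Module.Free R N) (h2 : HasFreeSummand R N → Module.Free R M)
    (h : HasFreeSummand R M ∨ HasFreeSummand R N) (i j k : ℤ) :
    stableBetti R (M ⊗[R] N) i = 0 ∧ stableBetti R M j * stableBetti R N k = 0 := by
  obtain h | h := h
  · have := h1 h
    refine ⟨?_, by rw [stableBetti_eq_zero hN, mul_zero]⟩
    obtain h3 | h3 := subsingleton_or_nontrivial N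
    · have : Module.Free R (M ⊗[R] N) := Module.Free.of_subsingleton R _
      exact stableBetti_eq_zero hMN i
    · have := h2 (hasFreeSummand_of_free N)
      exact stableBetti_eq_zero hMN i
  · have := h2 h
    refine ⟨?_, by rw [stableBetti_eq_zero hM, zero_mul]⟩
    obtain h3 | h3 := subsingleton_or_nontrivial M
    · have : Module.Free R (M ⊗[R] N) := Module.Free.of_subsingleton R _
      exact stableBetti_eq_zero hMN i
    · have := h1 (hasFreeSummand_of_free M)
      exact stableBetti_eq_zero hMN i

variable [IsNoetherianRing R]

/-- Without free summands, minimal complete resolutions of `M` and `N` have a pinched tensor product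
that is a minimal complete resolution of `M ⊗ N`. -/
lemma exists_minimal_pinchedTensor (hM : IsTotallyReflexive R M) (hN : IsTotallyReflexive R N)
    (hMN : IsTotallyReflexive R (M ⊗[R] N)) {T : ChainComplex (ModuleCat.{u} R) ℤ}
    (hT : IsCompleteResolutionOf T M) (hTor : IsExact (tensorComplex T N))
    (hM' : ¬ HasFreeSummand R M) (hN' : ¬ HasFreeSummand R N) :
    ∃ T₁ T₂ : ChainComplex (ModuleCat.{u} R) ℤ,
      (∀ n, stableBetti R M n = Module.finrank R (T₁.X n)) ∧
      (∀ n, stableBetti R N n = Module.finrank R (T₂.X n)) ∧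
      (∀ n, stableBetti R (M ⊗[R] N) n = Module.finrank R ((pinchedTensor T₁ T₂).X n)) ∧
      (∀ n, Module.Free R (T₁.X n)) ∧ (∀ n, Module.Free R (T₂.X n)) ∧
      (∀ n, Module.Finite R (T₁.X n)) ∧ (∀ n, Module.Finite R (T₂.X n)) := by
  obtain ⟨T₁, hT₁, hm₁, hf₁, hfin₁, ⟨e₁⟩⟩ := hM.exists_minimal_totallyAcyclic hM' 0
  obtain ⟨T₂, hT₂, hm₂, hf₂, hfin₂, ⟨e₂⟩⟩ := hN.exists_minimal_totallyAcyclic hN' 0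
  obtain ⟨e⟩ := hT.coker_equiv
  have s₁ := hT₁.isExact.splice (a := 0) (b := -1) rfl e₁
  have s₂ := hT₂.isExact.splice (a := 0) (b := -1) rfl e₂
  -- The vanishing of Tate homology is given for `T`, which need not be minimal, and is transferred
  -- to `T₁`.
  have hL : IsExact (pinchedTensor T₁ T₂) :=
    (isExact_pinchedTensor_iff (fun n => have := hf₁ n; inferInstance) hT₂.isExact s₂).2
      (hT.totallyAcyclic.isExact_tensorComplex hT₁ (.of_equiv (e₁.trans e.symm)) N hTor)
  obtain ⟨e'⟩ := nonempty_coker_pinchedTensor s₁ s₂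
  have hLf := free_pinchedTensor hf₁ hf₂
  have hLfin := finite_pinchedTensor hfin₁ hfin₂
  have hLP : ∀ n, Module.Projective R ((pinchedTensor T₁ T₂).X n) := fun n =>
    have := hLf n; inferInstance
  have hLT : IsTotallyAcyclic (pinchedTensor T₁ T₂) := (isTotallyAcyclic_iff hLfin).2
    ⟨hLP, hL, isHomExact_of_isTotallyReflexive hLfin hLP hL (hMN.of_equiv e'.symm)⟩
  exact ⟨T₁, T₂,
    stableBetti_eq hM.hasMinimalCompleteResolution hT₁ hm₁ hfin₁ hf₁ (.of_equiv e₁)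
      (.of_equiv e₁.symm),
    stableBetti_eq hN.hasMinimalCompleteResolution hT₂ hm₂ hfin₂ hf₂ (.of_equiv e₂)
      (.of_equiv e₂.symm),
    stableBetti_eq hMN.hasMinimalCompleteResolution hLT (isMinimal_pinchedTensor hm₁ hm₂) hLfin hLf
      (.of_equiv e') (.of_equiv e'.symm), hf₁, hf₂, hfin₁, hfin₂⟩

end Local

end

end Pinched

end

/-! ### The theorem on pinched tensor products -/

theorem mainTheorem5 {R : Type u} [CommRing R] [IsLocalRing R] [IsNoetherianRing R]
    (M N : Type u) [AddCommGroup M] [Module R M] [AddCommGroup N] [Module R N]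
    (hM : Pinched.IsTotallyReflexive R M) (hN : Pinched.IsTotallyReflexive R N)
    (T T' : ChainComplex (ModuleCat.{u} R) ℤ)
    (hT : Pinched.IsCompleteResolutionOf T M) (hT' : Pinched.IsCompleteResolutionOf T' N)
    (hTfin : ∀ n, Module.Finite R (T.X n)) (hTfin' : ∀ n, Module.Finite R (T'.X n))
    (hTor : ∀ i : ℤ, Limits.IsZero (Pinched.tateTor T N i)) :
    (∀ n, Module.Free R ((Pinched.pinchedTensor T T').X n) ∧
      Module.Finite R ((Pinched.pinchedTensor T T').X n)) ∧
    (Pinched.pinchedTensor T T').Acyclic ∧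
    Nonempty (Pinched.Coker (Pinched.pinchedTensor T T') 0 ≃ₗ[R] (M ⊗[R] N)) ∧
    List.TFAE [
      Pinched.IsTotallyAcyclic (Pinched.pinchedTensor T T'),
      ∀ i : ℤ, Limits.IsZero (Pinched.tateExt T (Module.Dual R N) i),
      Pinched.IsTotallyReflexive R (M ⊗[R] N)] ∧
    (Pinched.IsTotallyAcyclic (Pinched.pinchedTensor T T') →
      Pinched.IsCompleteResolutionOf (Pinched.pinchedTensor T T') (M ⊗[R] N) ∧
      (Pinched.IsMinimal T ∧ Pinched.IsMinimal T' →
        Pinched.IsMinimal (Pinched.pinchedTensor T T')) ∧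
      (Nontrivial M → Nontrivial N →
        (Pinched.HasFreeSummand R M ↔ Pinched.HasFreeSummand R N) →
        Pinched.IsMinimal (Pinched.pinchedTensor T T') →
        Pinched.IsMinimal T ∧ Pinched.IsMinimal T') ∧
      ((Pinched.HasFreeSummand R M → Module.Free R N) →
        (Pinched.HasFreeSummand R N → Module.Free R M) →
        Pinched.HasMinimalCompleteResolution R M ∧
        Pinched.HasMinimalCompleteResolution R N ∧
        Pinched.HasMinimalCompleteResolution R (M ⊗[R] N) ∧
        (∀ i : ℤ, 0 ≤ i → Pinched.stableBetti R (M ⊗[R] N) i =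
          ∑ j ∈ Finset.Icc 0 i, Pinched.stableBetti R M j * Pinched.stableBetti R N (i - j)) ∧
        (∀ i : ℤ, i < 0 → Pinched.stableBetti R (M ⊗[R] N) i =
          ∑ j ∈ Finset.Ico i 0,
            Pinched.stableBetti R M j * Pinched.stableBetti R N (i - j - 1)))) := by
  have hTf : ∀ n, Module.Free R (T.X n) := fun n =>
    have := hT.totallyAcyclic.projective n
    Module.free_of_flat_of_isLocalRing
  have hTf' : ∀ n, Module.Free R (T'.X n) := fun n =>
    have := hT'.totallyAcyclic.projective n
    Module.free_of_flat_of_isLocalRing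
  obtain ⟨e⟩ := hT.coker_equiv
  obtain ⟨e'⟩ := hT'.coker_equiv
  have s := hT.totallyAcyclic.isExact.splice (a := 0) (b := -1) rfl e
  have s' := hT'.totallyAcyclic.isExact.splice (a := 0) (b := -1) rfl e'
  have hTor' : Pinched.IsExact (Pinched.tensorComplex T N) :=
    (Pinched.acyclic_iff _).1 ((Pinched.acyclic_iff_isZero _).1 hTor)
  have hL : Pinched.IsExact (Pinched.pinchedTensor T T') :=
    (Pinched.isExact_pinchedTensor_iff (fun n => inferInstance) hT'.totallyAcyclic.isExact s').2
      hTor'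
  have hLf := Pinched.free_pinchedTensor hTf hTf'
  have hLfin := Pinched.finite_pinchedTensor hTfin hTfin'
  have hLP : ∀ n, Module.Projective R ((Pinched.pinchedTensor T T').X n) := fun n =>
    have := hLf n
    inferInstance
  obtain ⟨θ⟩ := Pinched.nonempty_coker_pinchedTensor s s'
  have h12 : Pinched.IsTotallyAcyclic (Pinched.pinchedTensor T T') ↔
      ∀ i : ℤ, Limits.IsZero (Pinched.tateExt T (Module.Dual R N) i) := by
    rw [Pinched.isTotallyAcyclic_iff hLfin, and_iff_right hLP, and_iff_right hL,
      Pinched.isHomExact_pinchedTensor_iff hT.totallyAcyclic.projective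
        (hT'.totallyAcyclic.isHomExact R) s', ← Pinched.homComplex_acyclic_iff,
      ← Pinched.acyclic_iff_isZero]
    -- Tate cohomology in degree `i` is homology in degree `-i`.
    exact ((Equiv.neg ℤ).forall_congr_left (p := fun i =>
      Limits.IsZero ((Pinched.homComplex T (Module.Dual R N)).homology i)))
  have h13 : Pinched.IsTotallyAcyclic (Pinched.pinchedTensor T T') ↔
      Pinched.IsTotallyReflexive R (M ⊗[R] N) := by
    constructor
    · intro h
      exact .of_equiv θ
        (Pinched.isTotallyReflexive_coker hLfin hLP h.isExact (h.isHomExact R) 0)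
    · intro h
      exact (Pinched.isTotallyAcyclic_iff hLfin).2 ⟨hLP, hL,
        Pinched.isHomExact_of_isTotallyReflexive hLfin hLP hL (h.of_equiv θ.symm)⟩
  refine ⟨fun n => ⟨hLf n, hLfin n⟩, (Pinched.acyclic_iff _).2 hL, ⟨θ⟩, ?_, fun h => ?_⟩
  · tfae_have 1 ↔ 2 := h12
    tfae_have 1 ↔ 3 := h13
    tfae_finish
  refine ⟨⟨h, ⟨θ⟩⟩, fun hmin => Pinched.isMinimal_pinchedTensor hmin.1 hmin.2,
    fun _ _ hMN hmin => Pinched.isMinimal_of_isMinimal_pinchedTensor hTf hTf'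
      (hT.totallyAcyclic.isHomExact R) (hT'.totallyAcyclic.isHomExact R) s s' hMN hmin,
    fun h1 h2 => ?_⟩
  have hMN := h13.1 h
  have bM := hM.hasMinimalCompleteResolution
  have bN := hN.hasMinimalCompleteResolution
  have bMN := hMN.hasMinimalCompleteResolution
  refine ⟨bM, bN, bMN, ?_⟩
  -- With a free summand both sides of the formulas are zero. Without one, minimal resolutions with
  -- cokernels `M` and `N` in degree `0` replace `T` and `T'`, and the ranks of their pinched tensor
  -- product are counted.
  by_cases hfree : Pinched.HasFreeSummand R M ∨ Pinched.HasFreeSummand R N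
  · have h0 := Pinched.stableBetti_tensorProduct_of_free bM bN bMN h1 h2 hfree
    exact ⟨fun i _ => (h0 i 0 0).1.trans (Finset.sum_eq_zero fun j _ => (h0 0 _ _).2).symm,
      fun i _ => (h0 i 0 0).1.trans (Finset.sum_eq_zero fun j _ => (h0 0 _ _).2).symm⟩
  · obtain ⟨hM', hN'⟩ := not_or.1 hfree
    obtain ⟨T₁, T₂, e₁, e₂, e₃, hf₁, hf₂, hfin₁, hfin₂⟩ :=
      Pinched.exists_minimal_pinchedTensor hM hN hMN hT hTor' hM' hN'
    simp only [e₁, e₂, e₃]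
    exact ⟨fun i hi => Pinched.finrank_pinchedTensor_of_nonneg hf₁ hf₂ hfin₁ hfin₂ hi,
      fun i hi => Pinched.finrank_pinchedTensor_of_neg hf₁ hf₂ hfin₁ hfin₂ hi⟩
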